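/- **Conventions.** A relation algebra (RA) is an algebra $(Q,+,\cdot,-,0,1,;,\breve{\ },1')$ satisfying Tarski's axioms. Elements $p,q$ of $Q$ are *quasi-projections* if $\breve p;p\le 1'$, $\breve q;q\le 1'$ and $\breve p;q=1$; $\mathsf{QRA}$ is the class of relation algebras that have a pair of quasi-projections. $\mathsf{CA}_n$ ($n\le\omega$) is the class of cylindric algebras of dimension $n$, $s^i_jx=c_i(d_{ij}\cdot x)$ for $i\ne j$, and $\mathsf{Lf}_\omega$ is the class of locally finite $A\in\mathsf{CA}_\omega$ (each $\{k: c_kx\neq x\}$ is finite). For $C\in\mathsf{CA}_n$, $\mathfrak{Nr}_3C$ is the 3-dimensional cylindric algebra of all $x\in C$ with $c_kx=x$ for all $k\ge 3$, and $S\,\mathsf{Nr}_3\mathsf{CA}_n$ is the class of algebras embeddable into some $\mathfrak{Nr}_3C$, $C\in\mathsf{CA}_n$. For distinct $i,j,k$ the *relation algebra reduct* $\mathfrak{Ra}A$ on the coordinates $i,j$ with spare coordinate $k$ has as elements the $x\in A$ with $c_lx=x$ for all $l\ne i,j$, the Boolean operations of $A$, $1'=d_{ij}$, $x;y=c_k(s^j_kx\cdot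 s^i_ky)$ and $\breve x=s^k_is^i_js^j_kx$; take $(i,j,k)=(1,2,0)$ for $A$ of dimension 3 and $(0,1,2)$ for $A\in\mathsf{CA}_\omega$. $\mathfrak{Sg}^AX$ denotes the subalgebra of $A$ generated by $X$. "$Q=\mathfrak{Ra}A$" means that an isomorphism $e:Q\to\mathfrak{Ra}A$ is given, along which $Q$ is identified with $\mathfrak{Ra}A$. **Theorem.** 1. Let $Q\in\mathsf{QRA}$ and $4\le n\le\omega$. There is an $A\in S\,\mathsf{Nr}_3\mathsf{CA}_n$ such that $Q=\mathfrak{Ra}A$, $A=\mathfrak{Sg}^AQ$, and $\mathfrak{Sg}^QX=\mathfrak{Ra}\,\mathfrak{Sg}^AX$ for all $X\subseteq Q$. It is unique: if $B$ is another such algebra, there is exactly one isomorphism $A\to B$ that is the identity on $Q$. Moreover, for every $B\in S\,\mathsf{Nr}_3\mathsf{CA}_n$ with $Q=\mathfrak{Ra}B$ there is exactly one embedding $A\to B$ that is the identity on $Q$. 2. Let $4\le n\le\omega$ and let $A,B\in S\,\mathsf{Nr}_3\mathsf{CA}_n$ be generated by $\mathfrak{Ra}A$ and $\mathfrak{Ra}B$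 respectively, with $\mathfrak{Ra}A\in\mathsf{QRA}$. Every isomorphism $\mathfrak{Ra}A\to\mathfrak{Ra}B$ extends to exactly one isomorphism $A\to B$. 3. Every $Q\in\mathsf{QRA}$ has an $\omega$-dilation: an $A\in\mathsf{Lf}_\omega$ with $Q=\mathfrak{Ra}A$, $A=\mathfrak{Sg}^AQ$, and $\mathfrak{Sg}^QX=\mathfrak{Ra}\,\mathfrak{Sg}^AX$ for all $X\subseteq Q$ that contain a pair of quasi-projections. For every $B\in\mathsf{Lf}_\omega$ with $Q=\mathfrak{Ra}B$ there is exactly one isomorphism $A\to B$ that is the identity on $Q$. 4. $\mathfrak{Ra}$ is an equivalence from the full subcategory $\{A\in\mathsf{Lf}_\omega:\mathfrak{Ra}A\in\mathsf{QRA}\}$ of $\mathsf{Lf}_\omega$ to $\mathsf{QRA}$ (all homomorphisms in both cases). It is also an equivalence from the category of algebras $A\in\mathsf{Lf}_\omega$ with a distinguished pair of quasi-projections in $\mathfrak{Ra}A\in\mathsf{QRA}$, and homomorphisms preserving this pair, to the category of relation algebras with a distinguished pair of quasi-projections, and homomorphisms preserving the pair. The former of these two categories is reflective over $\mathsf{Lf}_\omega$: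 its forgetful functor to $\mathsf{Lf}_\omega$ is faithful and has a left adjoint. -/

import Mathlib

open CategoryTheory

universe u v w

/-! ## Relation algebras -/

/-- The non-Boolean operations of the similarity type of relation algebras: composition `x ; y`,
converse and the identity constant `1'`. -/
class RelOps (R : Type u) where
  comp : R → R → R
  conv : R → R
  ident : R

open RelOps

/-- Tarski's axioms for relation algebras. -/
structure IsRelAlg (R : Type u) [BooleanAlgebra R] [RelOps R] : Prop where
  comp_assoc : ∀ x y z : R, comp (comp x y) z = comp x (comp y z)
  sup_comp : ∀ x y z : R, comp (x ⊔ y) z = comp x z ⊔ comp y z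
  comp_ident : ∀ x : R, comp x ident = x
  conv_conv : ∀ x : R, conv (conv x) = x
  conv_sup : ∀ x y : R, conv (x ⊔ y) = conv x ⊔ conv y
  conv_comp : ∀ x y : R, conv (comp x y) = comp (conv y) (conv x)
  tarski : ∀ x y : R, comp (conv x) (comp x y)ᶜ ≤ yᶜ

/-- `p`, `q` are quasi-projections. -/
structure IsQuasiProj {R : Type u} [BooleanAlgebra R] [RelOps R] (p q : R) : Prop where
  fst_functional : comp (conv p) p ≤ ident
  snd_functional : comp (conv q) q ≤ ident
  pairing : comp (conv p) q = ⊤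

/-- `R` is a quasi-projective relation algebra. -/
def IsQRA (R : Type u) [BooleanAlgebra R] [RelOps R] : Prop :=
  IsRelAlg R ∧ ∃ p q : R, IsQuasiProj p q

/-- Homomorphisms of algebras of the similarity type of relation algebras. -/
structure RAHom (R : Type u) (S : Type v) [BooleanAlgebra R] [RelOps R]
    [BooleanAlgebra S] [RelOps S] extends BoundedLatticeHom R S where
  map_comp' : ∀ x y : R,
    toBoundedLatticeHom (comp x y) = comp (toBoundedLatticeHom x) (toBoundedLatticeHom y)
  map_conv' : ∀ x : R, toBoundedLatticeHom (conv x) = conv (toBoundedLatticeHom x)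
  map_ident' : toBoundedLatticeHom (ident : R) = ident

instance {R : Type u} {S : Type v} [BooleanAlgebra R] [RelOps R] [BooleanAlgebra S] [RelOps S] :
    CoeFun (RAHom R S) (fun _ => R → S) :=
  ⟨fun f => f.toBoundedLatticeHom⟩

theorem RAHom.ext' {R : Type u} {S : Type v} [BooleanAlgebra R] [RelOps R] [BooleanAlgebra S]
    [RelOps S] {f g : RAHom R S} (h : ∀ x, f x = g x) : f = g := by
  obtain ⟨f, _, _, _⟩ := f
  obtain ⟨g, _, _, _⟩ := g
  obtain rfl : f = g := DFunLike.ext _ _ h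
  rfl

def RAHom.id (R : Type u) [BooleanAlgebra R] [RelOps R] : RAHom R R where
  toBoundedLatticeHom := BoundedLatticeHom.id R
  map_comp' _ _ := rfl
  map_conv' _ := rfl
  map_ident' := rfl

def RAHom.trans {R : Type u} {S : Type v} {T : Type w} [BooleanAlgebra R] [RelOps R]
    [BooleanAlgebra S] [RelOps S] [BooleanAlgebra T] [RelOps T]
    (f : RAHom R S) (g : RAHom S T) : RAHom R T where
  toBoundedLatticeHom := g.toBoundedLatticeHom.comp f.toBoundedLatticeHom
  map_comp' x y := by simp [f.map_comp', g.map_comp']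
  map_conv' x := by simp [f.map_conv', g.map_conv']
  map_ident' := by simp [f.map_ident', g.map_ident']

/-- Membership in the subalgebra of `R` generated by `X`. -/
inductive RelGen {R : Type u} [BooleanAlgebra R] [RelOps R] (X : Set R) : R → Prop
  | base {x : R} : x ∈ X → RelGen X x
  | bot : RelGen X ⊥
  | top : RelGen X ⊤
  | sup {x y : R} : RelGen X x → RelGen X y → RelGen X (x ⊔ y)
  | inf {x y : R} : RelGen X x → RelGen X y → RelGen X (x ⊓ y)
  | compl {x : R} : RelGen X x → RelGen X xᶜ
  | comp {x y : R} : RelGen X x → RelGen X y → RelGen X (comp x y)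
  | conv {x : R} : RelGen X x → RelGen X (conv x)
  | ident : RelGen X ident

/-- The universe of the subalgebra of `R` generated by `X`. -/
def relSg {R : Type u} [BooleanAlgebra R] [RelOps R] (X : Set R) : Set R := {x | RelGen X x}

/-! ## Cylindric algebras -/

/-- The non-Boolean operations and the axioms of cylindric algebras whose dimension is the
index set `I`. -/
class CylAlg (I : Type w) (A : Type u) [BooleanAlgebra A] where
  /-- cylindrifications -/
  c : I → A → A
  /-- diagonal elements -/
  d : I → I → A
  c_bot : ∀ i, c i ⊥ = ⊥
  le_c : ∀ i x, x ≤ c i x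
  c_inf_c : ∀ i x y, c i (x ⊓ c i y) = c i x ⊓ c i y
  c_comm : ∀ i j x, c i (c j x) = c j (c i x)
  d_self : ∀ i, d i i = ⊤
  d_trans : ∀ i j k, k ≠ i → k ≠ j → d i j = c k (d i k ⊓ d k j)
  d_subst : ∀ i j x, i ≠ j → c i (d i j ⊓ x) ⊓ c i (d i j ⊓ xᶜ) = ⊥

namespace CylAlg

variable {I : Type w} {A : Type u} [BooleanAlgebra A] [CylAlg I A]

theorem c_c (i : I) (x : A) : c i (c i x) = c i x := by
  have h := c_inf_c i (⊤ : A) x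
  have ht : c i (⊤ : A) = ⊤ := top_le_iff.1 (le_c i ⊤)
  simpa [ht] using h

theorem c_compl_of_fixed {i : I} {x : A} (h : c i x = x) : c i xᶜ = xᶜ := by
  refine le_antisymm ?_ (le_c i _)
  have h1 := c_inf_c i xᶜ x
  rw [h, inf_comm, inf_compl_eq_bot, c_bot] at h1
  exact (disjoint_iff.2 h1.symm).le_compl_right

theorem c_inf_of_fixed {i : I} {x y : A} (hy : c i y = y) : c i (x ⊓ y) = c i x ⊓ y := by
  have h := c_inf_c i x y
  rwa [hy] at h

theorem c_sup_of_fixed {i : I} {x y : A} (hx : c i x = x) (hy : c i y = y) :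
    c i (x ⊔ y) = x ⊔ y := by
  have h : c i (xᶜ ⊓ yᶜ) = xᶜ ⊓ yᶜ := by
    rw [c_inf_of_fixed (c_compl_of_fixed hy), c_compl_of_fixed hx]
  simpa [compl_inf] using c_compl_of_fixed h

theorem c_d (i j k : I) (hi : k ≠ i) (hj : k ≠ j) : c k (d i j : A) = d i j := by
  rw [d_trans i j k hi hj, c_c]

variable (A) in
/-- The Boolean subalgebra of the elements `x` with `c k x = x` for all `k ∈ K`. -/
def fixedBy (K : Set I) : BooleanSubalgebra A where
  carrier := {x | ∀ k ∈ K, c k x = x}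
  supClosed' _ hx _ hy k hk := c_sup_of_fixed (hx k hk) (hy k hk)
  infClosed' _ hx _ hy k hk := by rw [c_inf_of_fixed (hy k hk), hx k hk]
  compl_mem' h k hk := c_compl_of_fixed (h k hk)
  bot_mem' k _ := c_bot k

/-- The substitution operation replacing the index `i` by `j`; used for `i ≠ j` only. -/
def s (i j : I) (x : A) : A := c i (d i j ⊓ x)

theorem c_s_of_fixed {i j l : I} {x : A} (hi : l ≠ i) (hj : l ≠ j) (hx : c l x = x) :
    c l (s i j x) = s i j x := by
  rw [s, c_comm, c_inf_of_fixed hx, c_d i j l hi hj]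

theorem c_s_self (i j : I) (x : A) : c i (s i j x) = s i j x := c_c _ _

end CylAlg

open CylAlg

/-- Homomorphisms of cylindric algebras of dimension `I`. -/
structure CylHom (I : Type w) (A : Type u) (B : Type v) [BooleanAlgebra A] [CylAlg I A]
    [BooleanAlgebra B] [CylAlg I B] extends BoundedLatticeHom A B where
  map_c' : ∀ (i : I) (x : A), toBoundedLatticeHom (c i x) = c i (toBoundedLatticeHom x)
  map_d' : ∀ i j : I, toBoundedLatticeHom (d i j : A) = d i j

instance {I : Type w} {A : Type u} {B : Type v} [BooleanAlgebra A] [CylAlg I A]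
    [BooleanAlgebra B] [CylAlg I B] : CoeFun (CylHom I A B) (fun _ => A → B) :=
  ⟨fun f => f.toBoundedLatticeHom⟩

theorem CylHom.ext' {I : Type w} {A : Type u} {B : Type v} [BooleanAlgebra A] [CylAlg I A]
    [BooleanAlgebra B] [CylAlg I B] {f g : CylHom I A B} (h : ∀ x, f x = g x) : f = g := by
  obtain ⟨f, _, _⟩ := f
  obtain ⟨g, _, _⟩ := g
  obtain rfl : f = g := DFunLike.ext _ _ h
  rfl

def CylHom.id (I : Type w) (A : Type u) [BooleanAlgebra A] [CylAlg I A] : CylHom I A A where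
  toBoundedLatticeHom := BoundedLatticeHom.id A
  map_c' _ _ := rfl
  map_d' _ _ := rfl

def CylHom.trans {I : Type w} {A B C : Type u} [BooleanAlgebra A] [CylAlg I A]
    [BooleanAlgebra B] [CylAlg I B] [BooleanAlgebra C] [CylAlg I C]
    (f : CylHom I A B) (g : CylHom I B C) : CylHom I A C where
  toBoundedLatticeHom := g.toBoundedLatticeHom.comp f.toBoundedLatticeHom
  map_c' i x := by simp [f.map_c', g.map_c']
  map_d' i j := by simp [f.map_d', g.map_d']

theorem CylHom.map_s {I : Type w} {A : Type u} {B : Type v} [BooleanAlgebra A] [CylAlg I A]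
    [BooleanAlgebra B] [CylAlg I B] (f : CylHom I A B) (i j : I) (x : A) :
    f (s i j x) = s i j (f x) := by
  simp [s, f.map_c', f.map_d']

/-- Membership in the subalgebra of the cylindric algebra `A` generated by `X`. -/
inductive CylGen (I : Type w) {A : Type u} [BooleanAlgebra A] [CylAlg I A] (X : Set A) : A → Prop
  | base {x : A} : x ∈ X → CylGen I X x
  | bot : CylGen I X ⊥
  | top : CylGen I X ⊤
  | sup {x y : A} : CylGen I X x → CylGen I X y → CylGen I X (x ⊔ y)
  | inf {x y : A} : CylGen I X x → CylGen I X y → CylGen I X (x ⊓ y)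
  | compl {x : A} : CylGen I X x → CylGen I X xᶜ
  | cyl (i : I) {x : A} : CylGen I X x → CylGen I X (c i x)
  | diag (i j : I) : CylGen I X (d i j)

/-- The universe of the subalgebra of the cylindric algebra `A` generated by `X`. -/
def cylSg (I : Type w) {A : Type u} [BooleanAlgebra A] [CylAlg I A] (X : Set A) : Set A :=
  {x | CylGen I X x}

/-! ## Relation algebra reducts -/

/-- The relation algebra reduct of a cylindric algebra `A`, formed on the coordinates `i`, `j`
with spare coordinate `k`: its elements are the `x` with `c l x = x` for all `l ≠ i, j`. -/
def Ra {I : Type w} (i j _k : I) (A : Type u) [BooleanAlgebra A] [CylAlg I A] : Type u :=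
  fixedBy A {l : I | l ≠ i ∧ l ≠ j}

section Ra

variable {I : Type w} (i j k : I) (A : Type u) [BooleanAlgebra A] [CylAlg I A]

instance : BooleanAlgebra (Ra i j k A) :=
  inferInstanceAs (BooleanAlgebra (fixedBy A {l : I | l ≠ i ∧ l ≠ j}))

/-- `1' = d i j`, `x ; y = c k (s j k x · s i k y)`, and the converse of `x` is
`s k i (s i j (s j k x))`. -/
instance : RelOps (Ra i j k A) where
  comp x y := ⟨c k (s j k x.1 ⊓ s i k y.1), by
    rintro l ⟨hi, hj⟩
    by_cases hk : l = k
    · subst hk; exact c_c _ _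
    · rw [c_comm, c_inf_of_fixed (c_s_of_fixed hi hk (y.2 l ⟨hi, hj⟩)),
        c_s_of_fixed hj hk (x.2 l ⟨hi, hj⟩)]⟩
  conv x := ⟨s k i (s i j (s j k x.1)), by
    rintro l ⟨hi, hj⟩
    by_cases hk : l = k
    · subst hk; exact c_s_self _ _ _
    · exact c_s_of_fixed hk hi (c_s_of_fixed hi hj (c_s_of_fixed hj hk (x.2 l ⟨hi, hj⟩)))⟩
  ident := ⟨d i j, fun l hl => c_d i j l hl.1 hl.2⟩

variable {A} {i j k}

/-- An element of the reduct, as an element of the cylindric algebra. -/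
def Ra.val (x : Ra i j k A) : A := x.1

theorem Ra.ext {x y : Ra i j k A} (h : x.val = y.val) : x = y := Subtype.ext h

/-- The restriction of a homomorphism of cylindric algebras to the relation algebra reducts. -/
def CylHom.ra {B : Type v} [BooleanAlgebra B] [CylAlg I B] (f : CylHom I A B) :
    RAHom (Ra i j k A) (Ra i j k B) where
  toFun x := ⟨f x.1, fun l hl => by
    have h := f.map_c' l x.1
    rw [x.2 l hl] at h
    exact h.symm⟩
  map_sup' x y := Subtype.ext (map_sup f.toBoundedLatticeHom x.1 y.1)
  map_inf' x y := Subtype.ext (map_inf f.toBoundedLatticeHom x.1 y.1)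
  map_top' := Subtype.ext (map_top f.toBoundedLatticeHom)
  map_bot' := Subtype.ext (map_bot f.toBoundedLatticeHom)
  map_comp' x y := Subtype.ext (by
    change f (c k (s j k x.1 ⊓ s i k y.1)) = c k (s j k (f x.1) ⊓ s i k (f y.1))
    simp only [f.map_c', map_inf, f.map_s])
  map_conv' x := Subtype.ext (by
    change f (s k i (s i j (s j k x.1))) = s k i (s i j (s j k (f x.1)))
    simp only [f.map_s])
  map_ident' := Subtype.ext (f.map_d' i j)

end Ra

/-! ## Dimensions `n ≤ ω` and neat reducts -/

/-- The index set `{k | k < n}` of dimension `n ≤ ω`; `⊤ : ℕ∞` stands for `ω`. -/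
@[ext] structure Dim (n : ℕ∞) : Type where
  val : ℕ
  lt : (val : ℕ∞) < n

/-- The inclusion of index sets. -/
def Dim.incl {m n : ℕ∞} (h : m ≤ n) (i : Dim m) : Dim n := ⟨i.1, lt_of_lt_of_le i.2 h⟩

theorem Dim.incl_injective {m n : ℕ∞} (h : m ≤ n) : Function.Injective (Dim.incl h) :=
  fun _ _ e => Dim.ext (congrArg (fun k : Dim n => k.val) e)

theorem Dim.ne_incl {m n : ℕ∞} (h : m ≤ n) {k : Dim n} (hk : m ≤ (k.1 : ℕ∞)) (i : Dim m) :
    k ≠ Dim.incl h i := by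
  rintro rfl
  exact absurd i.2 (not_lt.2 hk)

/-- The neat `m`-reduct of a cylindric algebra `C` of dimension `n ≥ m`. -/
def Nr {m n : ℕ∞} (_h : m ≤ n) (C : Type u) [BooleanAlgebra C] [CylAlg (Dim n) C] : Type u :=
  fixedBy C {k : Dim n | m ≤ (k.1 : ℕ∞)}

instance {m n : ℕ∞} (h : m ≤ n) (C : Type u) [BooleanAlgebra C] [CylAlg (Dim n) C] :
    BooleanAlgebra (Nr h C) :=
  inferInstanceAs (BooleanAlgebra (fixedBy C {k : Dim n | m ≤ (k.1 : ℕ∞)}))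

instance {m n : ℕ∞} (h : m ≤ n) (C : Type u) [BooleanAlgebra C] [CylAlg (Dim n) C] :
    CylAlg (Dim m) (Nr h C) where
  c i x := ⟨c (Dim.incl h i) x.1, fun k hk => by rw [c_comm, x.2 k hk]⟩
  d i j := ⟨d (Dim.incl h i) (Dim.incl h j), fun _ hk =>
    c_d _ _ _ (Dim.ne_incl h hk i) (Dim.ne_incl h hk j)⟩
  c_bot i := Subtype.ext (c_bot (Dim.incl h i))
  le_c i x := le_c (Dim.incl h i) x.1
  c_inf_c i x y := Subtype.ext (c_inf_c (Dim.incl h i) x.1 y.1)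
  c_comm i j x := Subtype.ext (c_comm (Dim.incl h i) (Dim.incl h j) x.1)
  d_self i := Subtype.ext (d_self (Dim.incl h i))
  d_trans i j k hi hj := Subtype.ext (d_trans _ _ _ (fun e => hi (Dim.incl_injective h e))
    (fun e => hj (Dim.incl_injective h e)))
  d_subst i j x hij :=
    Subtype.ext (d_subst _ _ x.1 (fun e => hij (Dim.incl_injective h e)))

/-- `A ∈ S Nr_m CA_n`: `A` embeds into the neat `m`-reduct of a cylindric algebra of
dimension `n`. -/
def IsSNr (m n : ℕ∞) (A : Type u) [BooleanAlgebra A] [CylAlg (Dim m) A] : Prop :=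
  ∃ (h : m ≤ n) (C : Type u) (_ : BooleanAlgebra C) (_ : CylAlg (Dim n) C)
    (f : CylHom (Dim m) A (Nr h C)), Function.Injective f

/-- The relation algebra reduct of a 3-dimensional cylindric algebra, on the coordinates `1, 2`
with spare coordinate `0`. -/
abbrev Ra3 (A : Type u) [BooleanAlgebra A] [CylAlg (Dim 3) A] : Type u :=
  Ra (I := Dim 3) ⟨1, by norm_num⟩ ⟨2, by norm_num⟩ ⟨0, by norm_num⟩ A

/-- `e` exhibits `Q` as the relation algebra reduct of `A ∈ S Nr_3 CA_n`, where `A` is generated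
by (the image of) `Q` and the formation of `Ra` commutes with the generation of subalgebras:
`Sg^Q X = Ra (Sg^A X)` for all `X ⊆ Q`, after the identification of `Q` with `Ra A` along `e`. -/
structure IsDilation3 (n : ℕ∞) {Q : Type u} [BooleanAlgebra Q] [RelOps Q]
    {A : Type u} [BooleanAlgebra A] [CylAlg (Dim 3) A] (e : RAHom Q (Ra3 A)) : Prop where
  snr : IsSNr 3 n A
  bijective : Function.Bijective e
  generates : cylSg (Dim 3) (Set.range fun x => (e x).val) = Set.univ
  ra_sg : ∀ X : Set Q,
    {y : Ra3 A | y.val ∈ cylSg (Dim 3) ((fun x => (e x).val) '' X)} = e '' relSg X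

/-! ## Locally finite `ω`-dimensional algebras -/

/-- The relation algebra reduct of an `ω`-dimensional cylindric algebra, on the coordinates `0, 1`
with spare coordinate `2`. -/
abbrev RaOmega (A : Type u) [BooleanAlgebra A] [CylAlg (Dim ⊤) A] : Type u :=
  Ra (I := Dim ⊤) ⟨0, ENat.natCast_lt_top 0⟩ ⟨1, ENat.natCast_lt_top 1⟩ ⟨2, ENat.natCast_lt_top 2⟩ A

/-- `A ∈ Lf_ω`: every dimension set is finite. -/
def IsLf (A : Type u) [BooleanAlgebra A] [CylAlg (Dim ⊤) A] : Prop :=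
  ∀ x : A, {k : Dim ⊤ | c k x ≠ x}.Finite

/-- `e` exhibits `Q` as the relation algebra reduct of the locally finite `ω`-dimensional
algebra `A`, which is generated by `Q`, and the formation of `Ra` commutes with the generation of
subalgebras by sets that contain a pair of quasi-projections. -/
structure IsDilationOmega {Q : Type u} [BooleanAlgebra Q] [RelOps Q]
    {A : Type u} [BooleanAlgebra A] [CylAlg (Dim ⊤) A] (e : RAHom Q (RaOmega A)) : Prop where
  lf : IsLf A
  bijective : Function.Bijective e
  generates : cylSg (Dim ⊤) (Set.range fun x => (e x).val) = Set.univ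
  ra_sg : ∀ X : Set Q, (∃ p ∈ X, ∃ q ∈ X, IsQuasiProj p q) →
    {y : RaOmega A | y.val ∈ cylSg (Dim ⊤) ((fun x => (e x).val) '' X)} = e '' relSg X

/-! ## Categories -/

/-- Algebras of the similarity type of relation algebras. -/
structure RelTypeCat where
  carrier : Type u
  [ba : BooleanAlgebra carrier]
  [ops : RelOps carrier]

attribute [instance] RelTypeCat.ba RelTypeCat.ops

instance : Category RelTypeCat.{u} where
  Hom R S := RAHom R.carrier S.carrier
  id R := RAHom.id R.carrier
  comp f g := f.trans g

/-- The property of being a quasi-projective relation algebra. -/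
def isQRA : ObjectProperty RelTypeCat.{u} := fun R => IsQRA R.carrier

/-- The category of quasi-projective relation algebras and all homomorphisms. -/
abbrev QRACat := (isQRA.{u}).FullSubcategory

/-- Locally finite cylindric algebras of dimension `ω`. -/
structure LfCat where
  carrier : Type u
  [ba : BooleanAlgebra carrier]
  [cyl : CylAlg (Dim ⊤) carrier]
  lf : IsLf carrier

attribute [instance] LfCat.ba LfCat.cyl

instance : Category LfCat.{u} where
  Hom A B := CylHom (Dim ⊤) A.carrier B.carrier
  id A := CylHom.id (Dim ⊤) A.carrier
  comp f g := f.trans g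

/-- `Ra` as a functor on `Lf_ω`. -/
def raFunctor : LfCat.{u} ⥤ RelTypeCat.{u} where
  obj A := ⟨RaOmega A.carrier⟩
  map {A B} (f : CylHom (Dim ⊤) A.carrier B.carrier) :=
    (f.ra : RAHom (RaOmega A.carrier) (RaOmega B.carrier))

/-- The property of a locally finite algebra of having a quasi-projective relation algebra
reduct. -/
def hasQRA : ObjectProperty LfCat.{u} := fun A => IsQRA (RaOmega A.carrier)

/-- `Ra` as a functor from the full subcategory of `Lf_ω` of those algebras whose relation algebra
reduct is quasi-projective to the category of quasi-projective relation algebras. -/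
def raQRA : (hasQRA.{u}).FullSubcategory ⥤ QRACat.{u} :=
  (isQRA.{u}).lift (hasQRA.ι ⋙ raFunctor) (fun A => A.property)

/-- Relation algebras with a distinguished pair of quasi-projections. -/
structure PointedQRA where
  alg : RelTypeCat.{u}
  isRelAlg : IsRelAlg alg.carrier
  p : alg.carrier
  q : alg.carrier
  quasi : IsQuasiProj p q

/-- Homomorphisms that preserve the distinguished quasi-projections. -/
@[ext] structure PointedQRA.Hom (R S : PointedQRA.{u}) where
  hom : R.alg ⟶ S.alg
  map_p : RAHom.toBoundedLatticeHom hom R.p = S.p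
  map_q : RAHom.toBoundedLatticeHom hom R.q = S.q

instance : Category PointedQRA.{u} where
  Hom := PointedQRA.Hom
  id R := ⟨𝟙 R.alg, rfl, rfl⟩
  comp f g := ⟨f.hom ≫ g.hom, (congrArg _ f.map_p).trans g.map_p,
    (congrArg _ f.map_q).trans g.map_q⟩

/-- Locally finite algebras with a distinguished pair of quasi-projections in the relation algebra
reduct. -/
structure PointedLf where
  alg : LfCat.{u}
  isRelAlg : IsRelAlg (RaOmega alg.carrier)
  p : RaOmega alg.carrier
  q : RaOmega alg.carrier
  quasi : IsQuasiProj p q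

/-- Homomorphisms that preserve the distinguished quasi-projections. -/
@[ext] structure PointedLf.Hom (A B : PointedLf.{u}) where
  hom : A.alg ⟶ B.alg
  map_p : RAHom.toBoundedLatticeHom (raFunctor.map hom) A.p = B.p
  map_q : RAHom.toBoundedLatticeHom (raFunctor.map hom) A.q = B.q

instance : Category PointedLf.{u} where
  Hom := PointedLf.Hom
  id A := ⟨𝟙 A.alg, rfl, rfl⟩
  comp f g := ⟨f.hom ≫ g.hom, (congrArg _ f.map_p).trans g.map_p,
    (congrArg _ f.map_q).trans g.map_q⟩

/-- The forgetful functor from locally finite algebras with distinguished quasi-projections to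
`Lf_ω`. -/
def PointedLf.forget : PointedLf.{u} ⥤ LfCat.{u} where
  obj A := A.alg
  map f := f.hom

/-- `Ra` as a functor on locally finite algebras with distinguished quasi-projections. -/
def raPointed : PointedLf.{u} ⥤ PointedQRA.{u} where
  obj A := ⟨raFunctor.obj A.alg, A.isRelAlg, A.p, A.q, A.quasi⟩
  map f := ⟨raFunctor.map f.hom, f.map_p, f.map_q⟩

/-! ## Arithmetic of cylindric algebras -/

namespace CylAlg

variable {I : Type w} {A : Type u} [BooleanAlgebra A] [CylAlg I A]

/-! Uniqueness and lifting rest on one construction. Given a homomorphism $g$ between the reducts of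
$A$ and $B$, consider the subalgebra of $A\times B$ generated by the graph of $g$. If the elements
of this subalgebra that lie in the reduct of $A\times B$ are only those of the graph, if $A$ is
generated by its reduct, and if finitely many cylindrifications carry any element into the reduct,
then the subalgebra is the graph of a homomorphism extending $g$ (`exists_extension`). The first
condition says that taking reducts commutes with generation. Both settings are closed under binary
products, so commutation only has to be proved inside a single algebra.

In dimension three a fourth coordinate makes commutation work. Each element generated by elements of
the reduct is a finite sum of products of three binary relations along the sides of a triangle.
Cylindrifying such a product composes two of its sides, and the extra coordinate is what identifies
this with a relative product (`relGen_of_cylGen_three`).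

In $\mathsf{Lf}_\omega$ quasi-projections take over this role. A locally finite algebra has enough
regular representations by sets of sequences (`exists_regular_rep`), so identities may be checked
there. Quasi-projections code finite tuples by single points, which turns each generated element
into a binary relation on codes, built by relation algebra operations from the generators
(`exists_codedBy`). This gives commutation (`IsLf.relGen_of_cylGen`). The same coding recovers every
element from one of the reduct (`IsLf.generated_by_ra`), so generation need not be assumed.

Existence comes from representability of quasi-projective relation algebras (`exists_relRep`). A
generic construction represents $Q$ with respect to finitely many elements at a time, a
quasi-projection pair keeping the finitely many points built so far as functions of one code; an
ultraproduct then treats all elements at once. The representations embed $Q$ into the reduct of a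
product of set algebras of any required dimension (`exists_ra_embedding`). The dilation is the
subalgebra generated by $Q$, and by commutation its reduct contains nothing new.

The equivalences follow: fullness is extension, faithfulness is generation, essential surjectivity
is the $\omega$-dilation. The left adjoint adjoins a quasi-projection pair freely, inside the
product of all possible targets (`exists_free_pointed`). -/

theorem c_top (i : I) : c i (⊤ : A) = ⊤ := top_le_iff.1 (le_c i ⊤)

/-- `c i z` is the least fixed element above `z`, and fixed elements are closed under joins. -/
theorem c_sup (i : I) (x y : A) : c i (x ⊔ y) = c i x ⊔ c i y := by
  have key : ∀ z w : A, c i w = w → z ≤ w → c i z ≤ w := fun z w hw h => by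
    have h1 := c_inf_of_fixed (x := z) hw
    rw [inf_eq_left.2 h] at h1
    exact inf_eq_left.1 h1.symm
  apply le_antisymm
  · exact key _ _ (c_sup_of_fixed (c_c i x) (c_c i y)) (sup_le_sup (le_c i x) (le_c i y))
  · have h : ∀ z ≤ x ⊔ y, c i z ≤ c i (x ⊔ y) := fun z hz =>
      key _ _ (c_c i _) (hz.trans (le_c i _))
    exact sup_le (h _ le_sup_left) (h _ le_sup_right)

theorem c_mono (i : I) {x y : A} (h : x ≤ y) : c i x ≤ c i y := by
  have h1 := c_sup i x y
  rw [sup_eq_right.2 h] at h1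
  exact le_sup_left.trans h1.ge

theorem c_eq_bot {i : I} {x : A} : c i x = ⊥ ↔ x = ⊥ :=
  ⟨fun h => le_bot_iff.1 ((le_c i x).trans h.le), fun h => by rw [h, c_bot]⟩

/-- In `d_subst` at `d j i`, the part of `d i j` inside `d j i` has full cylindrification by
`d_trans`, so the part outside must vanish. -/
theorem d_comm (i j : I) : (d i j : A) = d j i := by
  by_cases h : i = j
  · rw [h]
  have key : ∀ i j : I, i ≠ j → (d i j : A) ≤ d j i := fun i j h => by
    have h3 := d_subst i j (d j i : A) h
    by_contra hne
    have h4 : (d i j ⊓ (d j i)ᶜ : A) ≠ ⊥ := fun h => hne (by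
      rwa [← disjoint_iff, disjoint_compl_right_iff] at h)
    have h5 : c i (d i j ⊓ d j i : A) = ⊤ := by
      have := d_trans (A := A) j j i h h
      rw [d_self] at this
      rw [inf_comm]; exact this.symm
    rw [h5, top_inf_eq, c_eq_bot] at h3
    exact h4 h3
  exact le_antisymm (key i j h) (key j i (Ne.symm h))

theorem c_d_self (i j : I) : c i (d i j : A) = ⊤ := by
  by_cases h : i = j
  · rw [h, d_self, c_top]
  have := d_trans (A := A) j j i h h
  rw [d_self, d_comm j i, inf_idem] at this
  exact this.symm

theorem c_d_self' (i j : I) : c i (d j i : A) = ⊤ := by rw [d_comm, c_d_self]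

theorem s_sup (i j : I) (x y : A) : s i j (x ⊔ y) = s i j x ⊔ s i j y := by
  rw [s, inf_sup_left, c_sup]; rfl

theorem s_compl {i j : I} (h : i ≠ j) (x : A) : s i j xᶜ = (s i j x)ᶜ := by
  refine (IsCompl.compl_eq ⟨disjoint_iff.2 (d_subst i j x h), codisjoint_iff.2 ?_⟩).symm
  change s i j x ⊔ s i j xᶜ = ⊤
  rw [← s_sup, sup_compl_eq_top, s, inf_top_eq, c_d_self]

theorem s_inf {i j : I} (h : i ≠ j) (x y : A) : s i j (x ⊓ y) = s i j x ⊓ s i j y := by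
  rw [← compl_inj_iff, ← s_compl h, compl_inf, s_sup, s_compl h, s_compl h, compl_inf]

theorem s_bot (i j : I) : s i j (⊥ : A) = ⊥ := by rw [s, inf_bot_eq, c_bot]

theorem s_top (i j : I) : s i j (⊤ : A) = ⊤ := by rw [s, inf_top_eq, c_d_self]

theorem s_mono (i j : I) {x y : A} (h : x ≤ y) : s i j x ≤ s i j y :=
  c_mono i (inf_le_inf_left _ h)

theorem s_of_fixed {i : I} (j : I) {x : A} (hx : c i x = x) : s i j x = x := by
  rw [s, c_inf_of_fixed hx, c_d_self, top_inf_eq]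

/-- A part of `d i j ⊓ s i j x` outside `x` would lie below both `s i j x` and `s i j xᶜ`, which are
disjoint by `d_subst`. -/
theorem d_inf_s {i j : I} (h : i ≠ j) (x : A) : d i j ⊓ s i j x = d i j ⊓ x := by
  apply le_antisymm
  · refine le_inf inf_le_left ?_
    have h1 := d_subst i j x h
    by_contra h2
    have h3 : d i j ⊓ s i j x ⊓ xᶜ ≠ ⊥ := fun h => h2 (by
      rwa [← disjoint_iff, disjoint_compl_right_iff] at h)
    apply h3
    rw [← le_bot_iff, ← h1]
    refine le_inf (inf_le_left.trans inf_le_right) ?_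
    exact (le_inf (inf_le_left.trans inf_le_left) inf_le_right).trans (le_c i _)
  · exact le_inf inf_le_left (le_c i _)

theorem s_c_comm {i j k : I} (hi : k ≠ i) (hj : k ≠ j) (x : A) :
    s i j (c k x) = c k (s i j x) := by
  rw [s, s, c_comm k i, inf_comm, inf_comm (d i j), c_inf_of_fixed (c_d i j k hi hj)]

theorem s_s_comm {i j k l : I} (hik : i ≠ k) (hil : i ≠ l) (hkj : k ≠ j) (x : A) :
    s i j (s k l x) = s k l (s i j x) := by
  have h1 : s i j (s k l x) = c k (c i (d i j ⊓ (d k l ⊓ x))) := by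
    rw [s, s, inf_comm, ← c_inf_of_fixed (c_d i j k hik.symm hkj), c_comm, inf_comm]
  have h2 : s k l (s i j x) = c i (c k (d k l ⊓ (d i j ⊓ x))) := by
    rw [s, s, inf_comm, ← c_inf_of_fixed (c_d k l i hik hil), c_comm, inf_comm]
  rw [h1, h2, c_comm, inf_left_comm]

/-- Substituting through an intermediate variable that is not free. -/
theorem s_s_of_fixed {i j k : I} (hki : k ≠ i) (hkj : k ≠ j) (hij : i ≠ j) {x : A}
    (hx : c k x = x) : s k j (s i k x) = s i j x := by
  have h1 : s k j (s i k x) = c i (c k (d k j ⊓ (d i k ⊓ x))) := by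
    rw [s, s, inf_comm, ← c_inf_of_fixed (c_d k j i hki.symm hij), c_comm, inf_comm]
  rw [h1, ← inf_assoc, c_inf_of_fixed hx, inf_comm (d k j), ← d_trans i j k hki hkj]; rfl

theorem s_s_cancel {i k : I} (hki : k ≠ i) {x : A} (hx : c k x = x) :
    s k i (s i k x) = x := by
  change c k (d k i ⊓ s i k x) = x
  rw [d_comm, d_inf_s hki.symm, c_inf_of_fixed hx, c_d_self', top_inf_eq]

/-- Renaming of a bound variable. -/
theorem c_s_rename {i j : I} {x : A} (hx : c j x = x) : c j (s i j x) = c i x := by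
  rw [s, c_comm, c_inf_of_fixed hx, c_d_self', top_inf_eq]

theorem s_d {i j k : I} (hij : i ≠ j) (hik : i ≠ k) : s i j (d i k : A) = d j k := by
  by_cases hjk : j = k
  · subst hjk; rw [s, inf_idem, c_d_self, d_self]
  · rw [s, d_comm i j, ← d_trans j k i hij hik]

/-- Cylindrification along a list of indices. -/
def cList (L : List I) (x : A) : A := L.foldr c x

theorem le_cList (L : List I) (x : A) : x ≤ cList L x := by
  induction L with
  | nil => exact le_rfl
  | cons i L ih => exact ih.trans (le_c i _)

theorem c_cList (i : I) (L : List I) (x : A) : c i (cList L x) = cList L (c i x) := by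
  induction L with
  | nil => rfl
  | cons j L ih => change c i (c j (cList L x)) = c j (cList L (c i x)); rw [c_comm, ih]

theorem c_cList_of_mem {i : I} {L : List I} (h : i ∈ L) (x : A) :
    c i (cList L x) = cList L x := by
  induction L with
  | nil => simp at h
  | cons j L ih =>
    change c i (c j (cList L x)) = c j (cList L x)
    rcases List.mem_cons.1 h with rfl | h
    · exact c_c _ _
    · rw [c_comm, ih h]

theorem cList_bot (L : List I) : cList L (⊥ : A) = ⊥ := by
  induction L with
  | nil => rfl
  | cons j L ih => change c j (cList L (⊥ : A)) = ⊥; rw [ih, c_bot]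

theorem gen_cList {X : Set A} (L : List I) {x : A} (h : CylGen I X x) : CylGen I X (cList L x) := by
  induction L with
  | nil => exact h
  | cons i L ih => exact ih.cyl i

theorem gen_s {X : Set A} (i j : I) {x : A} (h : CylGen I X x) : CylGen I X (s i j x) :=
  ((CylGen.diag i j).inf h).cyl i

theorem gen_mono_of {X Y : Set A} (h : ∀ x ∈ X, CylGen I Y x) {x : A} (hx : CylGen I X x) :
    CylGen I Y x := by
  induction hx with
  | base hx => exact h _ hx
  | bot => exact .bot
  | top => exact .top
  | sup _ _ h1 h2 => exact h1.sup h2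
  | inf _ _ h1 h2 => exact h1.inf h2
  | compl _ h => exact h.compl
  | cyl i _ h => exact h.cyl i
  | diag i j => exact .diag i j

end CylAlg

/-! ### Homomorphisms and generated subalgebras -/

namespace CylHom

variable {I : Type w} {A : Type u} {B : Type v} [BooleanAlgebra A] [CylAlg I A]
  [BooleanAlgebra B] [CylAlg I B]

theorem exists_of_gen (f : CylHom I A B) {X : Set A} {y : B} (h : CylGen I (f '' X) y) :
    ∃ x, CylGen I X x ∧ f x = y := by
  induction h with
  | base hx => obtain ⟨x, hx, rfl⟩ := hx; exact ⟨x, .base hx, rfl⟩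
  | bot => exact ⟨_, .bot, map_bot _⟩
  | top => exact ⟨_, .top, map_top _⟩
  | sup _ _ h1 h2 =>
    obtain ⟨a, ha, rfl⟩ := h1; obtain ⟨b, hb, rfl⟩ := h2
    exact ⟨_, ha.sup hb, map_sup _ _ _⟩
  | inf _ _ h1 h2 =>
    obtain ⟨a, ha, rfl⟩ := h1; obtain ⟨b, hb, rfl⟩ := h2
    exact ⟨_, ha.inf hb, map_inf _ _ _⟩
  | compl _ h => obtain ⟨a, ha, rfl⟩ := h; exact ⟨_, ha.compl, map_compl' _ _⟩
  | cyl i _ h => obtain ⟨a, ha, rfl⟩ := h; exact ⟨_, ha.cyl i, f.map_c' _ _⟩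
  | diag i j => exact ⟨_, .diag i j, f.map_d' _ _⟩

theorem eq_on_gen {f g : CylHom I A B} {X : Set A} (h : ∀ x ∈ X, f x = g x) {x : A}
    (hx : CylGen I X x) : f x = g x := by
  induction hx with
  | base hx => exact h _ hx
  | bot => rw [map_bot, map_bot]
  | top => rw [map_top, map_top]
  | sup _ _ h1 h2 => rw [map_sup, map_sup, h1, h2]
  | inf _ _ h1 h2 => rw [map_inf, map_inf, h1, h2]
  | compl _ h => rw [map_compl', map_compl', h]
  | cyl i _ h => rw [f.map_c', g.map_c', h]
  | diag i j => rw [f.map_d', g.map_d']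

theorem map_cList (f : CylHom I A B) (L : List I) (x : A) :
    f (cList L x) = cList L (f x) := by
  induction L with
  | nil => rfl
  | cons i L ih => change f (c i (cList L x)) = c i (cList L (f x)); rw [f.map_c', ih]

theorem injective_of_ker (f : CylHom I A B) (h : ∀ x, f x = ⊥ → x = ⊥) :
    Function.Injective f := by
  have key : ∀ x y, f x = f y → x ≤ y := fun x y hxy => by
    have h1 : f (x ⊓ yᶜ) = ⊥ := by rw [map_inf, map_compl', hxy, inf_compl_eq_bot]
    rw [← disjoint_compl_right_iff, disjoint_iff]
    exact h _ h1
  exact fun x y hxy => le_antisymm (key _ _ hxy) (key _ _ hxy.symm)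

end CylHom

namespace RAHom

variable {R : Type u} {S : Type v} [BooleanAlgebra R] [RelOps R] [BooleanAlgebra S] [RelOps S]

theorem injective_of_ker (f : RAHom R S) (h : ∀ x, f x = ⊥ → x = ⊥) :
    Function.Injective f := by
  have key : ∀ x y, f x = f y → x ≤ y := fun x y hxy => by
    have h1 : f (x ⊓ yᶜ) = ⊥ := by rw [map_inf, map_compl', hxy, inf_compl_eq_bot]
    rw [← disjoint_compl_right_iff, disjoint_iff]
    exact h _ h1
  exact fun x y hxy => le_antisymm (key _ _ hxy) (key _ _ hxy.symm)

theorem map_gen (f : RAHom R S) {X : Set R} {x : R} (h : RelGen X x) :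
    RelGen (f '' X) (f x) := by
  induction h with
  | base hx => exact .base ⟨_, hx, rfl⟩
  | bot => rw [map_bot]; exact .bot
  | top => rw [map_top]; exact .top
  | sup _ _ h1 h2 => rw [map_sup]; exact h1.sup h2
  | inf _ _ h1 h2 => rw [map_inf]; exact h1.inf h2
  | compl _ h => rw [map_compl']; exact h.compl
  | comp _ _ h1 h2 => rw [f.map_comp']; exact h1.comp h2
  | conv _ h => rw [f.map_conv']; exact h.conv
  | ident => rw [f.map_ident']; exact .ident

theorem exists_of_gen (f : RAHom R S) {X : Set R} {y : S} (h : RelGen (f '' X) y) :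
    ∃ x, RelGen X x ∧ f x = y := by
  induction h with
  | base hx => obtain ⟨x, hx, rfl⟩ := hx; exact ⟨x, .base hx, rfl⟩
  | bot => exact ⟨_, .bot, map_bot _⟩
  | top => exact ⟨_, .top, map_top _⟩
  | sup _ _ h1 h2 =>
    obtain ⟨a, ha, rfl⟩ := h1; obtain ⟨b, hb, rfl⟩ := h2
    exact ⟨_, ha.sup hb, map_sup _ _ _⟩
  | inf _ _ h1 h2 =>
    obtain ⟨a, ha, rfl⟩ := h1; obtain ⟨b, hb, rfl⟩ := h2
    exact ⟨_, ha.inf hb, map_inf _ _ _⟩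
  | compl _ h => obtain ⟨a, ha, rfl⟩ := h; exact ⟨_, ha.compl, map_compl' _ _⟩
  | comp _ _ h1 h2 =>
    obtain ⟨a, ha, rfl⟩ := h1; obtain ⟨b, hb, rfl⟩ := h2
    exact ⟨_, ha.comp hb, f.map_comp' _ _⟩
  | conv _ h => obtain ⟨a, ha, rfl⟩ := h; exact ⟨_, ha.conv, f.map_conv' _⟩
  | ident => exact ⟨_, .ident, f.map_ident'⟩

theorem map_quasi (f : RAHom R S) {p q : R} (h : IsQuasiProj p q) :
    IsQuasiProj (f p) (f q) where
  fst_functional := by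
    rw [← f.map_conv', ← f.map_comp', ← f.map_ident']
    exact OrderHomClass.mono f.toBoundedLatticeHom h.fst_functional
  snd_functional := by
    rw [← f.map_conv', ← f.map_comp', ← f.map_ident']
    exact OrderHomClass.mono f.toBoundedLatticeHom h.snd_functional
  pairing := by rw [← f.map_conv', ← f.map_comp', h.pairing, map_top]

/-- The inverse of a bijective homomorphism. -/
noncomputable def inverse (f : RAHom R S) (h : Function.Bijective f) : RAHom S R :=
  have hr : ∀ x, f (Function.surjInv h.2 x) = x := Function.surjInv_eq h.2
  { toFun := Function.surjInv h.2
    map_sup' := fun x y => h.1 <| (hr _).trans <| by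
      rw [map_sup f.toBoundedLatticeHom, hr, hr]
    map_inf' := fun x y => h.1 <| (hr _).trans <| by
      rw [map_inf f.toBoundedLatticeHom, hr, hr]
    map_top' := h.1 <| (hr _).trans (map_top f.toBoundedLatticeHom).symm
    map_bot' := h.1 <| (hr _).trans (map_bot f.toBoundedLatticeHom).symm
    map_comp' := fun x y => h.1 <| (hr _).trans <| by
      rw [f.map_comp']; exact congrArg₂ comp (hr x).symm (hr y).symm
    map_conv' := fun x => h.1 <| (hr _).trans <| by
      rw [f.map_conv']; exact congrArg conv (hr x).symm
    map_ident' := h.1 <| (hr _).trans f.map_ident'.symm }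

theorem apply_inverse (f : RAHom R S) (h : Function.Bijective f) (x : S) :
    f (f.inverse h x) = x := Function.surjInv_eq h.2 x

theorem inverse_apply (f : RAHom R S) (h : Function.Bijective f) (x : R) :
    f.inverse h (f x) = x := h.1 (f.apply_inverse h _)

end RAHom

/-! ## Subalgebras and products -/

/-- The subalgebra generated by `X`. -/
def cylSub (I : Type w) {A : Type u} [BooleanAlgebra A] [CylAlg I A] (X : Set A) :
    BooleanSubalgebra A where
  carrier := cylSg I X
  supClosed' _ hx _ hy := CylGen.sup hx hy
  infClosed' _ hx _ hy := CylGen.inf hx hy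
  compl_mem' h := CylGen.compl h
  bot_mem' := CylGen.bot

section Sub

variable {I : Type w} {A : Type u} [BooleanAlgebra A] [CylAlg I A] {X : Set A}

instance : CylAlg I (cylSub I X) where
  c i x := ⟨c i x.1, CylGen.cyl i x.2⟩
  d i j := ⟨d i j, CylGen.diag i j⟩
  c_bot i := Subtype.ext (c_bot i)
  le_c i x := le_c i x.1
  c_inf_c i x y := Subtype.ext (c_inf_c i x.1 y.1)
  c_comm i j x := Subtype.ext (c_comm i j x.1)
  d_self i := Subtype.ext (d_self i)
  d_trans i j k hi hj := Subtype.ext (d_trans i j k hi hj)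
  d_subst i j x h := Subtype.ext (d_subst i j x.1 h)

/-- The inclusion of a generated subalgebra. -/
def cylSub.incl (X : Set A) : CylHom I (cylSub I X) A where
  toFun := Subtype.val
  map_sup' _ _ := rfl
  map_inf' _ _ := rfl
  map_top' := rfl
  map_bot' := rfl
  map_c' _ _ := rfl
  map_d' _ _ := rfl

theorem cylSub.gen {x : A} (hx : CylGen I X x) :
    CylGen I {y : cylSub I X | y.1 ∈ X} (⟨x, hx⟩ : cylSub I X) := by
  induction hx with
  | base h => exact .base h
  | bot => exact .bot
  | top => exact .top
  | sup _ _ h1 h2 => exact h1.sup h2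
  | inf _ _ h1 h2 => exact h1.inf h2
  | compl _ h => exact h.compl
  | cyl i _ h => exact h.cyl i
  | diag i j => exact .diag i j

end Sub

section Prod

variable {I : Type w} {A : Type u} {B : Type v} [BooleanAlgebra A] [CylAlg I A]
  [BooleanAlgebra B] [CylAlg I B]

instance : CylAlg I (A × B) where
  c i x := (c i x.1, c i x.2)
  d i j := (d i j, d i j)
  c_bot i := Prod.ext (c_bot i) (c_bot i)
  le_c i x := ⟨le_c i x.1, le_c i x.2⟩
  c_inf_c i x y := Prod.ext (c_inf_c i x.1 y.1) (c_inf_c i x.2 y.2)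
  c_comm i j x := Prod.ext (c_comm i j x.1) (c_comm i j x.2)
  d_self i := Prod.ext (d_self i) (d_self i)
  d_trans i j k hi hj := Prod.ext (d_trans i j k hi hj) (d_trans i j k hi hj)
  d_subst i j x h := Prod.ext (d_subst i j x.1 h) (d_subst i j x.2 h)

/-- The first projection of a product of cylindric algebras. -/
def CylHom.fst : CylHom I (A × B) A where
  toFun := Prod.fst
  map_sup' _ _ := rfl
  map_inf' _ _ := rfl
  map_top' := rfl
  map_bot' := rfl
  map_c' _ _ := rfl
  map_d' _ _ := rfl

/-- The second projection of a product of cylindric algebras. -/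
def CylHom.snd : CylHom I (A × B) B where
  toFun := Prod.snd
  map_sup' _ _ := rfl
  map_inf' _ _ := rfl
  map_top' := rfl
  map_bot' := rfl
  map_c' _ _ := rfl
  map_d' _ _ := rfl

theorem fst_cList (L : List I) (z : A × B) : (cList L z).1 = cList L z.1 :=
  CylHom.fst.map_cList L z

theorem snd_cList (L : List I) (z : A × B) : (cList L z).2 = cList L z.2 :=
  CylHom.snd.map_cList L z

end Prod

instance {I : Type w} {J : Type u} (A : J → Type v) [∀ j, BooleanAlgebra (A j)]
    [∀ j, CylAlg I (A j)] : CylAlg I (∀ j, A j) where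
  c i x := fun j => c i (x j)
  d i k := fun _ => d i k
  c_bot i := funext fun _ => c_bot i
  le_c i x := fun j => le_c i (x j)
  c_inf_c i x y := funext fun j => c_inf_c i (x j) (y j)
  c_comm i k x := funext fun j => c_comm i k (x j)
  d_self i := funext fun _ => d_self i
  d_trans i j k hi hj := funext fun _ => d_trans i j k hi hj
  d_subst i k x h := funext fun j => d_subst i k (x j) h

/-! ## Extension of homomorphisms of relation algebra reducts -/

section Extension

variable {I : Type w} {i j k : I} {A : Type u} {B : Type v} [BooleanAlgebra A] [CylAlg I A]
  [BooleanAlgebra B] [CylAlg I B]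

/-- The graph of a homomorphism between relation algebra reducts, inside the reduct of the
product. -/
def RAHom.graph (g : RAHom (Ra i j k A) (Ra i j k B)) :
    RAHom (Ra i j k A) (Ra i j k (A × B)) where
  toFun r := ⟨(r.1, (g r).1), fun l hl => Prod.ext (r.2 l hl) ((g r).2 l hl)⟩
  map_sup' x y := 
    Subtype.ext (Prod.ext rfl (congrArg Ra.val (map_sup g.toBoundedLatticeHom x y)))
  map_inf' x y := 
    Subtype.ext (Prod.ext rfl (congrArg Ra.val (map_inf g.toBoundedLatticeHom x y)))
  map_top' := Subtype.ext (Prod.ext rfl (congrArg Ra.val (map_top g.toBoundedLatticeHom)))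
  map_bot' := Subtype.ext (Prod.ext rfl (congrArg Ra.val (map_bot g.toBoundedLatticeHom)))
  map_comp' x y := Subtype.ext (Prod.ext rfl (congrArg Ra.val (g.map_comp' x y)))
  map_conv' x := Subtype.ext (Prod.ext rfl (congrArg Ra.val (g.map_conv' x)))
  map_ident' := Subtype.ext (Prod.ext rfl (congrArg Ra.val g.map_ident'))

/-- The subalgebra generated by the graph of `g` is total over `A`, because its first projection
contains the generators of `A`. It is single-valued because the fibre over `⊥` is trivial. A total
single-valued subalgebra of the product is a homomorphism. -/
theorem exists_extension (g : RAHom (Ra i j k A) (Ra i j k B))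
    (hA : cylSg I (Set.range fun r : Ra i j k A => r.val) = Set.univ)
    (hcl : ∀ z : A × B, ∃ L : List I, ∀ l, l ≠ i → l ≠ j → c l (cList L z) = cList L z)
    (hG : ∀ y : Ra i j k (A × B), y.val ∈ cylSg I (Ra.val '' Set.range g.graph) →
      ∃ r, g.graph r = y) :
    ∃ h : CylHom I A B, ∀ r, h r.val = (g r).val := by
  set X : Set (A × B) := Ra.val '' Set.range g.graph with hX
  have htot : ∀ a : A, ∃ b : B, CylGen I X (a, b) := fun a => by
    have ha : CylGen I (Set.range fun r : Ra i j k A => r.val) a := by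
      have : a ∈ cylSg I (Set.range fun r : Ra i j k A => r.val) := by rw [hA]; trivial
      exact this
    have h1 : (CylHom.fst (I := I) (A := A) (B := B)) '' X
        = Set.range fun r : Ra i j k A => r.val := by
      rw [hX, Set.image_image]
      ext x
      constructor
      · rintro ⟨_, ⟨r, rfl⟩, rfl⟩; exact ⟨r, rfl⟩
      · rintro ⟨r, rfl⟩; exact ⟨_, ⟨r, rfl⟩, rfl⟩
    rw [← h1] at ha
    obtain ⟨z, hz, rfl⟩ := CylHom.exists_of_gen _ ha
    exact ⟨z.2, hz⟩
  -- Cylindrifying `(⊥, b)` into the reduct keeps the first component `⊥`. By `hG` the result is on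
  -- the graph of `g`, so its second component is `g ⊥ = ⊥`, and `b` lies below that.
  have hbot : ∀ b : B, CylGen I X (⊥, b) → b = ⊥ := fun b hb => by
    obtain ⟨L, hL⟩ := hcl (⊥, b)
    obtain ⟨r, hr⟩ := hG ⟨cList L (⊥, b), fun l hl => hL l hl.1 hl.2⟩ (gen_cList L hb)
    have h1 : (r.1, (g r).1) = cList L ((⊥, b) : A × B) := congrArg Subtype.val hr
    have h2 : r.1 = ⊥ := (congrArg Prod.fst h1).trans (by rw [fst_cList, cList_bot])
    have h3 : r = ⊥ := Subtype.ext h2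
    have h4 : (g r).1 = cList L b := (congrArg Prod.snd h1).trans (by rw [snd_cList])
    rw [h3, map_bot] at h4
    exact le_bot_iff.1 ((le_cList L b).trans h4.symm.le)
  have hle : ∀ a b b', CylGen I X (a, b) → CylGen I X (a, b') → b ≤ b' := fun a b b' h h' => by
    have h1 := h.inf h'.compl
    have h2 : ((a, b) ⊓ (a, b')ᶜ : A × B) = (⊥, b ⊓ b'ᶜ) := Prod.ext inf_compl_eq_bot rfl
    rw [h2] at h1
    rw [← disjoint_compl_right_iff, disjoint_iff]
    exact hbot _ h1
  choose F hF using htot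
  have hu : ∀ a b, CylGen I X (a, b) → F a = b := fun a b h =>
    le_antisymm (hle _ _ _ (hF a) h) (hle _ _ _ h (hF a))
  refine ⟨{ toFun := F
            map_sup' := fun x y => hu _ _ ((hF x).sup (hF y))
            map_inf' := fun x y => hu _ _ ((hF x).inf (hF y))
            map_top' := hu _ _ .top
            map_bot' := hu _ _ .bot
            map_c' := fun l x => hu _ _ ((hF x).cyl l)
            map_d' := fun l m => hu _ _ (.diag l m) }, fun r => ?_⟩
  exact hu _ _ (.base ⟨g.graph r, ⟨r, rfl⟩, rfl⟩)

/-- A kernel element lies below its cylindrification, which is again in the kernel and belongs to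
the reduct. -/
theorem CylHom.injective_of_ra (h : CylHom I A B)
    (hcl : ∀ x : A, ∃ L : List I, ∀ l, l ≠ i → l ≠ j → c l (cList L x) = cList L x)
    (hi : ∀ r : Ra i j k A, h r.val = ⊥ → r.val = ⊥) : Function.Injective h :=
  h.injective_of_ker fun x hx => by
    obtain ⟨L, hL⟩ := hcl x
    have h1 := hi ⟨cList L x, fun l hl => hL l hl.1 hl.2⟩ (by
      change h (cList L x) = ⊥
      rw [h.map_cList, hx, cList_bot])
    exact le_bot_iff.1 ((le_cList L x).trans h1.le)

theorem CylHom.surjective_of_gen (h : CylHom I A B) {Y : Set B} (hY : cylSg I Y = Set.univ)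
    (hs : ∀ y ∈ Y, ∃ x, h x = y) : Function.Surjective h := fun b => by
  have hb : CylGen I Y b := by
    have : b ∈ cylSg I Y := by rw [hY]; trivial
    exact this
  have h1 : CylGen I (h '' Set.univ) b := gen_mono_of (fun y hy => .base (by
    obtain ⟨x, rfl⟩ := hs y hy; exact ⟨x, trivial, rfl⟩)) hb
  obtain ⟨x, _, rfl⟩ := h.exists_of_gen h1
  exact ⟨x, rfl⟩

end Extension

/-! ## Substitutions with a spare coordinate -/

namespace CylAlg

variable {I : Type w} {C : Type u} [BooleanAlgebra C] [CylAlg I C] {i j k l : I}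

/-- The left side is the composite of the converse of `y` with `x`, its first argument moved to `k`.
The coordinate `l`, on which neither `x` nor `y` depends, replaces the bound `k` of the composition,
so that the outer substitution does not capture it. -/
theorem c_inf_s_eq_left (hij : i ≠ j) (hik : i ≠ k) (hil : i ≠ l) (hjk : j ≠ k) (hjl : j ≠ l)
    (hkl : k ≠ l) {x y : C} (hxk : c k x = x) (hxl : c l x = x)
    (hyl : c l y = y) :
    s i k (c k (s j k (s k i (s i j (s j k y))) ⊓ s i k x)) = c i (x ⊓ s j k y) := by
  set y' := s k i (s i j (s j k y)) with hy'
  have hy'l : c l y' = y' :=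
    c_s_of_fixed hkl.symm hil.symm (c_s_of_fixed hil.symm hjl.symm
      (c_s_of_fixed hjl.symm hkl.symm hyl))
  have hy'k : c k y' = y' := c_s_self _ _ _
  have e1 : c k (s j k y' ⊓ s i k x) = c l (s j l y' ⊓ s i l x) := by
    have hw : c l (s j k y' ⊓ s i k x) = s j k y' ⊓ s i k x := by
      rw [c_inf_of_fixed (c_s_of_fixed hil.symm hkl.symm hxl),
        c_s_of_fixed hjl.symm hkl.symm hy'l]
    rw [← c_s_rename (i := k) hw, s_inf hkl, s_s_of_fixed hjk.symm hkl hjl hy'k,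
      s_s_of_fixed hik.symm hkl hil hxk]
  -- The converse read at `(k, l)` is `y` read at `(l, k)`.
  have e2 : s i k (s j l y') = s i l (s j k y) := by
    have hz : c j (s j k y) = s j k y := c_s_self _ _ _
    rw [hy', s_s_comm hjk hij.symm hkl, s_s_of_fixed hij.symm hjl hil hz,
      s_s_cancel hik (c_s_self _ _ _)]
  have hyl' : c l (s j k y) = s j k y := c_s_of_fixed hjl.symm hkl.symm hyl
  rw [e1, s_c_comm hil.symm hkl.symm, s_inf hik, e2, s_of_fixed k (c_s_self i l x), ← s_inf hil,
    c_s_rename (by rw [c_inf_of_fixed hxl, hyl']), inf_comm]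

/-- The mirror image: `x` composed with the converse of `y`, its second argument moved to `k`, with
`l` again serving as the bound variable. -/
theorem c_inf_s_eq_right (hij : i ≠ j) (hik : i ≠ k) (hil : i ≠ l) (hjk : j ≠ k) (hjl : j ≠ l)
    (hkl : k ≠ l) {x y : C} (hxk : c k x = x) (hxl : c l x = x) (hyk : c k y = y)
    (hyl : c l y = y) :
    s j k (c k (s j k x ⊓ s i k (s k i (s i j (s j k y))))) = c j (x ⊓ s i k y) := by
  set y' := s k i (s i j (s j k y)) with hy'
  have hy'l : c l y' = y' :=
    c_s_of_fixed hkl.symm hil.symm (c_s_of_fixed hil.symm hjl.symm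
      (c_s_of_fixed hjl.symm hkl.symm hyl))
  have hy'k : c k y' = y' := c_s_self _ _ _
  have e1 : c k (s j k x ⊓ s i k y') = c l (s j l x ⊓ s i l y') := by
    have hw : c l (s j k x ⊓ s i k y') = s j k x ⊓ s i k y' := by
      rw [c_inf_of_fixed (c_s_of_fixed hil.symm hkl.symm hy'l),
        c_s_of_fixed hjl.symm hkl.symm hxl]
    rw [← c_s_rename (i := k) hw, s_inf hkl, s_s_of_fixed hjk.symm hkl hjl hxk,
      s_s_of_fixed hik.symm hkl hil hy'k]
  have e2 : s j k (s i l y') = s j l (s i k y) := by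
    have hz : c i (s i j (s j k y)) = s i j (s j k y) := c_s_self _ _ _
    rw [hy', s_s_of_fixed hik hil hkl hz, s_s_comm hik.symm hjk.symm hil,
      s_s_of_fixed hjk.symm hkl hjl hyk, s_s_of_fixed hij.symm hjk hik (c_s_self j l y),
      s_s_comm hij hil hjk]
  have hyl' : c l (s i k y) = s i k y := c_s_of_fixed hil.symm hkl.symm hyl
  rw [e1, s_c_comm hjl.symm hkl.symm, s_inf hjk, e2, s_of_fixed k (c_s_self j l x), ← s_inf hjl,
    c_s_rename (by rw [c_inf_of_fixed hyl', hxl])]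

end CylAlg

/-! ## Elements generated by the relation algebra reduct in dimension three -/

section Triangle

variable {I : Type w} {A : Type u} [BooleanAlgebra A] [CylAlg I A] {i j k : I}

/-- Finite sums of products of an element of the reduct on `i, j`, one on `k, j` and one on
`i, k`. -/
inductive TriangleSum (X : Set (Ra i j k A)) : A → Prop
  | bot : TriangleSum X ⊥
  | add {z : A} (a b e : Ra i j k A) : TriangleSum X z → RelGen X a → RelGen X b → RelGen X e →
      TriangleSum X (z ⊔ a.val ⊓ (s i k b.val ⊓ s j k e.val))

namespace TriangleSum

variable {X : Set (Ra i j k A)} {x y : A}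

theorem single {a b e : Ra i j k A} (ha : RelGen X a) (hb : RelGen X b) (he : RelGen X e) :
    TriangleSum X (a.val ⊓ (s i k b.val ⊓ s j k e.val)) := by
  simpa using TriangleSum.add a b e .bot ha hb he

theorem sup (hx : TriangleSum X x) (hy : TriangleSum X y) : TriangleSum X (x ⊔ y) := by
  induction hy with
  | bot => simpa using hx
  | add a b e _ ha hb he ih => rw [← sup_assoc]; exact .add a b e ih ha hb he

theorem fst {a : Ra i j k A} (ha : RelGen X a) : TriangleSum X a.val := by
  have h : a.val ⊓ (s i k (⊤ : A) ⊓ s j k (⊤ : A)) = a.val := by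
    rw [s_top, s_top, inf_top_eq, inf_top_eq]
  rw [← h]; exact single ha .top .top

theorem snd {a : Ra i j k A} (ha : RelGen X a) : TriangleSum X (s i k a.val) := by
  have h : (⊤ : A) ⊓ (s i k a.val ⊓ s j k (⊤ : A)) = s i k a.val := by
    rw [s_top, top_inf_eq, inf_top_eq]
  rw [← h]; exact single .top ha .top

theorem thd {a : Ra i j k A} (ha : RelGen X a) : TriangleSum X (s j k a.val) := by
  have h : (⊤ : A) ⊓ (s i k (⊤ : A) ⊓ s j k a.val) = s j k a.val := by
    rw [s_top, top_inf_eq, top_inf_eq]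
  rw [← h]; exact single .top .top ha

theorem inf (hik : i ≠ k) (hjk : j ≠ k) (hx : TriangleSum X x) (hy : TriangleSum X y) :
    TriangleSum X (x ⊓ y) := by
  induction hx with
  | bot => rw [bot_inf_eq]; exact .bot
  | add a b e _ ha hb he ih =>
    rw [inf_sup_right]
    refine ih.sup ?_
    clear ih
    induction hy with
    | bot => rw [inf_bot_eq]; exact .bot
    | add a' b' e' _ ha' hb' he' ih =>
      rw [inf_sup_left]
      refine ih.sup ?_
      have h := single (ha.inf ha') (hb.inf hb') (he.inf he')
      have h1 : (a ⊓ a').val = a.val ⊓ a'.val := rfl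
      have h2 : (b ⊓ b').val = b.val ⊓ b'.val := rfl
      have h3 : (e ⊓ e').val = e.val ⊓ e'.val := rfl
      rw [h1, h2, h3, s_inf hik, s_inf hjk] at h
      rw [inf_inf_inf_comm, inf_inf_inf_comm (s i k b.val)]
      exact h

theorem compl (hik : i ≠ k) (hjk : j ≠ k) (hx : TriangleSum X x) : TriangleSum X xᶜ := by
  induction hx with
  | bot =>
    rw [compl_bot]
    exact fst .top
  | add a b e _ ha hb he ih =>
    rw [compl_sup, compl_inf, compl_inf, ← s_compl hik, ← s_compl hjk]
    exact ih.inf hik hjk ((fst ha.compl).sup ((snd hb.compl).sup (thd he.compl)))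

theorem cyl {l : I} (h : ∀ a b e : Ra i j k A, RelGen X a → RelGen X b → RelGen X e →
    TriangleSum X (c l (a.val ⊓ (s i k b.val ⊓ s j k e.val)))) (hx : TriangleSum X x) :
    TriangleSum X (c l x) := by
  induction hx with
  | bot => rw [c_bot]; exact .bot
  | add a b e _ ha hb he ih => rw [c_sup]; exact ih.sup (h a b e ha hb he)

/-- The first factor does not depend on `k` and leaves the cylindrification; the other two then form
a relative product by definition. -/
theorem c_third (hik : i ≠ k) (hjk : j ≠ k) (a b e : Ra i j k A) :
    c k (a.val ⊓ (s i k b.val ⊓ s j k e.val)) = (a ⊓ comp e b).val := by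
  rw [inf_comm, c_inf_of_fixed (show c k a.val = a.val from a.2 k ⟨hik.symm, hjk.symm⟩), inf_comm, inf_comm (s i k b.val)]
  rfl

end TriangleSum

end Triangle

theorem Dim.three_cases (l : Dim 3) :
    l = ⟨1, by norm_num⟩ ∨ l = ⟨2, by norm_num⟩ ∨ l = ⟨0, by norm_num⟩ := by
  obtain ⟨l, hl⟩ := l
  have : l < 3 := by exact_mod_cast hl
  interval_cases l <;> simp

/-- The triangle sums over `X` form a subalgebra containing `X`, and cylindrifying one along the
spare coordinate gives an element generated by `X` in the reduct. An element of the reduct is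
unchanged by that cylindrification. -/
theorem relGen_of_cylGen_three {n : ℕ∞} (hn : 4 ≤ n) {A : Type u} [BooleanAlgebra A]
    [CylAlg (Dim 3) A] (hA : IsSNr 3 n A) (X : Set (Ra3 A)) {y : Ra3 A}
    (hy : CylGen (Dim 3) (Ra.val '' X) y.val) : RelGen X y := by
  obtain ⟨h3, C, _, _, f, hf⟩ := hA
  set i : Dim 3 := ⟨1, by norm_num⟩ with hi
  set j : Dim 3 := ⟨2, by norm_num⟩ with hj
  set k : Dim 3 := ⟨0, by norm_num⟩ with hk
  have hij : i ≠ j := by simp [hi, hj]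
  have hik : i ≠ k := by simp [hi, hk]
  have hjk : j ≠ k := by simp [hj, hk]
  -- The fourth coordinate, available since `4 ≤ n`. Images under `f` do not depend on it, as they
  -- lie in the neat reduct.
  let l : Dim n := ⟨3, lt_of_lt_of_le (by norm_num) hn⟩
  have hl : (3 : ℕ∞) ≤ (l.1 : ℕ∞) := le_rfl
  have hne : ∀ a b : Dim 3, a ≠ b → Dim.incl h3 a ≠ Dim.incl h3 b := fun a b h e =>
    h (Dim.incl_injective h3 e)
  have hlne : ∀ a : Dim 3, Dim.incl h3 a ≠ l := fun a => (Dim.ne_incl h3 hl a).symm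
  have fk : ∀ x : Ra3 A, c (Dim.incl h3 k) (f x.val).1 = (f x.val).1 := fun x => by
    have h1 := f.map_c' k x.val
    rw [show c k x.val = x.val from x.2 k ⟨hik.symm, hjk.symm⟩] at h1
    exact (congrArg Subtype.val h1).symm
  have fl : ∀ x : Ra3 A, c l (f x.val).1 = (f x.val).1 := fun x => (f x.val).2 l hl
  -- This involves only three coordinates, but is verified in `C` with the help of `l` and pulled
  -- back along the injection `f`.
  have e1 : ∀ x y : Ra3 A, c i (x.val ⊓ s j k y.val) = s i k (comp (conv y) x).val :=
    fun x y => hf <| by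
      change f (c i (x.val ⊓ s j k y.val))
        = f (s i k (c k (s j k (s k i (s i j (s j k y.val))) ⊓ s i k x.val)))
      simp only [f.map_c', map_inf, f.map_s]
      exact Subtype.ext (c_inf_s_eq_left (hne _ _ hij) (hne _ _ hik) (hlne _) (hne _ _ hjk)
        (hlne _) (hlne _) (fk x) (fl x) (fl y)).symm
  have e2 : ∀ x y : Ra3 A, c j (x.val ⊓ s i k y.val) = s j k (comp x (conv y)).val :=
    fun x y => hf <| by
      change f (c j (x.val ⊓ s i k y.val))
        = f (s j k (c k (s j k x.val ⊓ s i k (s k i (s i j (s j k y.val))))))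
      simp only [f.map_c', map_inf, f.map_s]
      exact Subtype.ext (c_inf_s_eq_right (hne _ _ hij) (hne _ _ hik) (hlne _) (hne _ _ hjk)
        (hlne _) (hlne _) (fk x) (fl x) (fk y) (fl y)).symm
  have key : ∀ x : A, CylGen (Dim 3) (Ra.val '' X) x → TriangleSum X x := fun x hx => by
    induction hx with
    | base h => obtain ⟨r, hr, rfl⟩ := h; exact .fst (.base hr)
    | bot => exact .bot
    | top => exact TriangleSum.fst (a := ⊤) .top
    | sup _ _ h1 h2 => exact h1.sup h2
    | inf _ _ h1 h2 => exact h1.inf hik hjk h2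
    | compl _ h => exact h.compl hik hjk
    -- In each direction one side of the triangle is independent of `m` and is pulled out. The other
    -- two sides merge into one relation on the side that remains.
    | cyl m _ h =>
      rcases Dim.three_cases m with rfl | rfl | rfl
      · refine h.cyl fun a b e ha hb he => ?_
        rw [inf_comm (s i k b.val), ← inf_assoc, c_inf_of_fixed (c_s_self i k _)]
        change TriangleSum X (c i (a.val ⊓ s j k e.val) ⊓ _)
        rw [e1]
        exact (TriangleSum.snd (he.conv.comp ha)).inf hik hjk (.snd hb)
      · refine h.cyl fun a b e ha hb he => ?_
        rw [← inf_assoc, c_inf_of_fixed (c_s_self j k _)]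
        change TriangleSum X (c j (a.val ⊓ s i k b.val) ⊓ _)
        rw [e2]
        exact (TriangleSum.thd (ha.comp hb.conv)).inf hik hjk (.thd he)
      · refine h.cyl fun a b e ha hb he => ?_
        have := TriangleSum.c_third hik hjk a b e
        rw [hk] at this
        rw [this]
        exact .fst (ha.inf (he.comp hb))
    | diag a b =>
      have h12 : TriangleSum X (d i j) := TriangleSum.fst (a := ident) .ident
      have h02 : TriangleSum X (d k j) := by
        rw [← s_d (i := i) hik hij]; exact TriangleSum.snd (a := ident) .ident
      have h01 : TriangleSum X (d k i) := by
        rw [← s_d (i := j) hjk hij.symm, d_comm j i]; exact TriangleSum.thd (a := ident) .ident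
      have hs : ∀ a : Dim 3, TriangleSum X (d a a) := fun a => by
        rw [d_self]; exact TriangleSum.fst (a := ⊤) .top
      rcases Dim.three_cases a with rfl | rfl | rfl <;>
        rcases Dim.three_cases b with rfl | rfl | rfl <;>
        first
        | exact hs _
        | assumption
        | (rw [d_comm]; assumption)
  have fin : ∀ x : A, TriangleSum X x → ∃ r : Ra3 A, RelGen X r ∧ r.val = c k x := fun x hx => by
    induction hx with
    | bot => exact ⟨⊥, .bot, (c_bot k).symm⟩
    | add a b e _ ha hb he ih =>
      obtain ⟨r, hr, h⟩ := ih
      refine ⟨r ⊔ (a ⊓ comp e b), hr.sup (ha.inf (he.comp hb)), ?_⟩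
      rw [c_sup, TriangleSum.c_third hik hjk, ← h]
      rfl
  obtain ⟨r, hr, h⟩ := fin _ (key _ hy)
  have : r = y := Ra.ext (h.trans (y.2 k ⟨hik.symm, hjk.symm⟩))
  rwa [← this]

/-! ## Arithmetic of relation algebras -/

local infixl:75 " ;; " => RelOps.comp

namespace IsRelAlg

variable {R : Type u} [BooleanAlgebra R] [RelOps R] (hR : IsRelAlg R)
include hR

theorem conv_mono {x y : R} (h : x ≤ y) : conv x ≤ conv y := by
  have := hR.conv_sup x y
  rw [sup_eq_right.2 h] at this
  exact le_sup_left.trans this.ge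

theorem conv_le_iff {x y : R} : conv x ≤ y ↔ x ≤ conv y :=
  ⟨fun h => by have := hR.conv_mono h; rwa [hR.conv_conv] at this,
    fun h => by have := hR.conv_mono h; rwa [hR.conv_conv] at this⟩

theorem conv_inf (x y : R) : conv (x ⊓ y) = conv x ⊓ conv y := by
  apply le_antisymm (le_inf (hR.conv_mono inf_le_left) (hR.conv_mono inf_le_right))
  rw [← hR.conv_le_iff]
  exact le_inf (hR.conv_le_iff.2 inf_le_left) (hR.conv_le_iff.2 inf_le_right)

theorem conv_bot : conv (⊥ : R) = ⊥ := le_bot_iff.1 (hR.conv_le_iff.2 bot_le)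

theorem conv_ident : conv (ident : R) = ident := by
  have := hR.conv_comp (conv ident) ident
  rw [hR.comp_ident, hR.conv_conv, hR.comp_ident] at this
  exact this.symm

theorem ident_comp (x : R) : ident ;; x = x := by
  have := hR.conv_comp (conv x) ident
  rw [hR.comp_ident, hR.conv_conv, hR.conv_ident] at this
  exact this.symm

theorem comp_sup (x y z : R) : x ;; (y ⊔ z) = x ;; y ⊔ x ;; z := by
  rw [← hR.conv_conv (x ;; (y ⊔ z)), hR.conv_comp, hR.conv_sup, hR.sup_comp, hR.conv_sup,
    ← hR.conv_comp, ← hR.conv_comp, hR.conv_conv, hR.conv_conv]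

theorem comp_mono {x y z w : R} (h : x ≤ y) (h' : z ≤ w) : x ;; z ≤ y ;; w := by
  have h1 := hR.sup_comp x y z
  rw [sup_eq_right.2 h] at h1
  have h2 := hR.comp_sup y z w
  rw [sup_eq_right.2 h'] at h2
  exact (le_sup_left.trans h1.ge).trans (le_sup_left.trans h2.ge)

theorem comp_mono_left {x y : R} (h : x ≤ y) (z : R) : x ;; z ≤ y ;; z :=
  hR.comp_mono h le_rfl

theorem comp_mono_right (z : R) {x y : R} (h : x ≤ y) : z ;; x ≤ z ;; y :=
  hR.comp_mono le_rfl h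

/-- Tarski's axiom at `⊤` bounds `x ;; (conv x ;; ⊤)ᶜ` by `⊥`, and `⊥` lies below the right factor.
-/
theorem comp_bot (x : R) : x ;; ⊥ = ⊥ := by
  have h := hR.tarski (conv x) ⊤
  rw [hR.conv_conv, compl_top, le_bot_iff] at h
  exact le_bot_iff.1 ((hR.comp_mono_right x bot_le).trans h.le)

theorem bot_comp (x : R) : ⊥ ;; x = ⊥ := by
  rw [← hR.conv_conv (⊥ ;; x), hR.conv_comp, hR.conv_bot, hR.comp_bot, hR.conv_bot]

/-- The modular law. -/
theorem modular_left (x y z : R) : x ;; y ⊓ z ≤ x ;; (y ⊓ conv x ;; z) := by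
  have h1 : x ;; y ≤ x ;; (y ⊓ conv x ;; z) ⊔ zᶜ := by
    calc x ;; y = x ;; (y ⊓ conv x ;; z) ⊔ x ;; (y ⊓ (conv x ;; z)ᶜ) := by
          rw [← hR.comp_sup, ← inf_sup_left, sup_compl_eq_top, inf_top_eq]
      _ ≤ _ := by
          refine sup_le_sup_left ((hR.comp_mono_right x inf_le_right).trans ?_) _
          have := hR.tarski (conv x) z
          rwa [hR.conv_conv] at this
  calc x ;; y ⊓ z ≤ (x ;; (y ⊓ conv x ;; z) ⊔ zᶜ) ⊓ z := inf_le_inf_right _ h1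
    _ ≤ _ := by rw [inf_sup_right, inf_comm zᶜ, inf_compl_eq_bot, sup_bot_eq]; exact inf_le_left

theorem modular_right (x y z : R) : x ;; y ⊓ z ≤ (x ⊓ z ;; conv y) ;; y := by
  have h := hR.conv_mono (hR.modular_left (conv y) (conv x) (conv z))
  simpa [hR.conv_inf, hR.conv_comp, hR.conv_conv] using h

theorem le_comp_conv_comp (x : R) : x ≤ x ;; conv x ;; x := by
  have h := hR.modular_left x ident x
  rw [hR.comp_ident, inf_idem, hR.comp_assoc] at *
  exact h.trans (hR.comp_mono_right _ inf_le_right)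

theorem conv_of_le_ident {e : R} (he : e ≤ ident) : conv e = e := by
  have h : ∀ e : R, e ≤ ident → e ≤ conv e := fun e he => by
    refine (hR.le_comp_conv_comp e).trans ?_
    refine (hR.comp_mono (hR.comp_mono_left he _) he).trans ?_
    rw [hR.ident_comp, hR.comp_ident]
  exact le_antisymm (hR.conv_le_iff.2 (h e he)) (h e he)

theorem comp_self_of_le_ident {e : R} (he : e ≤ ident) : e ;; e = e := by
  apply le_antisymm
  · exact (hR.comp_mono_left he e).trans (hR.ident_comp e).le
  · have h := hR.le_comp_conv_comp e
    rw [hR.conv_of_le_ident he] at h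
    exact h.trans ((hR.comp_mono_right _ he).trans (hR.comp_ident _).le)

/-- The elements coding the pairs in `w`. -/
theorem le_tabulation {p q w : R} (hw : w ≤ conv p ;; q) :
    w ≤ conv p ;; (ident ⊓ p ;; w ;; conv q) ;; q := by
  calc w ≤ conv p ;; q ⊓ w := le_inf hw le_rfl
    _ ≤ conv p ;; (q ⊓ conv (conv p) ;; w) := hR.modular_left _ _ _
    _ ≤ conv p ;; ((ident ⊓ p ;; w ;; conv q) ;; q) := by
        refine hR.comp_mono_right _ ?_
        have h := hR.modular_right ident q (p ;; w)
        simpa only [hR.ident_comp, hR.conv_conv] using h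
    _ = _ := (hR.comp_assoc _ _ _).symm

/-- A loop of `x ;; y` starts with an `x`-step, so it sits in the domain of `x`. Used to see that
codes have the required projections. -/
theorem ident_inf_comp_le_left (x y : R) : ident ⊓ x ;; y ≤ x ;; conv x := by
  rw [inf_comm]
  refine (hR.modular_left x y ident).trans (hR.comp_mono_right _ ?_)
  rw [hR.comp_ident]; exact inf_le_right

theorem ident_inf_comp_le_right (x y : R) : ident ⊓ x ;; y ≤ conv y ;; y := by
  rw [inf_comm]
  refine (hR.modular_right x y ident).trans (hR.comp_mono_left ?_ _)
  rw [hR.ident_comp]; exact inf_le_right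

end IsRelAlg

/-! ## Representation of quasi-projective relation algebras -/

section Forcing

variable {R : Type u} [BooleanAlgebra R] [RelOps R]

/-- A condition: finitely many named points `f i`, given as functions of a code that ranges over
the nonzero `e ≤ 1'`. -/
structure TypeCond (R : Type u) [BooleanAlgebra R] [RelOps R] where
  size : ℕ
  f : ℕ → R
  e : R
  functional : ∀ i, conv (f i) ;; f i ≤ ident
  le_ident : e ≤ ident
  ne_bot : e ≠ ⊥
  total : ∀ i, e ≤ f i ;; conv (f i)

namespace TypeCond

/-- The strongest relation that is known to hold between the points `i` and `j`. -/
def label (t : TypeCond R) (i j : ℕ) : R := conv (t.f i) ;; t.e ;; t.f j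

instance : Preorder (TypeCond R) where
  le s t := s.size ≤ t.size ∧ ∀ i < s.size, ∀ j < s.size, t.label i j ≤ s.label i j
  le_refl s := ⟨le_rfl, fun _ _ _ _ => le_rfl⟩
  le_trans s t r h1 h2 := ⟨h1.1.trans h2.1, fun i hi j hj =>
    (h2.2 i (hi.trans_le h1.1) j (hj.trans_le h1.1)).trans (h1.2 i hi j hj)⟩

/-- The condition forces `x` to hold between the points `i` and `j`. -/
def Forces (t : TypeCond R) (x : R) (i j : ℕ) : Prop :=
  i < t.size ∧ j < t.size ∧ t.label i j ≤ x

variable {s t : TypeCond R} {x y : R} {i j k : ℕ}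

theorem Forces.of_le (h : s.Forces x i j) (hst : s ≤ t) : t.Forces x i j :=
  ⟨h.1.trans_le hst.1, h.2.1.trans_le hst.1, (hst.2 i h.1 j h.2.1).trans h.2.2⟩

theorem Forces.mono (h : s.Forces x i j) (hxy : x ≤ y) : s.Forces y i j :=
  ⟨h.1, h.2.1, h.2.2.trans hxy⟩

variable (hR : IsRelAlg R)
include hR

/-- Every code in `e` has a value under `f i`, so `f j` can be reached by passing through that
value. This expresses that the labels lose no code, and with `e ≠ ⊥` it makes all labels nonzero. -/
theorem e_comp_le (t : TypeCond R) (i j : ℕ) : t.e ;; t.f j ≤ t.f i ;; t.label i j := by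
  calc t.e ;; t.f j = t.e ;; (t.e ;; t.f j) := by
        rw [← hR.comp_assoc, hR.comp_self_of_le_ident t.le_ident]
    _ ≤ t.f i ;; conv (t.f i) ;; (t.e ;; t.f j) := hR.comp_mono_left (t.total i) _
    _ = _ := by simp only [label, hR.comp_assoc]

theorem e_comp_ne_bot (t : TypeCond R) (j : ℕ) : t.e ;; t.f j ≠ ⊥ := fun h => t.ne_bot (by
  rw [← le_bot_iff]
  calc t.e = t.e ;; t.e := (hR.comp_self_of_le_ident t.le_ident).symm
    _ ≤ t.e ;; (t.f j ;; conv (t.f j)) := hR.comp_mono_right _ (t.total j)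
    _ = ⊥ := by rw [← hR.comp_assoc, h, hR.bot_comp])

theorem label_ne_bot (t : TypeCond R) (i j : ℕ) : t.label i j ≠ ⊥ := fun h =>
  t.e_comp_ne_bot hR j (le_bot_iff.1 (by
    have := t.e_comp_le hR i j
    rwa [h, hR.comp_bot] at this))

theorem conv_label (t : TypeCond R) (i j : ℕ) : conv (t.label i j) = t.label j i := by
  simp only [label, hR.conv_comp, hR.conv_conv, hR.conv_of_le_ident t.le_ident, hR.comp_assoc]

theorem label_self_le (t : TypeCond R) (i : ℕ) : t.label i i ≤ ident := by
  refine le_trans (hR.comp_mono_left (hR.comp_mono_right _ t.le_ident) _) ?_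
  rw [hR.comp_ident]; exact t.functional i

theorem label_le_comp (t : TypeCond R) (i j k : ℕ) : t.label i j ≤ t.label i k ;; t.label k j := by
  calc t.label i j = conv (t.f i) ;; t.e ;; (t.e ;; t.f j) := by
        rw [← hR.comp_assoc (conv (t.f i) ;; t.e), hR.comp_assoc (conv (t.f i)) t.e t.e,
          hR.comp_self_of_le_ident t.le_ident, label]
    _ ≤ conv (t.f i) ;; t.e ;; (t.f k ;; t.label k j) :=
        hR.comp_mono_right _ (t.e_comp_le hR k j)
    _ = _ := by simp only [label, hR.comp_assoc]

/-- Shrinking the set of codes. -/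
theorem exists_shrink (t : TypeCond R) {e : R} (he : e ≤ t.e) (hne : e ≠ ⊥) :
    ∃ t', t ≤ t' ∧ t'.size = t.size ∧ ∀ i j, t'.label i j = conv (t.f i) ;; e ;; t.f j :=
  ⟨⟨t.size, t.f, e, t.functional, he.trans t.le_ident, hne, fun i => he.trans (t.total i)⟩,
    ⟨le_rfl, fun _ _ _ _ => hR.comp_mono_left (hR.comp_mono_right _ he) _⟩, rfl, fun _ _ => rfl⟩

/-- The codes split into those whose points `i`, `j` are related by `x` and those whose points are
related by `xᶜ`. Keep a nonempty half. -/
theorem exists_decide (t : TypeCond R) (x : R) (i j : ℕ) (hi : i < t.size) (hj : j < t.size) :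
    ∃ t', t ≤ t' ∧ (t'.Forces x i j ∨ t'.Forces xᶜ i j) := by
  have key : ∀ z : R, conv (t.f i) ;; (t.e ⊓ t.f i ;; z ;; conv (t.f j)) ;; t.f j ≤ z := fun z => by
    calc _ ≤ conv (t.f i) ;; (t.f i ;; z ;; conv (t.f j)) ;; t.f j :=
          hR.comp_mono_left (hR.comp_mono_right _ inf_le_right) _
      _ = (conv (t.f i) ;; t.f i) ;; z ;; (conv (t.f j) ;; t.f j) := by
          simp only [hR.comp_assoc]
      _ ≤ ident ;; z ;; ident :=
          hR.comp_mono (hR.comp_mono_left (t.functional i) _) (t.functional j)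
      _ = z := by rw [hR.ident_comp, hR.comp_ident]
  have hsup : t.e ≤ (t.e ⊓ t.f i ;; x ;; conv (t.f j)) ⊔ (t.e ⊓ t.f i ;; xᶜ ;; conv (t.f j)) := by
    rw [← inf_sup_left, ← hR.sup_comp, ← hR.comp_sup, sup_compl_eq_top]
    refine le_inf le_rfl ?_
    calc t.e = t.e ;; t.e := (hR.comp_self_of_le_ident t.le_ident).symm
      _ ≤ t.f i ;; conv (t.f i) ;; (t.f j ;; conv (t.f j)) := hR.comp_mono (t.total i) (t.total j)
      _ = t.f i ;; (conv (t.f i) ;; t.f j) ;; conv (t.f j) := by simp only [hR.comp_assoc]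
      _ ≤ _ := hR.comp_mono_left (hR.comp_mono_right _ le_top) _
  by_cases h : t.e ⊓ t.f i ;; x ;; conv (t.f j) = ⊥
  · have h2 : t.e ⊓ t.f i ;; xᶜ ;; conv (t.f j) ≠ ⊥ := fun h2 => t.ne_bot (by
      rwa [h, h2, sup_bot_eq, le_bot_iff] at hsup)
    obtain ⟨t', h1, h3, h4⟩ := t.exists_shrink hR inf_le_left h2
    exact ⟨t', h1, .inr ⟨h3 ▸ hi, h3 ▸ hj, (h4 i j).le.trans (key _)⟩⟩
  · obtain ⟨t', h1, h3, h4⟩ := t.exists_shrink hR inf_le_left h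
    exact ⟨t', h1, .inl ⟨h3 ▸ hi, h3 ▸ hj, (h4 i j).le.trans (key _)⟩⟩

variable {p q : R} (hpq : IsQuasiProj p q)
include hpq

/-- Relate each old code to the possible intermediate points, and let the new codes be pairs `(old
code, intermediate point)`. Quasi-projections code all such pairs; old points are read through `p`,
the new point through `q`. -/
theorem exists_witness (h : t.Forces (x ;; y) i j) :
    ∃ t' k, t ≤ t' ∧ t'.Forces x i k ∧ t'.Forces y k j := by
  obtain ⟨hi, hj, hl⟩ := h
  set w := t.e ;; t.f i ;; x ⊓ t.e ;; t.f j ;; conv y with hw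
  have hw1 : w ≤ t.e ;; t.f i ;; x := inf_le_left
  have hw2 : w ≤ t.e ;; t.f j ;; conv y := inf_le_right
  -- If no code had an intermediate point, the modular law would make `t.e ;; t.f j` vanish,
  -- although each code has a value under `f j`.
  have hwne : w ≠ ⊥ := fun h0 => t.e_comp_ne_bot hR j (by
    rw [← le_bot_iff]
    have h1 : t.e ;; t.f j ≤ t.e ;; t.f i ;; x ;; y := by
      calc t.e ;; t.f j = t.e ;; (t.e ;; t.f j) := by
            rw [← hR.comp_assoc, hR.comp_self_of_le_ident t.le_ident]
        _ ≤ t.e ;; (t.f i ;; (x ;; y)) := hR.comp_mono_right _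
            ((t.e_comp_le hR i j).trans (hR.comp_mono_right _ hl))
        _ = _ := by simp only [hR.comp_assoc]
    have h2 := hR.modular_right (t.e ;; t.f i ;; x) y (t.e ;; t.f j)
    rw [← hw, h0, hR.bot_comp] at h2
    exact (le_inf h1 le_rfl).trans h2)
  set e' := ident ⊓ p ;; w ;; conv q with he'
  have htab : w ≤ conv p ;; e' ;; q := hR.le_tabulation (by rw [hpq.pairing]; exact le_top)
  have he'ne : e' ≠ ⊥ := fun h0 => hwne (by
    rwa [h0, hR.comp_bot, hR.bot_comp, le_bot_iff] at htab)
  have he'id : e' ≤ ident := inf_le_left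
  have hee : conv t.e = t.e := hR.conv_of_le_ident t.le_ident
  have hp : e' ≤ p ;; t.e ;; conv p := by
    have h1 : e' ≤ ident ⊓ p ;; t.e ;; (t.f i ;; x ;; conv q) := by
      refine inf_le_inf_left _ ?_
      refine (hR.comp_mono_left (hR.comp_mono_right _ hw1) _).trans ?_
      simp only [hR.comp_assoc]; exact le_rfl
    refine (h1.trans (hR.ident_inf_comp_le_left _ _)).trans ?_
    rw [hR.conv_comp, hee, hR.comp_assoc, ← hR.comp_assoc t.e,
      hR.comp_self_of_le_ident t.le_ident, hR.comp_assoc]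
  have hq : e' ≤ q ;; conv q := by
    have h1 := hR.ident_inf_comp_le_right (p ;; w) (conv q)
    rwa [hR.conv_conv] at h1
  -- The first component of a new code is an old code, so labels between old points can only shrink.
  have hpe : conv p ;; e' ;; p ≤ t.e := by
    calc _ ≤ conv p ;; (p ;; t.e ;; conv p) ;; p :=
          hR.comp_mono_left (hR.comp_mono_right _ hp) _
      _ = (conv p ;; p) ;; t.e ;; (conv p ;; p) := by simp only [hR.comp_assoc]
      _ ≤ ident ;; t.e ;; ident :=
          hR.comp_mono (hR.comp_mono_left hpq.fst_functional _) hpq.fst_functional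
      _ = t.e := by rw [hR.ident_comp, hR.comp_ident]
  have hpw : conv p ;; e' ;; q ≤ w := by
    calc _ ≤ conv p ;; (p ;; w ;; conv q) ;; q :=
          hR.comp_mono_left (hR.comp_mono_right _ inf_le_right) _
      _ = (conv p ;; p) ;; w ;; (conv q ;; q) := by simp only [hR.comp_assoc]
      _ ≤ ident ;; w ;; ident :=
          hR.comp_mono (hR.comp_mono_left hpq.fst_functional _) hpq.snd_functional
      _ = w := by rw [hR.ident_comp, hR.comp_ident]
  -- The new point takes the index `t.size`. The function previously stored there is discarded
  -- harmlessly, since the order on conditions compares only indices below the size.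
  let f' : ℕ → R := fun k => if k = t.size then q else p ;; t.f k
  have hf' : ∀ k, k < t.size → f' k = p ;; t.f k := fun k hk => if_neg hk.ne
  have hf'm : f' t.size = q := if_pos rfl
  let t' : TypeCond R :=
    { size := t.size + 1
      f := f'
      e := e'
      functional := fun k => by
        by_cases hk : k = t.size
        · rw [hk, hf'm]; exact hpq.snd_functional
        · rw [show f' k = p ;; t.f k from if_neg hk, hR.conv_comp]
          calc _ = conv (t.f k) ;; (conv p ;; p) ;; t.f k := by simp only [hR.comp_assoc]
            _ ≤ conv (t.f k) ;; ident ;; t.f k :=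
              hR.comp_mono_left (hR.comp_mono_right _ hpq.fst_functional) _
            _ ≤ _ := by rw [hR.comp_ident]; exact t.functional k
      le_ident := he'id
      ne_bot := he'ne
      total := fun k => by
        by_cases hk : k = t.size
        · rw [hk, hf'm]; exact hq
        · rw [show f' k = p ;; t.f k from if_neg hk, hR.conv_comp]
          calc e' ≤ p ;; t.e ;; conv p := hp
            _ ≤ p ;; (t.f k ;; conv (t.f k)) ;; conv p :=
              hR.comp_mono_left (hR.comp_mono_right _ (t.total k)) _
            _ = _ := by simp only [hR.comp_assoc] }
  have l1 : ∀ a < t.size, ∀ b < t.size, t'.label a b ≤ t.label a b := fun a ha b hb => by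
    change conv (f' a) ;; e' ;; f' b ≤ _
    rw [hf' a ha, hf' b hb, hR.conv_comp]
    calc _ = conv (t.f a) ;; (conv p ;; e' ;; p) ;; t.f b := by simp only [hR.comp_assoc]
      _ ≤ _ := hR.comp_mono_left (hR.comp_mono_right _ hpe) _
  have l2 : t'.label i t.size ≤ x := by
    change conv (f' i) ;; e' ;; f' t.size ≤ x
    rw [hf' i hi, hf'm, hR.conv_comp]
    calc _ = conv (t.f i) ;; (conv p ;; e' ;; q) := by simp only [hR.comp_assoc]
      _ ≤ conv (t.f i) ;; (t.e ;; t.f i ;; x) := hR.comp_mono_right _ (hpw.trans hw1)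
      _ = t.label i i ;; x := by simp only [label, hR.comp_assoc]
      _ ≤ ident ;; x := hR.comp_mono_left (t.label_self_le hR i) _
      _ = x := hR.ident_comp x
  have l3 : t'.label j t.size ≤ conv y := by
    change conv (f' j) ;; e' ;; f' t.size ≤ conv y
    rw [hf' j hj, hf'm, hR.conv_comp]
    calc _ = conv (t.f j) ;; (conv p ;; e' ;; q) := by simp only [hR.comp_assoc]
      _ ≤ conv (t.f j) ;; (t.e ;; t.f j ;; conv y) := hR.comp_mono_right _ (hpw.trans hw2)
      _ = t.label j j ;; conv y := by simp only [label, hR.comp_assoc]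
      _ ≤ ident ;; conv y := hR.comp_mono_left (t.label_self_le hR j) _
      _ = conv y := hR.ident_comp _
  refine ⟨t', t.size, ⟨Nat.le_succ _, l1⟩, ⟨hi.trans (Nat.lt_succ_self _), Nat.lt_succ_self _, l2⟩,
    Nat.lt_succ_self _, hj.trans (Nat.lt_succ_self _), ?_⟩
  rw [← t'.conv_label hR, hR.conv_le_iff]
  exact l3

/-- Start from the codes of pairs in `r`, with `p` reading off point 0 and `q` point 1; `q` also
serves as filler at all higher indices. -/
theorem exists_forces {r : R} (hr : r ≠ ⊥) : ∃ t : TypeCond R, t.Forces r 0 1 := by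
  have htab := hR.le_tabulation (p := p) (q := q) (w := r) (by rw [hpq.pairing]; exact le_top)
  set e := ident ⊓ p ;; r ;; conv q with he
  let f : ℕ → R := fun k => if k = 0 then p else q
  refine ⟨⟨2, f, e, fun k => ?_, inf_le_left, fun h0 => ?_, fun k => ?_⟩, Nat.zero_lt_two, Nat.one_lt_two, ?_⟩
  · by_cases hk : k = 0
    · rw [show f k = p from if_pos hk]; exact hpq.fst_functional
    · rw [show f k = q from if_neg hk]; exact hpq.snd_functional
  · rw [h0, hR.comp_bot, hR.bot_comp, le_bot_iff] at htab
    exact hr htab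
  · by_cases hk : k = 0
    · rw [show f k = p from if_pos hk]
      have h1 := hR.ident_inf_comp_le_left p (r ;; conv q)
      rwa [← hR.comp_assoc] at h1
    · rw [show f k = q from if_neg hk]
      have h1 := hR.ident_inf_comp_le_right (p ;; r) (conv q)
      rwa [hR.conv_conv] at h1
  · change conv p ;; e ;; q ≤ r
    calc _ ≤ conv p ;; (p ;; r ;; conv q) ;; q :=
          hR.comp_mono_left (hR.comp_mono_right _ inf_le_right) _
      _ = (conv p ;; p) ;; r ;; (conv q ;; q) := by simp only [hR.comp_assoc]
      _ ≤ ident ;; r ;; ident :=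
          hR.comp_mono (hR.comp_mono_left hpq.fst_functional _) hpq.snd_functional
      _ = r := by rw [hR.ident_comp, hR.comp_ident]

/-- The set of conditions that decide `x` and `x ; y` at `i`, `j`, and provide a witness for the
latter. -/
theorem isCofinal_decide (x y : R) (i j : ℕ) :
    IsCofinal {t : TypeCond R | (t.Forces x i j ∨ t.Forces xᶜ i j) ∧
      (t.Forces (x ;; y)ᶜ i j ∨ ∃ k, t.Forces x i k ∧ t.Forces y k j)} := fun t => by
  -- Enlarging `size` is free, because `f` is functional and total on the codes at every index. The
  -- new labels are not constrained by the order.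
  have h0 : ∃ t', t ≤ t' ∧ i < t'.size ∧ j < t'.size :=
    ⟨{ t with size := max t.size (max i j + 1) }, ⟨le_max_left _ _, fun _ _ _ _ => le_rfl⟩,
      by simp only [lt_max_iff]; omega, by simp only [lt_max_iff]; omega⟩
  obtain ⟨t0, h0, hi, hj⟩ := h0
  obtain ⟨t1, h1, hx⟩ := t0.exists_decide hR x i j hi hj
  obtain ⟨t2, h2, hy⟩ := t1.exists_decide hR (x ;; y) i j (hi.trans_le h1.1) (hj.trans_le h1.1)
  have hx2 := hx.imp (fun h => h.of_le h2) (fun h => h.of_le h2)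
  rcases hy with hy | hy
  · obtain ⟨t3, k, h3, hk, hk'⟩ := exists_witness hR hpq hy
    exact ⟨t3, ⟨hx2.imp (fun h => h.of_le h3) (fun h => h.of_le h3), .inr ⟨k, hk, hk'⟩⟩,
      ((h0.trans h1).trans h2).trans h3⟩
  · exact ⟨t2, ⟨hx2, .inl hy⟩, (h0.trans h1).trans h2⟩

/-- Rasiowa–Sikorski: finiteness of `F` leaves countably many requirements, so an ideal containing a
condition that forces `r` meets them all. A relation holds when some member of the ideal forces it.
-/
theorem exists_generic {r : R} (hr : r ≠ ⊥) (F : Finset R) :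
    ∃ H : R → ℕ → ℕ → Prop, H r 0 1 ∧ (∀ i j, ¬ H ⊥ i j) ∧
      (∀ x y i j, x ≤ y → H x i j → H y i j) ∧
      (∀ x y i j, H x i j → H y i j → H (x ⊓ y) i j) ∧
      (∀ x ∈ F, ∀ i j, H x i j ∨ H xᶜ i j) ∧
      (∀ x i j, H x i j → H (conv x) j i) ∧
      (F.Nonempty → ∀ i, H ident i i) ∧
      (∀ x y i j k, H x i k → H y k j → H (x ;; y) i j) ∧
      (∀ x ∈ F, ∀ y ∈ F, ∀ i j, H (x ;; y) i j → ∃ k, H x i k ∧ H y k j) := by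
  obtain ⟨t0, ht0⟩ := exists_forces hR hpq hr
  let ι := ℕ × ℕ × F × F
  have : Encodable ι := Encodable.ofCountable _
  let D : ι → Order.Cofinal (TypeCond R) := fun a =>
    ⟨_, isCofinal_decide hR hpq a.2.2.1.1 a.2.2.2.1 a.1 a.2.1⟩
  let G := Order.idealOfCofinals t0 D
  have hG : ∀ s ∈ G, ∀ t ∈ G, ∃ w ∈ G, s ≤ w ∧ t ≤ w := fun s hs t ht => G.directed s hs t ht
  have hinf : ∀ x y i j, (∃ t ∈ G, t.Forces x i j) → (∃ t ∈ G, t.Forces y i j) →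
      ∃ t ∈ G, t.Forces (x ⊓ y) i j := by
    rintro x y i j ⟨s, hs, h⟩ ⟨t, ht, h'⟩
    obtain ⟨w, hw, h1, h2⟩ := hG s hs t ht
    exact ⟨w, hw, (h.of_le h1).1, (h.of_le h1).2.1, le_inf (h.of_le h1).2.2 (h'.of_le h2).2.2⟩
  have hbot : ∀ i j, ¬ ∃ t ∈ G, t.Forces (⊥ : R) i j := by
    rintro i j ⟨t, _, h⟩
    exact t.label_ne_bot hR i j (le_bot_iff.1 h.2.2)
  refine ⟨fun x i j => ∃ t ∈ G, t.Forces x i j, ⟨t0, Order.mem_idealOfCofinals _ _, ht0⟩, hbot,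
    ?_, hinf, ?_, ?_, ?_, ?_, ?_⟩
  · rintro x y i j hxy ⟨t, ht, h⟩
    exact ⟨t, ht, h.mono hxy⟩
  · intro x hx i j
    obtain ⟨t, ht, htG⟩ := Order.cofinal_meets_idealOfCofinals t0 D (i, j, ⟨x, hx⟩, ⟨x, hx⟩)
    exact ht.1.imp (fun h => ⟨t, htG, h⟩) (fun h => ⟨t, htG, h⟩)
  · rintro x i j ⟨t, ht, h⟩
    refine ⟨t, ht, h.2.1, h.1, ?_⟩
    rw [← t.conv_label hR]
    exact hR.conv_mono h.2.2
  · rintro ⟨x, hx⟩ i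
    -- Any element of `F` will do: a condition deciding it at `(i, i)` has `i` below its size.
    obtain ⟨t, ht, htG⟩ := Order.cofinal_meets_idealOfCofinals t0 D (i, i, ⟨x, hx⟩, ⟨x, hx⟩)
    have hi : i < t.size := ht.1.elim (fun h => h.1) (fun h => h.1)
    exact ⟨t, htG, hi, hi, t.label_self_le hR i⟩
  · rintro x y i j k ⟨s, hs, h⟩ ⟨t, ht, h'⟩
    obtain ⟨w, hw, h1, h2⟩ := hG s hs t ht
    have h3 := h.of_le h1
    have h4 := h'.of_le h2
    exact ⟨w, hw, h3.1, h4.2.1, (w.label_le_comp hR i j k).trans (hR.comp_mono h3.2.2 h4.2.2)⟩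
  · intro x hx y hy i j h
    obtain ⟨t, ht, htG⟩ := Order.cofinal_meets_idealOfCofinals t0 D (i, j, ⟨x, hx⟩, ⟨y, hy⟩)
    rcases ht.2 with h' | ⟨k, h1, h2⟩
    · exfalso
      have := hinf _ _ i j h ⟨t, htG, h'⟩
      rw [inf_compl_eq_bot] at this
      exact hbot i j this
    · exact ⟨k, ⟨t, htG, h1⟩, ⟨t, htG, h2⟩⟩

end TypeCond

end Forcing

/-- `h` represents `R` by all binary relations `h x` on the set `U`; it need not be injective. -/
structure IsRelRep {R : Type u} [BooleanAlgebra R] [RelOps R] {U : Type v}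
    (h : R → U → U → Prop) : Prop where
  map_sup : ∀ x y a b, h (x ⊔ y) a b ↔ h x a b ∨ h y a b
  map_inf : ∀ x y a b, h (x ⊓ y) a b ↔ h x a b ∧ h y a b
  map_bot : ∀ a b, ¬ h ⊥ a b
  map_top : ∀ a b, h ⊤ a b
  map_comp : ∀ x y a b, h (x ;; y) a b ↔ ∃ u, h x a u ∧ h y u b
  map_conv : ∀ x a b, h (conv x) a b ↔ h x b a
  map_ident : ∀ a b, h ident a b ↔ a = b

/-- The structures generic for finite `F ⊆ R` are combined along an ultrafilter on `Finset R` for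
which every `x` belongs to almost all `F`. Decisions and witnesses then exist for every element of
`R`. -/
theorem exists_relRep {R : Type u} [BooleanAlgebra R] [RelOps R] (hR : IsRelAlg R) {p q : R}
    (hpq : IsQuasiProj p q) {r : R} (hr : r ≠ ⊥) :
    ∃ (U : Type u) (h : R → U → U → Prop), IsRelRep h ∧ ∃ a b, h r a b := by
  choose H H0 Hbot Hmono Hinf Hdec Hconv Hid Hcomp Hwit using
    TypeCond.exists_generic hR hpq hr
  let 𝒰 : Ultrafilter (Finset R) := Ultrafilter.of Filter.atTop
  have hle : (𝒰 : Filter (Finset R)) ≤ Filter.atTop := Ultrafilter.of_le _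
  have hmem : ∀ x : R, ∀ᶠ F in (𝒰 : Filter (Finset R)), x ∈ F := fun x =>
    hle ((Filter.eventually_ge_atTop {x}).mono fun F hF => hF (Finset.mem_singleton_self x))
  let V := Finset R → ℕ
  let K : R → V → V → Prop := fun x a b => ∀ᶠ F in (𝒰 : Filter (Finset R)), H F x (a F) (b F)
  have Kmono : ∀ x y a b, x ≤ y → K x a b → K y a b := fun x y a b hxy h =>
    h.mono fun F hF => Hmono F x y _ _ hxy hF
  have Kinf : ∀ x y a b, K (x ⊓ y) a b ↔ K x a b ∧ K y a b := fun x y a b =>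
    ⟨fun h => ⟨Kmono _ _ _ _ inf_le_left h, Kmono _ _ _ _ inf_le_right h⟩,
      fun h => (h.1.and h.2).mono fun F hF => Hinf F x y _ _ hF.1 hF.2⟩
  have Kbot : ∀ a b, ¬ K ⊥ a b := fun a b h => by
    obtain ⟨F, hF⟩ := h.exists
    exact Hbot F _ _ hF
  have Kdec : ∀ x a b, K x a b ∨ K xᶜ a b := fun x a b =>
    Ultrafilter.eventually_or.1 ((hmem x).mono fun F hF => Hdec F x hF _ _)
  have Ksup : ∀ x y a b, K (x ⊔ y) a b ↔ K x a b ∨ K y a b := fun x y a b => by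
    refine ⟨fun h => (Kdec x a b).imp_right fun h' => ?_, fun h =>
      h.elim (Kmono _ _ _ _ le_sup_left) (Kmono _ _ _ _ le_sup_right)⟩
    refine Kmono _ _ _ _ ?_ ((Kinf _ _ _ _).2 ⟨h, h'⟩)
    rw [inf_sup_right, inf_compl_eq_bot, bot_sup_eq]
    exact inf_le_left
  have Ktop : ∀ a b, K ⊤ a b := fun a b =>
    (Kdec ⊤ a b).resolve_right (by rw [compl_top]; exact Kbot a b)
  have Kconv : ∀ x a b, K (conv x) a b ↔ K x b a := fun x a b => by
    have h1 : ∀ x a b, K x a b → K (conv x) b a := fun x a b h => h.mono fun F => Hconv F x _ _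
    refine ⟨fun h => ?_, h1 x b a⟩
    have := h1 _ _ _ h
    rwa [hR.conv_conv] at this
  have Kid : ∀ a, K ident a a := fun a => (hmem ⊤).mono fun F hF => Hid F ⟨_, hF⟩ _
  have Kcomp : ∀ x y a b, K (x ;; y) a b ↔ ∃ u, K x a u ∧ K y u b := fun x y a b => by
    constructor
    · intro h
      have h1 : ∀ᶠ F in (𝒰 : Filter (Finset R)), ∃ k, H F x (a F) k ∧ H F y k (b F) := by
        filter_upwards [h, hmem x, hmem y] with F h hx hy using Hwit F x hx y hy _ _ h
      obtain ⟨u, hu⟩ := h1.choice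
      exact ⟨u, hu.mono fun F h => h.1, hu.mono fun F h => h.2⟩
    · rintro ⟨u, h1, h2⟩
      exact (h1.and h2).mono fun F hF => Hcomp F _ _ _ _ _ hF.1 hF.2
  -- In the combined structure `1'` is a congruence only. Dividing by it makes `1'` true equality
  -- and also absorbs equality modulo the ultrafilter.
  let S : Setoid V :=
    ⟨K ident, Kid, fun {a b} h => by
      rw [← Kconv, hR.conv_ident]; exact h, fun {a b e} h h' => by
      rw [← hR.comp_ident ident, Kcomp]; exact ⟨b, h, h'⟩⟩
  have Kcongr : ∀ x a b a' b', K ident a a' → K ident b b' → K x a b → K x a' b' :=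
    fun x a b a' b' ha hb h => by
      have h1 : K (ident ;; x ;; ident) a' b' :=
        (Kcomp _ _ _ _).2 ⟨b, (Kcomp _ _ _ _).2 ⟨a, S.symm ha, h⟩, hb⟩
      rwa [hR.comp_ident, hR.ident_comp] at h1
  have hout : ∀ a : V, K ident a (Quotient.mk S a).out := fun a => S.symm (Quotient.mk_out a)
  refine ⟨Quotient S, fun x a b => K x a.out b.out, ⟨fun x y a b => Ksup _ _ _ _,
    fun x y a b => Kinf _ _ _ _, fun a b => Kbot _ _, fun a b => Ktop _ _, fun x y a b => ?_,
    fun x a b => Kconv _ _ _, fun a b => ?_⟩, ?_⟩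
  · rw [Kcomp]
    constructor
    · rintro ⟨u, h1, h2⟩
      exact ⟨Quotient.mk S u, Kcongr _ _ _ _ _ (Kid _) (hout u) h1,
        Kcongr _ _ _ _ _ (hout u) (Kid _) h2⟩
    · rintro ⟨u, h1, h2⟩
      exact ⟨_, h1, h2⟩
  · constructor
    · intro h
      rw [← Quotient.out_eq a, ← Quotient.out_eq b]
      exact Quotient.sound h
    · rintro rfl; exact Kid _
  · exact ⟨Quotient.mk S fun _ => 0, Quotient.mk S fun _ => 1,
      Kcongr _ _ _ _ _ (hout _) (hout _) (Filter.Eventually.of_forall fun F => H0 F)⟩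

/-! ## Cylindric set algebras -/

section SetAlgebra

variable {I : Type w} {U : Type v}

open Classical in
instance : CylAlg I (Set (I → U)) where
  c i X := {σ | ∃ u, Function.update σ i u ∈ X}
  d i j := {σ | σ i = σ j}
  c_bot i := Set.eq_empty_iff_forall_notMem.2 fun σ h => h.elim fun _ h => h
  le_c i X σ h := ⟨σ i, by rwa [Function.update_eq_self]⟩
  c_inf_c i X Y := Set.ext fun σ => by
    simp [← exists_and_right]
  c_comm i j X := Set.ext fun σ => by
    by_cases h : i = j
    · rw [h]
    · constructor
      · rintro ⟨u, v, hv⟩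
        exact ⟨v, u, by rwa [Function.update_comm (Ne.symm h)]⟩
      · rintro ⟨u, v, hv⟩
        exact ⟨v, u, by rwa [Function.update_comm h]⟩
  d_self i := Set.eq_univ_of_forall fun σ => rfl
  d_trans i j k hi hj := Set.ext fun σ => by
    simp [hi.symm, hj.symm]
  d_subst i j X h := Set.eq_empty_iff_forall_notMem.2 fun σ => by
    rintro ⟨⟨u, h1, h2⟩, ⟨v, h3, h4⟩⟩
    simp only [Set.mem_ofPred_eq, Function.update_self, Function.update_of_ne (Ne.symm h)] at h1 h3
    subst h1; subst h3
    exact h4 h2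

theorem mem_c {i : I} {X : Set (I → U)} {σ : I → U} [DecidableEq I] :
    σ ∈ c i X ↔ ∃ u, Function.update σ i u ∈ X := by
  have : σ ∈ c i X ↔ ∃ u, (@Function.update I (fun _ => U) (Classical.decEq I) σ i u) ∈ X := Iff.rfl
  rw [this]
  refine exists_congr fun u => ?_
  rw [Subsingleton.elim (Classical.decEq I)]

theorem mem_d {i j : I} {σ : I → U} : σ ∈ (d i j : Set (I → U)) ↔ σ i = σ j := Iff.rfl

theorem mem_s {i j : I} (hij : i ≠ j) {X : Set (I → U)} {σ : I → U} [DecidableEq I] :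
    σ ∈ s i j X ↔ Function.update σ i (σ j) ∈ X := by
  rw [s, mem_c]
  constructor
  · rintro ⟨u, h1, h2⟩
    rw [mem_d, Function.update_self, Function.update_of_ne hij.symm] at h1
    rwa [← h1]
  · intro h
    exact ⟨σ j, by rw [mem_d, Function.update_self, Function.update_of_ne hij.symm], h⟩

variable {Q : Type u} [BooleanAlgebra Q] [RelOps Q]

/-- A family of representations of `Q` yields a homomorphism to the relation algebra reduct of a
product of cylindric set algebras. -/
def RAHom.ofRelRep {J : Type u} {U : J → Type v} (h : ∀ r, Q → U r → U r → Prop)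
    (hh : ∀ r, IsRelRep (h r)) {i j k : I} (hij : i ≠ j) (hik : i ≠ k) (hjk : j ≠ k) :
    RAHom Q (Ra i j k (∀ r, Set (I → U r))) where
  toFun x := ⟨fun r => {σ | h r x (σ i) (σ j)}, fun l hl => by
    classical
    refine funext fun r => Set.ext fun σ => mem_c.trans ?_
    simp only [Set.mem_ofPred_eq, Function.update_of_ne hl.1.symm, Function.update_of_ne hl.2.symm]
    exact ⟨fun h => h.elim fun _ h => h, fun h => ⟨σ i, h⟩⟩⟩
  map_sup' x y := Subtype.ext (funext fun r => Set.ext fun σ => (hh r).map_sup x y _ _)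
  map_inf' x y := Subtype.ext (funext fun r => Set.ext fun σ => (hh r).map_inf x y _ _)
  map_top' := Subtype.ext (funext fun r => Set.eq_univ_of_forall fun σ => (hh r).map_top _ _)
  map_bot' := Subtype.ext (funext fun r =>
    Set.eq_empty_iff_forall_notMem.2 fun σ => (hh r).map_bot _ _)
  map_ident' := Subtype.ext (funext fun r => Set.ext fun σ => (hh r).map_ident _ _)
  map_comp' x y := Subtype.ext (funext fun r => Set.ext fun σ => by
    classical
    refine ((hh r).map_comp x y _ _).trans ?_
    change _ ↔ σ ∈ c k (s j k {σ | h r x (σ i) (σ j)} ∩ s i k {σ | h r y (σ i) (σ j)})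
    simp [mem_c, mem_s hjk, mem_s hik, hij, hij.symm, hik, hjk])
  map_conv' x := Subtype.ext (funext fun r => Set.ext fun σ => by
    classical
    refine ((hh r).map_conv x _ _).trans ?_
    change _ ↔ σ ∈ s k i (s i j (s j k {σ | h r x (σ i) (σ j)}))
    simp [mem_s hjk, mem_s hik.symm, mem_s hij, hij, hik.symm, hjk])

/-- The factor belonging to a nonzero `r` keeps `r` nonzero, so the product over all of them has
trivial kernel. -/
theorem exists_ra_embedding {I : Type} {i j k : I} (hij : i ≠ j) (hik : i ≠ k) (hjk : j ≠ k)
    (hQ : IsQRA Q) :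
    ∃ (C : Type u) (_ : BooleanAlgebra C) (_ : CylAlg I C) (e : RAHom Q (Ra i j k C)),
      Function.Injective e := by
  classical
  obtain ⟨hR, p, q, hpq⟩ := hQ
  choose U h hh hne using fun r : {r : Q // r ≠ ⊥} => exists_relRep hR hpq r.2
  refine ⟨∀ r, Set (I → U r), inferInstance, inferInstance, RAHom.ofRelRep h hh hij hik hjk,
    RAHom.injective_of_ker _ fun x hx => ?_⟩
  by_contra hne'
  obtain ⟨a, b, hab⟩ := hne ⟨x, hne'⟩
  have h1 : {σ : I → U ⟨x, hne'⟩ | h ⟨x, hne'⟩ x (σ i) (σ j)} = ∅ :=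
    congrFun (congrArg Ra.val hx) ⟨x, hne'⟩
  have h2 : (fun l => if l = j then b else a) ∈
      {σ : I → U ⟨x, hne'⟩ | h ⟨x, hne'⟩ x (σ i) (σ j)} := by
    simpa [hij] using hab
  rw [h1] at h2
  exact h2

end SetAlgebra

/-! ## Dilations as generated subalgebras -/

section Dilation

variable {I : Type w} {i j k : I} {Q : Type u} [BooleanAlgebra Q] [RelOps Q]
  {C : Type v} [BooleanAlgebra C] [CylAlg I C]

/-- A homomorphism to a relation algebra reduct, with the codomain restricted to the reduct of
the generated subalgebra. -/
def RAHom.toSub (e : RAHom Q (Ra i j k C)) :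
    RAHom Q (Ra i j k (cylSub I (Set.range fun x => (e x).val))) where
  toFun x := ⟨⟨(e x).val, .base ⟨x, rfl⟩⟩, fun l hl => Subtype.ext ((e x).2 l hl)⟩
  map_sup' x y := Subtype.ext (Subtype.ext (congrArg Ra.val (map_sup e.toBoundedLatticeHom x y)))
  map_inf' x y := Subtype.ext (Subtype.ext (congrArg Ra.val (map_inf e.toBoundedLatticeHom x y)))
  map_top' := Subtype.ext (Subtype.ext (congrArg Ra.val (map_top e.toBoundedLatticeHom)))
  map_bot' := Subtype.ext (Subtype.ext (congrArg Ra.val (map_bot e.toBoundedLatticeHom)))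
  map_ident' := Subtype.ext (Subtype.ext (congrArg Ra.val e.map_ident'))
  map_comp' x y := Subtype.ext (Subtype.ext (congrArg Ra.val (e.map_comp' x y)))
  map_conv' x := Subtype.ext (Subtype.ext (congrArg Ra.val (e.map_conv' x)))

theorem RAHom.toSub_injective {e : RAHom Q (Ra i j k C)} (he : Function.Injective e) :
    Function.Injective e.toSub := fun _ _ h =>
  he (Ra.ext (congrArg (fun z => (Ra.val z).1) h))

theorem RAHom.toSub_generates (e : RAHom Q (Ra i j k C)) :
    cylSg I (Set.range fun x => (e.toSub x).val) = Set.univ := by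
  refine Set.eq_univ_of_forall fun x => ?_
  refine gen_mono_of (fun y hy => .base ?_) (cylSub.gen x.2)
  obtain ⟨r, hr⟩ := hy
  exact ⟨r, Subtype.ext hr⟩

theorem Ra.gen_of_relGen {X : Set (Ra i j k C)} {y : Ra i j k C} (h : RelGen X y) :
    CylGen I (Ra.val '' X) y.val := by
  induction h with
  | base hx => exact .base ⟨_, hx, rfl⟩
  | bot => exact .bot
  | top => exact .top
  | sup _ _ h1 h2 => exact h1.sup h2
  | inf _ _ h1 h2 => exact h1.inf h2
  | compl _ h => exact h.compl
  | comp _ _ h1 h2 => exact ((gen_s j k h1).inf (gen_s i k h2)).cyl k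
  | conv _ h => exact gen_s k i (gen_s i j (gen_s j k h))
  | ident => exact .diag i j

theorem RAHom.mem_relSg (e : RAHom Q (Ra i j k C)) {X : Set Q} {y : Ra i j k C}
    (h : RelGen (e '' X) y) : y ∈ e '' relSg X := by
  obtain ⟨x, hx, rfl⟩ := e.exists_of_gen h
  exact ⟨x, hx, rfl⟩

theorem RAHom.mem_range (e : RAHom Q (Ra i j k C)) {y : Ra i j k C}
    (h : RelGen (Set.range e) y) : ∃ x, e x = y := by
  rw [← Set.image_univ] at h
  obtain ⟨x, _, rfl⟩ := e.exists_of_gen h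
  exact ⟨x, rfl⟩

/-- The operations of the reduct are cylindric terms, so one inclusion is automatic. The hypothesis
supplies the other. -/
theorem RAHom.ra_sg_of (e : RAHom Q (Ra i j k C)) (X : Set Q)
    (h : ∀ y : Ra i j k C, CylGen I (Ra.val '' (e '' X)) y.val → RelGen (e '' X) y) :
    {y : Ra i j k C | y.val ∈ cylSg I ((fun x => (e x).val) '' X)} = e '' relSg X := by
  have hX : (fun x => (e x).val) '' X = Ra.val '' (e '' X) := (Set.image_image _ _ _).symm
  ext y
  constructor
  · intro hy
    exact e.mem_relSg (h y (by rw [← hX]; exact hy))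
  · rintro ⟨x, hx, rfl⟩
    change CylGen I _ _
    rw [hX]
    exact Ra.gen_of_relGen (e.map_gen hx)

theorem RAHom.bijective_of (e : RAHom Q (Ra i j k C)) (he : Function.Injective e)
    (hgen : cylSg I (Set.range fun x => (e x).val) = Set.univ)
    (h : ∀ y : Ra i j k C, CylGen I (Ra.val '' Set.range e) y.val → RelGen (Set.range e) y) :
    Function.Bijective e := by
  refine ⟨he, fun y => e.mem_range (h y ?_)⟩
  have h1 : y.val ∈ cylSg I (Set.range fun x => (e x).val) := by rw [hgen]; trivial
  rw [← Set.range_comp]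
  exact h1

theorem generates_of_surjective (e : RAHom Q (Ra i j k C)) (he : Function.Surjective e)
    (hgen : cylSg I (Set.range fun x => (e x).val) = Set.univ) :
    cylSg I (Set.range fun r : Ra i j k C => r.val) = Set.univ := by
  rw [← hgen]
  congr 1
  exact (he.range_comp (Ra.val : Ra i j k C → C)).symm

end Dilation

/-! ## Dimension three -/

/-- Two neat embeddings act componentwise. This lets the commutation result be applied to the
product carrying a graph. -/
theorem isSNr_prod {n : ℕ∞} {A B : Type u} [BooleanAlgebra A] [CylAlg (Dim 3) A]
    [BooleanAlgebra B] [CylAlg (Dim 3) B] (hA : IsSNr 3 n A) (hB : IsSNr 3 n B) :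
    IsSNr 3 n (A × B) := by
  obtain ⟨h, C, _, _, f, hf⟩ := hA
  obtain ⟨_, D, _, _, g, hg⟩ := hB
  refine ⟨h, C × D, inferInstance, inferInstance,
    { toFun := fun z => ⟨((f z.1).1, (g z.2).1),
        fun k hk => Prod.ext ((f z.1).2 k hk) ((g z.2).2 k hk)⟩
      map_sup' := fun x y => Subtype.ext (Prod.ext
        (congrArg (fun z : Nr h C => z.1) (map_sup f.toBoundedLatticeHom x.1 y.1))
        (congrArg (fun z : Nr h D => z.1) (map_sup g.toBoundedLatticeHom x.2 y.2)))
      map_inf' := fun x y => Subtype.ext (Prod.ext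
        (congrArg (fun z : Nr h C => z.1) (map_inf f.toBoundedLatticeHom x.1 y.1))
        (congrArg (fun z : Nr h D => z.1) (map_inf g.toBoundedLatticeHom x.2 y.2)))
      map_top' := Subtype.ext (Prod.ext
        (congrArg Subtype.val (map_top f.toBoundedLatticeHom))
        (congrArg Subtype.val (map_top g.toBoundedLatticeHom)))
      map_bot' := Subtype.ext (Prod.ext
        (congrArg Subtype.val (map_bot f.toBoundedLatticeHom))
        (congrArg Subtype.val (map_bot g.toBoundedLatticeHom)))
      map_c' := fun i x => Subtype.ext (Prod.ext
        (congrArg Subtype.val (f.map_c' i x.1)) (congrArg Subtype.val (g.map_c' i x.2)))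
      map_d' := fun i j => Subtype.ext (Prod.ext
        (congrArg Subtype.val (f.map_d' i j)) (congrArg Subtype.val (g.map_d' i j))) }, ?_⟩
  intro x y hxy
  have h1 := congrArg Subtype.val hxy
  exact Prod.ext (hf (Subtype.ext (congrArg Prod.fst h1))) (hg (Subtype.ext (congrArg Prod.snd h1)))

theorem cList_three {A : Type u} [BooleanAlgebra A] [CylAlg (Dim 3) A] (x : A) :
    ∃ L : List (Dim 3), ∀ l : Dim 3, l ≠ ⟨1, by norm_num⟩ → l ≠ ⟨2, by norm_num⟩ →
      c l (cList L x) = cList L x :=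
  ⟨[⟨0, by norm_num⟩], fun l h1 h2 => by
    rcases Dim.three_cases l with h | h | h
    · exact absurd h h1
    · exact absurd h h2
    · exact c_cList_of_mem (by rw [h]; exact List.mem_singleton_self _) x⟩

/-! ### Existence and uniqueness of extensions in dimension three -/

section Three

variable {n : ℕ∞} {A B : Type u} [BooleanAlgebra A] [CylAlg (Dim 3) A] [BooleanAlgebra B]
  [CylAlg (Dim 3) B]

theorem exists_extension_three (hn : 4 ≤ n) (hA : IsSNr 3 n A) (hB : IsSNr 3 n B)
    (hgen : cylSg (Dim 3) (Set.range fun x : Ra3 A => x.val) = Set.univ)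
    (g : RAHom (Ra3 A) (Ra3 B)) :
    ∃ h : CylHom (Dim 3) A B, ∀ r : Ra3 A, h r.val = (g r).val :=
  exists_extension g hgen cList_three fun _ hy =>
    g.graph.mem_range (relGen_of_cylGen_three hn (isSNr_prod hA hB) _ hy)

theorem extension_three_injective {h : CylHom (Dim 3) A B} {g : RAHom (Ra3 A) (Ra3 B)}
    (hg : Function.Injective g) (hh : ∀ r : Ra3 A, h r.val = (g r).val) :
    Function.Injective h :=
  h.injective_of_ra (i := ⟨1, by norm_num⟩) (j := ⟨2, by norm_num⟩) (k := ⟨0, by norm_num⟩)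
    cList_three fun r hr => by
      have h1 : g r = ⊥ := Ra.ext ((hh r).symm.trans hr)
      have h2 : r = ⊥ := hg (h1.trans (map_bot g.toBoundedLatticeHom).symm)
      rw [h2]; rfl

end Three

theorem exists_dilation_three (Q : Type u) [BooleanAlgebra Q] [RelOps Q] (hQ : IsQRA Q) (n : ℕ∞)
    (hn : 4 ≤ n) :
    ∃ (A : Type u) (_ : BooleanAlgebra A) (_ : CylAlg (Dim 3) A) (e : RAHom Q (Ra3 A)),
      IsDilation3 n e := by
  have h3 : 3 ≤ n := le_trans (by norm_num) hn
  have ne : ∀ a b : Dim 3, a.1 ≠ b.1 → Dim.incl h3 a ≠ Dim.incl h3 b := fun a b h e =>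
    h (congrArg Dim.val (Dim.incl_injective h3 e))
  obtain ⟨C, _, _, e, he⟩ := exists_ra_embedding
    (ne ⟨1, by norm_num⟩ ⟨2, by norm_num⟩ (by norm_num))
    (ne ⟨1, by norm_num⟩ ⟨0, by norm_num⟩ (by norm_num))
    (ne ⟨2, by norm_num⟩ ⟨0, by norm_num⟩ (by norm_num)) hQ
  -- The embedding is made in dimension `n` on the included coordinates 1 and 2 with spare 0. Its
  -- values depend on no coordinate from 3 on, so they lie in the neat reduct.
  let e1 : RAHom Q (Ra3 (Nr h3 C)) :=
    { toFun := fun x => ⟨⟨(e x).val, fun k hk => (e x).2 k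
          ⟨Dim.ne_incl h3 hk _, Dim.ne_incl h3 hk _⟩⟩, fun l hl => Subtype.ext ((e x).2 _
          ⟨fun h => hl.1 (Dim.incl_injective h3 h), fun h => hl.2 (Dim.incl_injective h3 h)⟩)⟩
      map_sup' := fun x y =>
        Subtype.ext (Subtype.ext (congrArg Ra.val (map_sup e.toBoundedLatticeHom x y)))
      map_inf' := fun x y =>
        Subtype.ext (Subtype.ext (congrArg Ra.val (map_inf e.toBoundedLatticeHom x y)))
      map_top' := Subtype.ext (Subtype.ext (congrArg Ra.val (map_top e.toBoundedLatticeHom)))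
      map_bot' := Subtype.ext (Subtype.ext (congrArg Ra.val (map_bot e.toBoundedLatticeHom)))
      map_ident' := Subtype.ext (Subtype.ext (congrArg Ra.val e.map_ident'))
      map_comp' := fun x y => Subtype.ext (Subtype.ext (congrArg Ra.val (e.map_comp' x y)))
      map_conv' := fun x => Subtype.ext (Subtype.ext (congrArg Ra.val (e.map_conv' x))) }
  have he1 : Function.Injective e1 := fun x y h =>
    he (Ra.ext (congrArg (fun z => (Ra.val z).1) h))
  have hsnr : IsSNr 3 n (cylSub (Dim 3) (Set.range fun x => (e1 x).val)) :=
    ⟨h3, C, inferInstance, inferInstance, cylSub.incl _, Subtype.val_injective⟩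
  exact ⟨_, inferInstance, inferInstance, e1.toSub, hsnr,
    e1.toSub.bijective_of (e1.toSub_injective he1) e1.toSub_generates
      (fun _ => relGen_of_cylGen_three hn hsnr _),
    e1.toSub_generates, fun X => e1.toSub.ra_sg_of X fun _ => relGen_of_cylGen_three hn hsnr _⟩

theorem existsUnique_embedding_three {n : ℕ∞} (hn : 4 ≤ n) {Q A B : Type u} [BooleanAlgebra Q]
    [RelOps Q] [BooleanAlgebra A] [CylAlg (Dim 3) A] [BooleanAlgebra B] [CylAlg (Dim 3) B]
    {e : RAHom Q (Ra3 A)} (he : IsDilation3 n e) {f : RAHom Q (Ra3 B)} (hB : IsSNr 3 n B)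
    (hf : Function.Bijective f) :
    ∃! h : CylHom (Dim 3) A B, Function.Injective h ∧ ∀ x, h (e x).val = (f x).val := by
  let g := (e.inverse he.bijective).trans f
  have hg : Function.Injective g := hf.1.comp fun x y h =>
    (e.apply_inverse he.bijective x).symm.trans ((congrArg e h).trans (e.apply_inverse _ y))
  obtain ⟨h, hh⟩ := exists_extension_three hn he.snr hB
    (generates_of_surjective e he.bijective.2 he.generates) g
  refine ⟨h, ⟨extension_three_injective hg hh, fun x => ?_⟩, fun h' hh' => ?_⟩
  · rw [hh]
    exact congrArg (fun z => (f z).val) (e.inverse_apply he.bijective x)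
  · refine CylHom.ext' fun x => CylHom.eq_on_gen (X := Set.range fun x => (e x).val) ?_ ?_
    · rintro _ ⟨x, rfl⟩
      rw [hh'.2, hh]
      exact (congrArg (fun z => (f z).val) (e.inverse_apply he.bijective x)).symm
    · have : x ∈ cylSg (Dim 3) (Set.range fun x => (e x).val) := by rw [he.generates]; trivial
      exact this

theorem existsUnique_iso_three {n : ℕ∞} (hn : 4 ≤ n) {Q A B : Type u} [BooleanAlgebra Q]
    [RelOps Q] [BooleanAlgebra A] [CylAlg (Dim 3) A] [BooleanAlgebra B] [CylAlg (Dim 3) B]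
    {e : RAHom Q (Ra3 A)} (he : IsDilation3 n e) {f : RAHom Q (Ra3 B)} (hf : IsDilation3 n f) :
    ∃! h : CylHom (Dim 3) A B, Function.Bijective h ∧ ∀ x, h (e x).val = (f x).val := by
  obtain ⟨h, hh, hu⟩ := existsUnique_embedding_three hn he hf.snr hf.bijective
  refine ⟨h, ⟨⟨hh.1, h.surjective_of_gen hf.generates ?_⟩, hh.2⟩, fun h' hh' =>
    hu h' ⟨hh'.1.1, hh'.2⟩⟩
  rintro _ ⟨x, rfl⟩
  exact ⟨_, hh.2 x⟩

theorem existsUnique_extension_three {n : ℕ∞} (hn : 4 ≤ n) {A B : Type u} [BooleanAlgebra A]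
    [CylAlg (Dim 3) A] [BooleanAlgebra B] [CylAlg (Dim 3) B] (hA : IsSNr 3 n A)
    (hB : IsSNr 3 n B) (hgA : cylSg (Dim 3) (Set.range fun x : Ra3 A => x.val) = Set.univ)
    (hgB : cylSg (Dim 3) (Set.range fun x : Ra3 B => x.val) = Set.univ)
    (g : RAHom (Ra3 A) (Ra3 B)) (hg : Function.Bijective g) :
    ∃! h : CylHom (Dim 3) A B, Function.Bijective h ∧ ∀ x : Ra3 A, h x.val = (g x).val := by
  obtain ⟨h, hh⟩ := exists_extension_three hn hA hB hgA g
  refine ⟨h, ⟨⟨extension_three_injective hg.1 hh, h.surjective_of_gen hgB ?_⟩, hh⟩,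
    fun h' hh' => ?_⟩
  · rintro _ ⟨y, rfl⟩
    obtain ⟨x, rfl⟩ := hg.2 y
    exact ⟨_, hh x⟩
  · refine CylHom.ext' fun x => CylHom.eq_on_gen (X := Set.range fun x : Ra3 A => x.val) ?_ ?_
    · rintro _ ⟨x, rfl⟩
      exact (hh'.2 x).trans (hh x).symm
    · have : x ∈ cylSg (Dim 3) (Set.range fun x : Ra3 A => x.val) := by rw [hgA]; trivial
      exact this

/-! ## Representation of locally finite cylindric algebras -/

section Substitution

variable {I : Type w} {B : Type u} [BooleanAlgebra B] [CylAlg I B]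

namespace CylAlg

theorem d_inf_d_le (i j k : I) : (d i k ⊓ d k j : B) ≤ d i j := by
  by_cases hi : k = i
  · subst hi; exact inf_le_right
  by_cases hj : k = j
  · subst hj; exact inf_le_left
  rw [d_trans i j k hi hj]; exact le_c _ _

/-- `d a b` does not depend on `k`, so it moves under the cylindrification, where equality of `k`
with `a` becomes equality with `b`. -/
theorem d_inf_s_le {a b k : I} (ha : k ≠ a) (hb : k ≠ b) (y : B) :
    d a b ⊓ s k a y ≤ s k b y := by
  rw [s, inf_comm, ← c_inf_of_fixed (c_d a b k ha hb)]
  refine c_mono k (le_inf ?_ (inf_le_left.trans inf_le_right))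
  exact (le_inf (inf_le_left.trans inf_le_left) inf_le_right).trans (d_inf_d_le k b a)

/-- Simultaneous substitution of `ν (σ k)` for the coordinates `k` of the list `L`. -/
def subst (ν : ℕ → I) (σ : I → ℕ) (L : List I) (x : B) : B :=
  L.foldr (fun k y => s k (ν (σ k)) y) x

variable {ν : ℕ → I} {σ τ : I → ℕ} {L : List I}

theorem subst_cons (k : I) (x : B) :
    subst ν σ (k :: L) x = s k (ν (σ k)) (subst ν σ L x) := rfl

theorem subst_mono {x y : B} (h : x ≤ y) : subst ν σ L x ≤ subst ν σ L y := by
  induction L with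
  | nil => exact h
  | cons i L ih => exact s_mono _ _ ih

theorem subst_bot : subst ν σ L (⊥ : B) = ⊥ := by
  induction L with
  | nil => rfl
  | cons i L ih => rw [subst_cons, ih, s_bot]

theorem subst_of_fixed {x : B} (h : ∀ k ∈ L, c k x = x) : subst ν σ L x = x := by
  induction L with
  | nil => rfl
  | cons i L ih =>
    rw [subst_cons, ih fun k hk => h k (List.mem_cons_of_mem _ hk),
      s_of_fixed _ (h i List.mem_cons_self)]

theorem subst_congr {x : B} (h : ∀ k ∈ L, σ k = τ k) : subst ν σ L x = subst ν τ L x := by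
  induction L with
  | nil => rfl
  | cons i L ih =>
    rw [subst_cons, subst_cons, ih fun k hk => h k (List.mem_cons_of_mem _ hk),
      h i List.mem_cons_self]

theorem subst_inf (hL : ∀ k ∈ L, ∀ n, k ≠ ν n) (x y : B) :
    subst ν σ L (x ⊓ y) = subst ν σ L x ⊓ subst ν σ L y := by
  induction L with
  | nil => rfl
  | cons i L ih =>
    rw [subst_cons, ih fun k hk => hL k (List.mem_cons_of_mem _ hk),
      s_inf (hL i List.mem_cons_self _)]
    rfl

theorem subst_compl (hL : ∀ k ∈ L, ∀ n, k ≠ ν n) (x : B) :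
    subst ν σ L xᶜ = (subst ν σ L x)ᶜ := by
  induction L with
  | nil => rfl
  | cons i L ih =>
    rw [subst_cons, ih fun k hk => hL k (List.mem_cons_of_mem _ hk),
      s_compl (hL i List.mem_cons_self _)]
    rfl

theorem subst_c {k : I} (hk : k ∉ L) (hkν : ∀ n, k ≠ ν n) (x : B) :
    subst ν σ L (c k x) = c k (subst ν σ L x) := by
  induction L with
  | nil => rfl
  | cons i L ih =>
    rw [List.mem_cons, not_or] at hk
    rw [subst_cons, ih hk.2, s_c_comm hk.1 (hkν _)]
    rfl

/-- The targets `ν n` lie outside `L`, so the substitutions commute and any one of them may be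
performed last. -/
theorem subst_erase [DecidableEq I] (hL : ∀ k ∈ L, ∀ n, k ≠ ν n) {k : I} (hk : k ∈ L) (x : B) :
    subst ν σ L x = s k (ν (σ k)) (subst ν σ (L.erase k) x) := by
  induction L with
  | nil => simp at hk
  | cons i L ih =>
    by_cases hik : i = k
    · subst hik; rw [List.erase_cons_head, subst_cons]
    · have hk' : k ∈ L := (List.mem_cons.1 hk).resolve_left (Ne.symm hik)
      rw [List.erase_cons_tail (by simpa using hik), subst_cons,
        ih (fun k hk => hL k (List.mem_cons_of_mem _ hk)) hk',
        s_s_comm hik (hL i List.mem_cons_self _) (hL k hk _), subst_cons]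

theorem subst_c_of_mem [DecidableEq I] (hL : ∀ k ∈ L, ∀ n, k ≠ ν n) (hn : L.Nodup) {k : I}
    (hk : k ∈ L) (x : B) : subst ν σ L (c k x) = c k (subst ν σ (L.erase k) x) := by
  rw [subst_erase hL hk, subst_c hn.not_mem_erase (hL k hk), s_of_fixed _ (c_c _ _)]

theorem subst_update [DecidableEq I] (hL : ∀ k ∈ L, ∀ n, k ≠ ν n) (hn : L.Nodup) {k : I}
    (hk : k ∈ L) (a : ℕ) (x : B) :
    subst ν (Function.update σ k a) L x = s k (ν a) (subst ν σ (L.erase k) x) := by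
  rw [subst_erase hL hk, Function.update_self]
  congr 1
  refine subst_congr fun l hl => Function.update_of_ne ?_ _ _
  rintro rfl
  exact hn.not_mem_erase hl

theorem subst_d [DecidableEq I] (hL : ∀ k ∈ L, ∀ n, k ≠ ν n) (hn : L.Nodup) {i j : I}
    (hi : i ∈ L) (hj : j ∈ L) : subst ν σ L (d i j : B) = d (ν (σ i)) (ν (σ j)) := by
  by_cases hij : i = j
  · subst hij
    rw [d_self, d_self, subst_of_fixed fun k _ => c_top k]
  · have hj' : j ∈ L.erase i := (List.mem_erase_of_ne (Ne.symm hij)).2 hj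
    have hL' : ∀ k ∈ L.erase i, ∀ n, k ≠ ν n := fun k hk => hL k (List.mem_of_mem_erase hk)
    rw [subst_erase hL hi, subst_erase hL' hj', subst_of_fixed fun k hk => c_d i j k ?_ ?_,
      d_comm i j, s_d (hL j hj _) (Ne.symm hij), d_comm, s_d (hL i hi _) (hL i hi _)]
    · rintro rfl
      exact hn.not_mem_erase (List.mem_of_mem_erase hk)
    · rintro rfl
      exact (hn.erase i).not_mem_erase hk

/-- A substitution at a coordinate on which `x` does not depend has no effect, even after the later
substitutions of the list. -/
theorem subst_regular {x : B} (hL : ∀ k ∈ L, ∀ n, k ≠ ν n) (hn : L.Nodup)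
    (h : ∀ k, c k x ≠ x → σ k = τ k) : subst ν σ L x = subst ν τ L x := by
  induction L with
  | nil => rfl
  | cons i L ih =>
    have ih' := ih (fun k hk => hL k (List.mem_cons_of_mem _ hk)) (List.nodup_cons.1 hn).2
    by_cases hi : c i x = x
    · have h1 : ∀ ρ : I → ℕ, subst ν ρ (i :: L) x = subst ν ρ L x := fun ρ => by
        rw [subst_cons]
        refine s_of_fixed _ ?_
        rw [← subst_c (List.nodup_cons.1 hn).1 (hL i List.mem_cons_self), hi]
      rw [h1, h1, ih']
    · rw [subst_cons, subst_cons, ih', h i hi]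

end CylAlg

/-- A Henkin construction: coordinates `ν n` outside `T` serve as constants, and conditions are
nonzero elements. A generic filter decides the instances of elements of `F` and names a witness
whenever a cylindrification holds. Starting at the closed element `z` makes `z` hold under every
assignment. -/
theorem exists_generic_subst {I : Type w} {B : Type u} [BooleanAlgebra B] [CylAlg I B]
    [DecidableEq I] [Infinite I] (hB : ∀ x : B, {k : I | c k x ≠ x}.Finite) {z : B} (hz : z ≠ ⊥)
    (hcz : ∀ k : I, c k z = z) (F : Finset B) (T : Finset I) :
    ∃ (H : B → (I → ℕ) → Prop) (D : ℕ → ℕ → Prop),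
      (∀ σ, H z σ) ∧ (∀ σ, ¬ H ⊥ σ) ∧ (∀ x y σ, x ≤ y → H x σ → H y σ) ∧
      (∀ x y σ, H x σ → H y σ → H (x ⊓ y) σ) ∧
      (∀ x ∈ F, ∀ k ∈ T, ∀ σ, H x σ ∨ H xᶜ σ) ∧
      (∀ x ∈ F, ∀ k ∈ T, ∀ σ, H (c k x) σ → ∃ a, H x (Function.update σ k a)) ∧
      (∀ x, ∀ k ∈ T, ∀ σ a, H x (Function.update σ k a) → H (c k x) σ) ∧
      (∀ i ∈ T, ∀ j ∈ T, ∀ σ, H (d i j) σ ↔ D (σ i) (σ j)) ∧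
      (∀ a, D a a) ∧ (∀ a b, D a b → D b a) ∧ (∀ a b e, D a b → D b e → D a e) ∧
      (∀ x, ∀ k ∈ T, ∀ σ a b, D a b →
        H x (Function.update σ k a) → H x (Function.update σ k b)) ∧
      (∀ x σ τ, (∀ k, c k x ≠ x → σ k = τ k) → H x σ → H x τ) := by
  obtain ⟨ν, hν, hνT⟩ : ∃ ν : ℕ → I, Function.Injective ν ∧ ∀ n, ν n ∉ T := by
    have : Infinite {i : I // i ∉ T} := T.finite_toSet.infinite_compl.to_subtype
    let f : ℕ ↪ {i : I // i ∉ T} := Infinite.natEmbedding _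
    exact ⟨fun n => (f n).1, fun a b h => f.injective (Subtype.ext h), fun n => (f n).2⟩
  set L := T.toList with hLdef
  have hmem : ∀ {k}, k ∈ L ↔ k ∈ T := Finset.mem_toList
  have hL : ∀ k ∈ L, ∀ n, k ≠ ν n := fun k hk n h => hνT n (h ▸ hmem.1 hk)
  have hn : L.Nodup := T.nodup_toList
  let P := {e : B // e ≠ ⊥}ᵒᵈ
  have inf_or : ∀ e x : B, e ≠ ⊥ → e ⊓ x = ⊥ → e ≤ xᶜ := fun e x _ h =>
    (disjoint_iff.2 h).le_compl_right
  have dense : ∀ (x : B) (k : I) (σ : I → ℕ), k ∈ L →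
      IsCofinal {e : P | (e.1 ≤ subst ν σ L x ∨ e.1 ≤ (subst ν σ L x)ᶜ) ∧
        (e.1 ≤ (c k (subst ν σ (L.erase k) x))ᶜ ∨
          ∃ a, e.1 ≤ s k (ν a) (subst ν σ (L.erase k) x))} := by
    intro x k σ hk e
    obtain ⟨e1, h1, h2⟩ : ∃ e1 : P, e ≤ e1 ∧
        (e1.1 ≤ subst ν σ L x ∨ e1.1 ≤ (subst ν σ L x)ᶜ) := by
      by_cases h : e.1 ⊓ subst ν σ L x = ⊥
      · exact ⟨e, le_rfl, .inr (inf_or _ _ e.2 h)⟩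
      · exact ⟨⟨_, h⟩, inf_le_left, .inl inf_le_right⟩
    set y := subst ν σ (L.erase k) x
    by_cases h : e1.1 ⊓ c k y = ⊥
    · exact ⟨e1, ⟨h2, .inl (inf_or _ _ e1.2 h)⟩, h1⟩
    -- A fresh constant exists because `e1` and `y` depend on finitely many coordinates only.
    -- Renaming the bound `k` to it keeps the meet with `e1` nonzero.
    · obtain ⟨a, ha⟩ : ∃ a : ℕ, ν a ∉ {l | c l e1.1 ≠ e1.1} ∪ {l | c l y ≠ y} := by
        by_contra hcon
        push Not at hcon
        exact Set.infinite_range_of_injective hν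
          (((hB e1.1).union (hB y)).subset (by rintro _ ⟨a, rfl⟩; exact hcon a))
      simp only [Set.mem_union, Set.mem_ofPred_eq, not_or, not_not] at ha
      have hne : e1.1 ⊓ s k (ν a) y ≠ ⊥ := fun h0 => h (by
        rw [← c_s_rename (i := k) ha.2, inf_comm, ← c_inf_of_fixed ha.1, inf_comm, h0, c_bot])
      refine ⟨⟨_, hne⟩, ⟨?_, .inr ⟨a, inf_le_right⟩⟩, h1.trans inf_le_left⟩
      exact h2.imp (fun h => inf_le_left.trans h) (fun h => inf_le_left.trans h)
  -- Assignments matter only on the finite list `L`, which leaves countably many; the default 0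
  -- elsewhere is never read.
  let ext : ({k // k ∈ L} → ℕ) → I → ℕ := fun ρ k => if h : k ∈ L then ρ ⟨k, h⟩ else 0
  have hext : ∀ (σ : I → ℕ) (L' : List I) (x : B), (∀ k ∈ L', k ∈ L) →
      subst ν (ext fun k => σ k.1) L' x = subst ν σ L' x := fun σ L' x h =>
    subst_congr fun k hk => by simp [ext, h k hk]
  let ι := F × {k // k ∈ L} × ({k // k ∈ L} → ℕ)
  have : Encodable ι := Encodable.ofCountable _
  let 𝒟 : ι → Order.Cofinal P := fun a => ⟨_, dense a.1.1 a.2.1.1 (ext a.2.2) a.2.1.2⟩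
  let z0 : P := ⟨z, hz⟩
  let G := Order.idealOfCofinals z0 𝒟
  have hz0 : z0 ∈ G := Order.mem_idealOfCofinals _ _
  have hmeet : ∀ x ∈ F, ∀ k ∈ L, ∀ σ : I → ℕ, ∃ e ∈ G,
      (e.1 ≤ subst ν σ L x ∨ e.1 ≤ (subst ν σ L x)ᶜ) ∧
        (e.1 ≤ (c k (subst ν σ (L.erase k) x))ᶜ ∨
          ∃ a, e.1 ≤ s k (ν a) (subst ν σ (L.erase k) x)) := by
    intro x hx k hk σ
    obtain ⟨e, he, heG⟩ := Order.cofinal_meets_idealOfCofinals z0 𝒟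
      (⟨x, hx⟩, ⟨k, hk⟩, fun k => σ k.1)
    have he' : (e.1 ≤ subst ν (ext fun k => σ k.1) L x ∨
        e.1 ≤ (subst ν (ext fun k => σ k.1) L x)ᶜ) ∧
        (e.1 ≤ (c k (subst ν (ext fun k => σ k.1) (L.erase k) x))ᶜ ∨
          ∃ a, e.1 ≤ s k (ν a) (subst ν (ext fun k => σ k.1) (L.erase k) x)) := he
    rw [hext σ L x fun _ h => h, hext σ _ x fun _ h => List.mem_of_mem_erase h] at he'
    exact ⟨e, heG, he'⟩
  let W : B → Prop := fun y => ∃ e ∈ G, e.1 ≤ y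
  have Wmono : ∀ {x y}, x ≤ y → W x → W y := fun h ⟨e, he, h'⟩ => ⟨e, he, h'.trans h⟩
  have Winf : ∀ {x y}, W x → W y → W (x ⊓ y) := fun {x y} ⟨e, he, h⟩ ⟨e', he', h'⟩ => by
    obtain ⟨f, hf, h1, h2⟩ := G.directed e he e' he'
    exact ⟨f, hf, le_inf (le_trans h1 h) (le_trans h2 h')⟩
  have Wbot : ¬ W ⊥ := fun ⟨e, _, h⟩ => e.2 (le_bot_iff.1 h)
  refine ⟨fun x σ => W (subst ν σ L x), fun a b => W (d (ν a) (ν b)), fun σ => ?_, fun σ => ?_,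
    fun x y σ h => Wmono (subst_mono h), fun x y σ h h' => ?_, fun x hx k hk σ => ?_,
    fun x hx k hk σ h => ?_, fun x k hk σ a h => ?_, fun i hi j hj σ => ?_, fun a => ?_,
    fun a b h => ?_, fun a b e h h' => ?_, fun x k hk σ a b h h' => ?_, fun x σ τ h h' => ?_⟩
  · beta_reduce at *
    rw [subst_of_fixed fun k _ => hcz k]
    exact ⟨z0, hz0, le_rfl⟩
  · beta_reduce at *
    rw [subst_bot]; exact Wbot
  · beta_reduce at *
    rw [subst_inf hL]; exact Winf h h'
  · beta_reduce at *
    obtain ⟨e, he, h, _⟩ := hmeet x hx k (hmem.2 hk) σ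
    rw [subst_compl hL]
    exact h.imp (fun h => ⟨e, he, h⟩) (fun h => ⟨e, he, h⟩)
  · beta_reduce at *
    obtain ⟨e, he, _, h1 | ⟨a, h1⟩⟩ := hmeet x hx k (hmem.2 hk) σ
    · rw [subst_c_of_mem hL hn (hmem.2 hk)] at h
      exact absurd (Winf h ⟨e, he, h1⟩) (by rw [inf_compl_eq_bot]; exact Wbot)
    · exact ⟨a, by rw [subst_update hL hn (hmem.2 hk)]; exact ⟨e, he, h1⟩⟩
  · beta_reduce at *
    rw [subst_update hL hn (hmem.2 hk)] at h
    rw [subst_c_of_mem hL hn (hmem.2 hk)]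
    exact Wmono (c_mono k inf_le_right) h
  · beta_reduce at *
    rw [subst_d hL hn (hmem.2 hi) (hmem.2 hj)]
  · beta_reduce at *
    rw [d_self]; exact ⟨z0, hz0, le_top⟩
  · beta_reduce at *
    rw [d_comm]; exact h
  · beta_reduce at *
    exact Wmono (d_inf_d_le _ _ _) (Winf h h')
  · beta_reduce at *
    rw [subst_update hL hn (hmem.2 hk)] at h' ⊢
    exact Wmono (d_inf_s_le (hL k (hmem.2 hk) a) (hL k (hmem.2 hk) b) _) (Winf h h')
  · beta_reduce at *
    rw [← subst_regular hL hn h]; exact h'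

end Substitution

/-- A homomorphism to a cylindric set algebra whose values `h x` depend only on the coordinates in
the dimension set of `x`. -/
def CylHom.Regular {I : Type w} {B : Type u} [BooleanAlgebra B] [CylAlg I B] {U : Type v}
    (h : CylHom I B (Set (I → U))) : Prop :=
  ∀ x σ τ, (∀ k, c k x ≠ x → σ k = τ k) → σ ∈ h x → τ ∈ h x

/-- As for relation algebras, the structures generic for finite sets of elements and coordinates are
combined by an ultraproduct and divided by the relation that the diagonals denote. Regularity holds
in each factor and therefore survives. -/
theorem exists_regular_rep {I : Type} [Infinite I] {B : Type u} [BooleanAlgebra B] [CylAlg I B]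
    (hB : ∀ x : B, {k : I | c k x ≠ x}.Finite) {z : B} (hz : z ≠ ⊥) :
    ∃ (U : Type u) (h : CylHom I B (Set (I → U))), h.Regular ∧ h z ≠ ⊥ := by
  classical
  -- Closing `z` under its finitely many essential coordinates gives an element fixed by every
  -- cylindrification, as the generic construction requires.
  let Δ := (hB z).toFinset.toList
  have hz' : cList Δ z ≠ ⊥ := fun h => hz (le_bot_iff.1 ((le_cList Δ z).trans h.le))
  have hcz : ∀ k : I, c k (cList Δ z) = cList Δ z := fun k => by
    by_cases hk : c k z = z
    · rw [c_cList, hk]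
    · exact c_cList_of_mem (by simpa [Δ] using hk) z
  choose H D Hz Hbot Hmono Hinf Hdec Hwit Hc Hd Drefl Dsymm Dtrans Hcongr Hreg using
    fun j : Finset B × Finset I => exists_generic_subst hB hz' hcz j.1 j.2
  let 𝒰 : Ultrafilter (Finset B × Finset I) := Ultrafilter.of Filter.atTop
  have hle : (𝒰 : Filter (Finset B × Finset I)) ≤ Filter.atTop := Ultrafilter.of_le _
  have hB1 : ∀ x : B, ∀ᶠ j in (𝒰 : Filter (Finset B × Finset I)), x ∈ j.1 := fun x =>
    hle ((Filter.eventually_ge_atTop ({x}, ∅)).mono fun j hj => hj.1 (Finset.mem_singleton_self x))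
  have hI1 : ∀ k : I, ∀ᶠ j in (𝒰 : Filter (Finset B × Finset I)), k ∈ j.2 := fun x =>
    hle ((Filter.eventually_ge_atTop (∅, {x})).mono fun j hj => hj.2 (Finset.mem_singleton_self x))
  let V := Finset B × Finset I → ℕ
  let K : B → (I → V) → Prop := fun x σ =>
    ∀ᶠ j in (𝒰 : Filter (Finset B × Finset I)), H j x fun i => σ i j
  let E : V → V → Prop := fun a b =>
    ∀ᶠ j in (𝒰 : Filter (Finset B × Finset I)), D j (a j) (b j)
  have hupd : ∀ (σ : I → V) k v j, (fun i => Function.update σ k v i j)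
      = Function.update (fun i => σ i j) k (v j) := fun σ k v j => by
    funext i
    by_cases h : i = k
    · subst h; simp
    · simp [h]
  have Kmono : ∀ x y σ, x ≤ y → K x σ → K y σ := fun x y σ hxy h =>
    h.mono fun j hj => Hmono j x y _ hxy hj
  have Kinf : ∀ x y σ, K (x ⊓ y) σ ↔ K x σ ∧ K y σ := fun x y σ =>
    ⟨fun h => ⟨Kmono _ _ _ inf_le_left h, Kmono _ _ _ inf_le_right h⟩,
      fun h => (h.1.and h.2).mono fun j hj => Hinf j x y _ hj.1 hj.2⟩
  have Kbot : ∀ σ, ¬ K ⊥ σ := fun σ h => by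
    obtain ⟨j, hj⟩ := h.exists
    exact Hbot j _ hj
  -- The decision clause needs some coordinate in `T`; any one will do.
  obtain ⟨i0⟩ : Nonempty I := inferInstance
  have Kdec : ∀ x σ, K x σ ∨ K xᶜ σ := fun x σ =>
    Ultrafilter.eventually_or.1 (((hB1 x).and (hI1 i0)).mono fun j hj =>
      Hdec j x hj.1 i0 hj.2 _)
  have Ksup : ∀ x y σ, K (x ⊔ y) σ ↔ K x σ ∨ K y σ := fun x y σ => by
    refine ⟨fun h => (Kdec x σ).imp_right fun h' => ?_, fun h =>
      h.elim (Kmono _ _ _ le_sup_left) (Kmono _ _ _ le_sup_right)⟩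
    refine Kmono _ _ _ ?_ ((Kinf _ _ _).2 ⟨h, h'⟩)
    rw [inf_sup_right, inf_compl_eq_bot, bot_sup_eq]
    exact inf_le_left
  have Ktop : ∀ σ, K ⊤ σ := fun σ =>
    (Kdec ⊤ σ).resolve_right (by rw [compl_top]; exact Kbot σ)
  have Kc : ∀ k x σ, K (c k x) σ ↔ ∃ v, K x (Function.update σ k v) := fun k x σ => by
    constructor
    · intro h
      have h1 : ∀ᶠ j in (𝒰 : Filter (Finset B × Finset I)),
          ∃ a, H j x (Function.update (fun i => σ i j) k a) := by
        filter_upwards [h, hB1 x, hI1 k] with j h hx hk using Hwit j x hx k hk _ h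
      obtain ⟨v, hv⟩ := h1.choice
      exact ⟨v, hv.mono fun j hj => by rw [hupd]; exact hj⟩
    · rintro ⟨v, hv⟩
      filter_upwards [hv, hI1 k] with j h hk
      rw [hupd] at h
      exact Hc j x k hk _ _ h
  have Kd : ∀ i j σ, K (d i j) σ ↔ E (σ i) (σ j) := fun i j σ =>
    Filter.eventually_congr (((hI1 i).and (hI1 j)).mono fun a ha => Hd a i ha.1 j ha.2 _)
  let S : Setoid V := ⟨E, fun a => Filter.Eventually.of_forall fun j => Drefl j _,
    fun {a b} h => h.mono fun j => Dsymm j _ _,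
    fun {a b e} h h' => (h.and h').mono fun j hj => Dtrans j _ _ _ hj.1 hj.2⟩
  have Kcongr : ∀ x k σ a b, E a b → K x (Function.update σ k a) →
      K x (Function.update σ k b) := fun x k σ a b h h' => by
    filter_upwards [h, h', hI1 k] with j h h' hk
    rw [hupd] at h' ⊢
    exact Hcongr j x k hk _ _ _ h h'
  refine ⟨Quotient S,
    { toFun := fun x => {τ | K x fun i => (τ i).out}
      map_sup' := fun x y => Set.ext fun τ => Ksup _ _ _
      map_inf' := fun x y => Set.ext fun τ => Kinf _ _ _
      map_top' := Set.eq_univ_of_forall fun τ => Ktop _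
      map_bot' := Set.eq_empty_iff_forall_notMem.2 fun τ => Kbot _
      map_c' := fun k x => Set.ext fun τ => ?_
      map_d' := fun i j => Set.ext fun τ => ?_ }, fun x σ τ h h' => ?_, fun h => ?_⟩
  · have ho : ∀ u : Quotient S, (fun i => (Function.update τ k u i).out)
        = Function.update (fun i => (τ i).out) k u.out := fun u => Function.comp_update _ _ _ _
    rw [mem_c]
    refine (Kc _ _ _).trans ⟨?_, ?_⟩
    · rintro ⟨v, hv⟩
      refine ⟨Quotient.mk S v, ?_⟩
      change K _ _
      rw [ho]
      exact Kcongr _ _ _ _ _ (S.symm (Quotient.mk_out v)) hv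
    · rintro ⟨u, hu⟩
      refine ⟨u.out, ?_⟩
      rw [← ho]; exact hu
  · refine (Kd _ _ _).trans ?_
    rw [mem_d]
    constructor
    · intro h
      rw [← Quotient.out_eq (τ i), ← Quotient.out_eq (τ j)]
      exact Quotient.sound h
    · intro h; rw [h]; exact S.refl _
  · exact (show K x _ from h').mono fun j hj => Hreg j x _ _ (fun k hk => by dsimp only; rw [h k hk]) hj
  -- If `h z` were empty, so would be the image of the closure of `z`, which contains every
  -- sequence.
  · have h1 := CylHom.map_cList _ Δ z |>.trans (by rw [h, cList_bot])
    have h2 : K (cList Δ z) fun _ => (Quotient.mk S fun _ => 0).out :=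
      Filter.Eventually.of_forall fun j => Hz j _
    have h3 : (fun _ => Quotient.mk S fun _ => 0 : I → Quotient S) ∈ (⊥ : Set (I → Quotient S)) := by
      rw [← h1]; exact h2
    exact h3

/-! ## Coding of tuples by quasi-projections -/


namespace IsRelRep

variable {R : Type u} [BooleanAlgebra R] [RelOps R] {U : Type v} {h : R → U → U → Prop}
  (hh : IsRelRep h)
include hh

theorem mono {x y : R} (hxy : x ≤ y) {a b : U} (hx : h x a b) : h y a b := by
  rw [← inf_eq_left.2 hxy, hh.map_inf] at hx
  exact hx.2

theorem map_compl (x : R) (a b : U) : h xᶜ a b ↔ ¬ h x a b := by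
  have h1 := hh.map_inf x xᶜ a b
  have h2 := hh.map_sup x xᶜ a b
  rw [inf_compl_eq_bot] at h1
  rw [sup_compl_eq_top] at h2
  have h3 := hh.map_bot a b
  have h4 := hh.map_top a b
  tauto

theorem functional {p : R} (hp : conv p ;; p ≤ ident) {u a b : U} (ha : h p u a) (hb : h p u b) :
    a = b :=
  (hh.map_ident a b).1 (hh.mono hp ((hh.map_comp _ _ _ _).2 ⟨u, (hh.map_conv _ _ _).2 ha, hb⟩))

end IsRelRep

/-- The `n`-th projection of codes of tuples. -/
def tupleProj {R : Type u} [RelOps R] (p q : R) : ℕ → R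
  | 0 => p
  | n + 1 => q ;; tupleProj p q n

/-- The meet of the first `n` terms of a sequence. -/
def infBelow {R : Type u} [BooleanAlgebra R] (f : ℕ → R) : ℕ → R
  | 0 => ⊤
  | n + 1 => infBelow f n ⊓ f n

section Coding

variable {R : Type u} [BooleanAlgebra R] [RelOps R] {U : Type v} {h : R → U → U → Prop}
  (hh : IsRelRep h) {p q : R}

theorem RelGen.tupleProj {X : Set R} (hp : RelGen X p) (hq : RelGen X q) (n : ℕ) :
    RelGen X (tupleProj p q n) := by
  induction n with
  | zero => exact hp
  | succ n ih => exact hq.comp ih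

theorem RelGen.infBelow {X : Set R} {f : ℕ → R} (hf : ∀ i, RelGen X (f i)) (n : ℕ) :
    RelGen X (infBelow f n) := by
  induction n with
  | zero => exact .top
  | succ n ih => exact ih.inf (hf n)

namespace IsRelRep
include hh

theorem map_infBelow (f : ℕ → R) (n : ℕ) (a b : U) :
    h (infBelow f n) a b ↔ ∀ i < n, h (f i) a b := by
  induction n with
  | zero => exact iff_of_true (hh.map_top a b) (by simp)
  | succ n ih => rw [infBelow, hh.map_inf, ih, Nat.forall_lt_succ_right]

variable (hpq : IsQuasiProj p q)
include hpq

theorem tupleProj_functional (n : ℕ) {u a b : U} (ha : h (tupleProj p q n) u a)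
    (hb : h (tupleProj p q n) u b) : a = b := by
  induction n generalizing u with
  | zero => exact hh.functional hpq.fst_functional ha hb
  | succ n ih =>
    obtain ⟨v, h1, h2⟩ := (hh.map_comp _ _ _ _).1 ha
    obtain ⟨w, h3, h4⟩ := (hh.map_comp _ _ _ _).1 hb
    obtain rfl := hh.functional hpq.snd_functional h1 h3
    exact ih h2 h4

/-- By `hpq.pairing`, a code of the tail can be paired with the first entry. Projections are partial
functions, and a code is promised values only below `n`. -/
theorem exists_code (n : ℕ) (σ : ℕ → U) : ∃ u, ∀ i < n, h (tupleProj p q i) u (σ i) := by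
  induction n generalizing σ with
  | zero => exact ⟨σ 0, by simp⟩
  | succ n ih =>
    obtain ⟨v, hv⟩ := ih fun i => σ (i + 1)
    have h1 := hh.map_top (σ 0) v
    rw [← hpq.pairing, hh.map_comp] at h1
    obtain ⟨u, h2, h3⟩ := h1
    refine ⟨u, fun i hi => ?_⟩
    cases i with
    | zero => exact (hh.map_conv _ _ _).1 h2
    | succ i => exact (hh.map_comp _ _ _ _).2 ⟨v, h3, hv i (by omega)⟩

end IsRelRep

end Coding

/-! ## Representations of the reduct induced by representations of the algebra -/

section RaRep

variable {I : Type w} {B : Type u} [BooleanAlgebra B] [CylAlg I B] {U : Type v}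
  {i j k : I} {h : CylHom I B (Set (I → U))}

theorem mem_inf {X Y : Set (I → U)} {σ : I → U} : σ ∈ X ⊓ Y ↔ σ ∈ X ∧ σ ∈ Y := Iff.rfl

open Classical in
/-- The binary relation that an element of the reduct denotes in a set algebra. -/
def CylHom.rel (h : CylHom I B (Set (I → U))) (r : Ra i j k B) (a b : U) : Prop :=
  (fun l => if l = j then b else a) ∈ h r.val

/-- Regularity makes the values away from `i` and `j` immaterial, so the filler chosen in
`CylHom.rel` does not matter. -/
theorem CylHom.Regular.mem_iff (hr : h.Regular) (r : Ra i j k B) (σ : I → U) :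
    σ ∈ h r.val ↔ h.rel r (σ i) (σ j) := by
  classical
  have h1 : ∀ l, c l r.val ≠ r.val → σ l = if l = j then σ j else σ i := fun l hl => by
    by_cases hlj : l = j
    · rw [if_pos hlj, hlj]
    · rw [if_neg hlj]
      by_contra h2
      exact hl (r.2 l ⟨fun h3 => h2 (by rw [h3]), hlj⟩)
  exact ⟨hr _ _ _ h1, hr _ _ _ fun l hl => (h1 l hl).symm⟩

theorem CylHom.Regular.isRelRep (hr : h.Regular) (hij : i ≠ j) (hik : i ≠ k) (hjk : j ≠ k) :
    IsRelRep (h.rel : Ra i j k B → U → U → Prop) where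
  map_sup x y a b := by
    change _ ∈ h (x.val ⊔ y.val) ↔ _
    rw [map_sup]; exact Iff.rfl
  map_inf x y a b := by
    change _ ∈ h (x.val ⊓ y.val) ↔ _
    rw [map_inf]; exact Iff.rfl
  map_bot a b := by
    change ¬ _ ∈ h (⊥ : B)
    rw [map_bot]; exact fun h => h
  map_top a b := by
    change _ ∈ h (⊤ : B)
    rw [map_top]; trivial
  map_comp x y a b := by
    classical
    change _ ∈ h (c k (s j k x.val ⊓ s i k y.val)) ↔ _
    rw [h.map_c', map_inf, h.map_s, h.map_s, mem_c]
    refine exists_congr fun u => ?_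
    rw [mem_inf, mem_s hjk, mem_s hik, hr.mem_iff,
      hr.mem_iff]
    simp [hij, hij.symm, hik, hjk]
  map_conv x a b := by
    classical
    change _ ∈ h (s k i (s i j (s j k x.val))) ↔ _
    rw [h.map_s, h.map_s, h.map_s, mem_s hik.symm, mem_s hij, mem_s hjk, hr.mem_iff]
    simp [hij, hik.symm, hjk]
  map_ident a b := by
    change _ ∈ h (d i j) ↔ _
    rw [h.map_d', mem_d]
    simp [hij]

theorem mem_cList {L : List I} {X : Set (I → U)} {σ : I → U} :
    σ ∈ cList L X ↔ ∃ τ, (∀ l, l ∉ L → τ l = σ l) ∧ τ ∈ X := by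
  classical
  induction L generalizing σ with
  | nil =>
    refine ⟨fun h => ⟨σ, fun _ _ => rfl, h⟩, ?_⟩
    rintro ⟨τ, h1, h2⟩
    rwa [show τ = σ from funext fun l => h1 l (by simp)] at h2
  | cons l L ih =>
    change σ ∈ c l (cList L X) ↔ _
    rw [mem_c]
    constructor
    · rintro ⟨u, hu⟩
      obtain ⟨τ, h1, h2⟩ := ih.1 hu
      refine ⟨τ, fun m hm => ?_, h2⟩
      rw [List.mem_cons, not_or] at hm
      rw [h1 m hm.2, Function.update_of_ne hm.1]
    · rintro ⟨τ, h1, h2⟩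
      refine ⟨τ l, ih.2 ⟨τ, fun m hm => ?_, h2⟩⟩
      by_cases hml : m = l
      · subst hml; rw [Function.update_self]
      · rw [Function.update_of_ne hml, h1 m (by simp [hml, hm])]

end RaRep

/-! ## Locally finite algebras with quasi-projections in the reduct -/

/-- The index `n`. -/
def Dim.ofNat (n : ℕ) : Dim ⊤ := ⟨n, ENat.natCast_lt_top n⟩

theorem Dim.ofNat_val (i : Dim ⊤) : Dim.ofNat i.val = i := rfl

theorem Dim.ofNat_injective : Function.Injective Dim.ofNat := fun _ _ h =>
  congrArg Dim.val h

theorem Dim.ofNat_ne {m n : ℕ} (h : m ≠ n) : Dim.ofNat m ≠ Dim.ofNat n := fun e =>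
  h (Dim.ofNat_injective e)

instance : Infinite (Dim ⊤) := Infinite.of_injective _ Dim.ofNat_injective

theorem exists_bound_of_finite {S : Set (Dim ⊤)} (hS : S.Finite) : ∃ n : ℕ, ∀ i ∈ S, i.val < n := by
  obtain ⟨n, hn⟩ := (hS.image Dim.val).bddAbove
  exact ⟨n + 1, fun i hi => Nat.lt_succ_of_le (hn ⟨i, hi, rfl⟩)⟩

section LocallyFinite

variable {B : Type u} [BooleanAlgebra B] [CylAlg (Dim ⊤) B]

/-- A nonzero `x ⊓ yᶜ` would stay nonzero in some regular representation. Inclusions and equations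
may therefore be argued with points and sequences. -/
theorem IsLf.le_of_rep (hB : IsLf B) {x y : B}
    (h : ∀ (U : Type u) (h : CylHom (Dim ⊤) B (Set (Dim ⊤ → U))), h.Regular →
      ∀ σ ∈ h x, σ ∈ h y) : x ≤ y := by
  by_contra hxy
  have hne : x ⊓ yᶜ ≠ ⊥ := fun h0 => hxy (by
    rwa [← disjoint_iff, disjoint_compl_right_iff] at h0)
  obtain ⟨U, f, hf, h1⟩ := exists_regular_rep hB hne
  apply h1
  rw [map_inf, map_compl']
  refine Set.eq_empty_iff_forall_notMem.2 fun σ hσ => hσ.2 (h U f hf σ hσ.1)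

theorem IsLf.eq_of_rep (hB : IsLf B) {x y : B}
    (h : ∀ (U : Type u) (h : CylHom (Dim ⊤) B (Set (Dim ⊤ → U))), h.Regular →
      ∀ σ, σ ∈ h x ↔ σ ∈ h y) : x = y :=
  le_antisymm (hB.le_of_rep fun U f hf σ => (h U f hf σ).1)
    (hB.le_of_rep fun U f hf σ => (h U f hf σ).2)

theorem CylHom.Regular.isRelRepOmega {U : Type v} {h : CylHom (Dim ⊤) B (Set (Dim ⊤ → U))}
    (hr : h.Regular) : IsRelRep (h.rel : RaOmega B → U → U → Prop) :=
  hr.isRelRep (Dim.ofNat_ne (by decide : 0 ≠ 1)) (Dim.ofNat_ne (by decide : 0 ≠ 2))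
    (Dim.ofNat_ne (by decide : 1 ≠ 2))

theorem CylHom.Regular.mem_iffOmega {U : Type v} {h : CylHom (Dim ⊤) B (Set (Dim ⊤ → U))}
    (hr : h.Regular) (r : RaOmega B) (σ : Dim ⊤ → U) :
    σ ∈ h r.val ↔ h.rel r (σ (.ofNat 0)) (σ (.ofNat 1)) :=
  hr.mem_iff r σ

/-- `r` defines `x` on the codes of `n`-tuples. -/
def CodedBy (p q : RaOmega B) (n : ℕ) (x : B) (r : RaOmega B) : Prop :=
  ∀ (U : Type u) (h : CylHom (Dim ⊤) B (Set (Dim ⊤ → U))), h.Regular → ∀ (σ : Dim ⊤ → U) (u : U),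
    (∀ i < n, h.rel (tupleProj p q i) u (σ (.ofNat i))) → (σ ∈ h x ↔ h.rel r u u)

theorem CodedBy.mono {p q : RaOmega B} {m n : ℕ} {x : B} {r : RaOmega B}
    (hx : CodedBy p q n x r) (hmn : n ≤ m) : CodedBy p q m x r :=
  fun U h hr σ u hu => hx U h hr σ u fun i hi => hu i (hi.trans_le hmn)

/-- Codes of tuples that agree outside the coordinate `l`. -/
def agreeOff (p q : RaOmega B) (l : ℕ) : ℕ → RaOmega B :=
  infBelow fun i => if i = l then ⊤ ;; conv (tupleProj p q i)
    else tupleProj p q i ;; conv (tupleProj p q i)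

theorem relGen_agreeOff {X : Set (RaOmega B)} {p q : RaOmega B} (hp : RelGen X p)
    (hq : RelGen X q) (l n : ℕ) : RelGen X (agreeOff p q l n) :=
  RelGen.infBelow (fun i => by
    split_ifs
    · exact RelGen.top.comp (hp.tupleProj hq i).conv
    · exact (hp.tupleProj hq i).comp (hp.tupleProj hq i).conv) n

theorem rel_agreeOff {p q : RaOmega B} {U : Type v} {h : CylHom (Dim ⊤) B (Set (Dim ⊤ → U))}
    (hr : h.Regular) (l n : ℕ) (a b : U) :
    h.rel (agreeOff p q l n) a b ↔ ∀ i < n, (∃ e, (i ≠ l → h.rel (tupleProj p q i) a e) ∧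
      h.rel (tupleProj p q i) b e) := by
  have hh := hr.isRelRepOmega
  rw [agreeOff, hh.map_infBelow]
  refine forall₂_congr fun i hi => ?_
  split_ifs with hil
  · simp [hh.map_comp, hh.map_conv, hh.map_top, hil]
  · simp [hh.map_comp, hh.map_conv, hil]

/-- Induction on generation, with truth at a sequence becoming a loop at its code. A generator
relates the first two entries of the code, a diagonal compares two entries, and a cylindrification
passes to a code that agrees off one entry. -/
theorem exists_codedBy {X : Set (RaOmega B)} {p q : RaOmega B} (hp : RelGen X p)
    (hq : RelGen X q) (hpq : IsQuasiProj p q) {x : B} (hx : CylGen (Dim ⊤) (Ra.val '' X) x) :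
    ∃ n r, RelGen X r ∧ CodedBy p q n x r := by
  induction hx with
  | base hx =>
    obtain ⟨r, hr, rfl⟩ := hx
    refine ⟨2, tupleProj p q 0 ;; r ;; conv (tupleProj p q 1),
      ((hp.tupleProj hq 0).comp (.base hr)).comp (hp.tupleProj hq 1).conv,
      fun U h hreg σ u hu => ?_⟩
    have hh := hreg.isRelRepOmega
    rw [hreg.mem_iffOmega, hh.map_comp]
    constructor
    · intro h1
      exact ⟨_, (hh.map_comp _ _ _ _).2 ⟨_, hu 0 (by omega), h1⟩,
        (hh.map_conv _ _ _).2 (hu 1 (by omega))⟩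
    · rintro ⟨b, h1, h2⟩
      obtain ⟨a, h3, h4⟩ := (hh.map_comp _ _ _ _).1 h1
      rw [hh.tupleProj_functional hpq 0 (hu 0 (by omega)) h3,
        hh.tupleProj_functional hpq 1 (hu 1 (by omega)) ((hh.map_conv _ _ _).1 h2)]
      exact h4
  | bot =>
    refine ⟨0, ⊥, .bot, fun U h hreg σ u hu => ?_⟩
    rw [map_bot]
    exact iff_of_false (fun h => h) (hreg.isRelRepOmega.map_bot _ _)
  | top =>
    refine ⟨0, ⊤, .top, fun U h hreg σ u hu => ?_⟩
    rw [map_top]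
    exact iff_of_true trivial (hreg.isRelRepOmega.map_top _ _)
  | sup _ _ h1 h2 =>
    obtain ⟨n, r, hr, h1⟩ := h1
    obtain ⟨m, s, hs, h2⟩ := h2
    refine ⟨max n m, r ⊔ s, hr.sup hs, fun U h hreg σ u hu => ?_⟩
    rw [map_sup, hreg.isRelRepOmega.map_sup, ← h1.mono (le_max_left n m) U h hreg σ u hu,
      ← h2.mono (le_max_right n m) U h hreg σ u hu]
    exact Iff.rfl
  | inf _ _ h1 h2 =>
    obtain ⟨n, r, hr, h1⟩ := h1
    obtain ⟨m, s, hs, h2⟩ := h2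
    refine ⟨max n m, r ⊓ s, hr.inf hs, fun U h hreg σ u hu => ?_⟩
    rw [map_inf, hreg.isRelRepOmega.map_inf, ← h1.mono (le_max_left n m) U h hreg σ u hu,
      ← h2.mono (le_max_right n m) U h hreg σ u hu]
    exact Iff.rfl
  | compl _ h1 =>
    obtain ⟨n, r, hr, h1⟩ := h1
    refine ⟨n, rᶜ, hr.compl, fun U h hreg σ u hu => ?_⟩
    rw [map_compl', hreg.isRelRepOmega.map_compl, ← h1 U h hreg σ u hu]
    exact Iff.rfl
  | cyl l _ h1 =>
    classical
    obtain ⟨n, r, hr, h1⟩ := h1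
    refine ⟨n, agreeOff p q l.val n ;; (r ⊓ ident) ;; ⊤,
      ((relGen_agreeOff hp hq _ _).comp (hr.inf .ident)).comp .top, fun U h hreg σ u hu => ?_⟩
    have hh := hreg.isRelRepOmega
    have h2 : h.rel (agreeOff p q l.val n ;; (r ⊓ ident) ;; ⊤) u u ↔
        ∃ v, h.rel (agreeOff p q l.val n) u v ∧ h.rel r v v := by
      simp only [hh.map_comp, hh.map_top, hh.map_inf, hh.map_ident, and_true]
      constructor
      · rintro ⟨_, v, h1, h2, rfl⟩; exact ⟨v, h1, h2⟩
      · rintro ⟨v, h1, h2⟩; exact ⟨v, v, h1, h2, rfl⟩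
    rw [h2, h.map_c', mem_c]
    constructor
    · rintro ⟨a, ha⟩
      obtain ⟨v, hv⟩ := hh.exists_code hpq n fun i => Function.update σ l a (.ofNat i)
      refine ⟨v, (rel_agreeOff hreg _ _ _ _).2 fun i hi => ⟨_, fun hil => ?_, hv i hi⟩,
        (h1 U h hreg _ v hv).1 ha⟩
      rw [Function.update_of_ne fun e => hil (by rw [← e]; rfl)]
      exact hu i hi
    · rintro ⟨v, hv, hrv⟩
      rw [rel_agreeOff hreg] at hv
      -- If `l` is not among the coded entries, its new value is irrelevant and `u` is an arbitrary
      -- choice.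
      have h3 : ∃ a, l.val < n → h.rel (tupleProj p q l.val) v a := by
        by_cases hl : l.val < n
        · obtain ⟨a, _, ha⟩ := hv _ hl
          exact ⟨a, fun _ => ha⟩
        · exact ⟨u, fun h => absurd h hl⟩
      obtain ⟨a, ha⟩ := h3
      refine ⟨a, (h1 U h hreg _ v fun i hi => ?_).2 hrv⟩
      by_cases hil : i = l.val
      · subst hil
        rw [Dim.ofNat_val, Function.update_self]
        exact ha hi
      · rw [Function.update_of_ne fun e => hil (by rw [← e]; rfl)]
        obtain ⟨e, h4, h5⟩ := hv i hi
        rw [hh.tupleProj_functional hpq i (hu i hi) (h4 hil)]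
        exact h5
  | diag i j =>
    refine ⟨max i.val j.val + 1, tupleProj p q i.val ;; conv (tupleProj p q j.val),
      (hp.tupleProj hq _).comp (hp.tupleProj hq _).conv, fun U h hreg σ u hu => ?_⟩
    have hh := hreg.isRelRepOmega
    have hi := hu i.val (Nat.lt_succ_of_le (le_max_left _ _))
    have hj := hu j.val (Nat.lt_succ_of_le (le_max_right _ _))
    rw [Dim.ofNat_val] at hi hj
    rw [h.map_d', mem_d, hh.map_comp]
    constructor
    · intro e
      exact ⟨_, hi, (hh.map_conv _ _ _).2 (by rw [e]; exact hj)⟩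
    · rintro ⟨a, h1, h2⟩
      rw [hh.tupleProj_functional hpq _ hi h1,
        hh.tupleProj_functional hpq _ hj ((hh.map_conv _ _ _).1 h2)]

/-- The formation of relation algebra reducts commutes with the generation of subalgebras in the
presence of quasi-projections. -/
theorem IsLf.relGen_of_cylGen (hB : IsLf B) {X : Set (RaOmega B)} {p q : RaOmega B}
    (hp : RelGen X p) (hq : RelGen X q) (hpq : IsQuasiProj p q) {y : RaOmega B}
    (hy : CylGen (Dim ⊤) (Ra.val '' X) y.val) : RelGen X y := by
  obtain ⟨n, r, hr, hyr⟩ := exists_codedBy hp hq hpq hy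
  -- The code must include entries 0 and 1, where `y` lives.
  replace hyr := hyr.mono (le_max_left n 2)
  set m := max n 2 with hm
  have hm2 : 2 ≤ m := le_max_right n 2
  -- `z` relates the first two entries of each code satisfying `r`. As `m` is not an index below
  -- `m`, `agreeOff p q m m` on the diagonal says just that all `m` entries are defined.
  set z : RaOmega B := conv (tupleProj p q 0) ;; (r ⊓ (ident ⊓ agreeOff p q m m)) ;; tupleProj p q 1
    with hz
  have hgen : RelGen X z :=
    ((hp.tupleProj hq 0).conv.comp (hr.inf (.inf .ident (relGen_agreeOff hp hq m m)))).comp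
      (hp.tupleProj hq 1)
  suffices h : y = z by rwa [h]
  refine Ra.ext (hB.eq_of_rep fun U h hreg σ => ?_)
  have hh := hreg.isRelRepOmega
  have hzz : h.rel z (σ (.ofNat 0)) (σ (.ofNat 1)) ↔ ∃ u,
      h.rel (tupleProj p q 0) u (σ (.ofNat 0)) ∧ h.rel r u u ∧ h.rel (agreeOff p q m m) u u ∧
      h.rel (tupleProj p q 1) u (σ (.ofNat 1)) := by
    simp only [hz, hh.map_comp, hh.map_conv, hh.map_inf, hh.map_ident]
    constructor
    · rintro ⟨_, ⟨u, h1, h2, rfl, h3⟩, h4⟩; exact ⟨u, h1, h2, h3, h4⟩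
    · rintro ⟨u, h1, h2, h3, h4⟩; exact ⟨u, ⟨u, h1, h2, rfl, h3⟩, h4⟩
  rw [hreg.mem_iffOmega z, hzz]
  constructor
  · intro hσ
    obtain ⟨u, hu⟩ := hh.exists_code hpq m fun i => σ (.ofNat i)
    exact ⟨u, hu 0 (by omega), (hyr U h hreg σ u hu).1 hσ,
      (rel_agreeOff hreg _ _ _ _).2 fun i hi => ⟨_, fun _ => hu i hi, hu i hi⟩, hu 1 (by omega)⟩
  · rintro ⟨u, h0, h1, h2, h3⟩
    rw [rel_agreeOff hreg] at h2
    have h4 : ∀ i : Dim ⊤, ∃ e, i.val < m → h.rel (tupleProj p q i.val) u e := fun i => by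
      by_cases hi : i.val < m
      · obtain ⟨e, _, he⟩ := h2 _ hi
        exact ⟨e, fun _ => he⟩
      · exact ⟨u, fun h => absurd h hi⟩
    choose τ hτ using h4
    have h5 := (hyr U h hreg τ u fun i hi => hτ (.ofNat i) hi).2 h1
    rw [hreg.mem_iffOmega] at h5 ⊢
    rw [hh.tupleProj_functional hpq 0 h0 (hτ (.ofNat 0) (show 0 < m by omega)),
      hh.tupleProj_functional hpq 1 h3 (hτ (.ofNat 1) (show 1 < m by omega))]
    exact h5

/-- The arguments are routed through two fresh coordinates, so `i` and `j` may coincide with each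
other or with 0 and 1. -/
theorem exists_transport (r : RaOmega B) (i j : Dim ⊤) :
    ∃ x : B, CylGen (Dim ⊤) (Set.range fun r : RaOmega B => r.val) x ∧
      ∀ (U : Type u) (h : CylHom (Dim ⊤) B (Set (Dim ⊤ → U))), h.Regular → ∀ σ : Dim ⊤ → U,
        σ ∈ h x ↔ h.rel r (σ i) (σ j) := by
  classical
  let a : Dim ⊤ := .ofNat (i.val + j.val + 2)
  let b : Dim ⊤ := .ofNat (i.val + j.val + 3)
  have hab : a ≠ b := Dim.ofNat_ne (by omega)
  have h0a : Dim.ofNat 0 ≠ a := Dim.ofNat_ne (by omega)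
  have h1a : Dim.ofNat 1 ≠ a := Dim.ofNat_ne (by omega)
  have h0b : Dim.ofNat 0 ≠ b := Dim.ofNat_ne (by omega)
  have h1b : Dim.ofNat 1 ≠ b := Dim.ofNat_ne (by omega)
  have h01 : Dim.ofNat 0 ≠ Dim.ofNat 1 := Dim.ofNat_ne (by omega)
  have hia : i ≠ a := fun e => by have := congrArg Dim.val e; simp [a, Dim.ofNat] at this; omega
  have hib : i ≠ b := fun e => by have := congrArg Dim.val e; simp [b, Dim.ofNat] at this; omega
  have hja : j ≠ a := fun e => by have := congrArg Dim.val e; simp [a, Dim.ofNat] at this; omega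
  have hjb : j ≠ b := fun e => by have := congrArg Dim.val e; simp [b, Dim.ofNat] at this; omega
  refine ⟨s a i (s b j (s (.ofNat 0) a (s (.ofNat 1) b r.val))),
    gen_s _ _ (gen_s _ _ (gen_s _ _ (gen_s _ _ (.base ⟨r, rfl⟩)))), fun U h hreg σ => ?_⟩
  rw [h.map_s, h.map_s, h.map_s, h.map_s, mem_s hia.symm, mem_s hjb.symm, mem_s h0a, mem_s h1b,
    hreg.mem_iffOmega]
  simp [h01, hab, h0b.symm, hja]

/-- A locally finite algebra with quasi-projections in its reduct is generated by the reduct. -/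
theorem IsLf.generated_by_ra (hB : IsLf B) {p q : RaOmega B} (hpq : IsQuasiProj p q) :
    cylSg (Dim ⊤) (Set.range fun r : RaOmega B => r.val) = Set.univ := by
  classical
  refine Set.eq_univ_of_forall fun x => ?_
  obtain ⟨n', hn'⟩ := exists_bound_of_finite (hB x)
  -- The bound is made positive so that the coordinate `n`, which will hold codes, differs from 0.
  obtain ⟨n, hn, hx⟩ : ∃ n, 0 < n ∧ ∀ i : Dim ⊤, c i x ≠ x → i.val < n :=
    ⟨n' + 1, by omega, fun i hi => (hn' i hi).trans (by omega)⟩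
  clear hn'
  set m : Dim ⊤ := .ofNat n with hm
  have hm0 : m ≠ .ofNat 0 := Dim.ofNat_ne hn.ne'
  have hmi : ∀ i < n, Dim.ofNat i ≠ m := fun i hi => Dim.ofNat_ne hi.ne
  choose P hPgen hP using fun i : ℕ => exists_transport (tupleProj p q i) m (.ofNat i)
  have hPn : ∀ (U : Type u) (h : CylHom (Dim ⊤) B (Set (Dim ⊤ → U))), h.Regular →
      ∀ (σ : Dim ⊤ → U) (n : ℕ), σ ∈ h (infBelow P n) ↔
        ∀ i < n, h.rel (tupleProj p q i) (σ m) (σ (.ofNat i)) := fun U h hreg σ n => by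
    induction n with
    | zero => rw [infBelow, map_top]; exact iff_of_true trivial (by simp)
    | succ n ih =>
      rw [infBelow, map_inf, Nat.forall_lt_succ_right, ← ih, ← hP n U h hreg]
      exact Iff.rfl
  have hPg : ∀ n, CylGen (Dim ⊤) (Set.range fun r : RaOmega B => r.val) (infBelow P n) := fun n => by
    induction n with
    | zero => exact .top
    | succ n ih => exact ih.inf (hPgen n)
  let L : List (Dim ⊤) := (List.range n).map .ofNat
  have hL : ∀ i : Dim ⊤, i ∈ L ↔ i.val < n := fun i => by
    simp only [L, List.mem_map, List.mem_range]
    exact ⟨fun ⟨a, ha, e⟩ => by rw [← e]; exact ha, fun h => ⟨_, h, rfl⟩⟩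
  -- Coordinate 0 holds a code of some sequence in `x`. This depends on coordinate 0 alone, so it
  -- defines an element of the reduct.
  let z : B := s m (.ofNat 0) (cList L (x ⊓ infBelow P n))
  have hz : ∀ (U : Type u) (h : CylHom (Dim ⊤) B (Set (Dim ⊤ → U))), h.Regular →
      ∀ σ : Dim ⊤ → U, σ ∈ h z ↔ ∃ τ ∈ h x, ∀ i < n,
        h.rel (tupleProj p q i) (σ (.ofNat 0)) (τ (.ofNat i)) := fun U h hreg σ => by
    rw [h.map_s, mem_s hm0, h.map_cList, mem_cList]
    constructor
    · rintro ⟨τ, h1, h2⟩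
      rw [map_inf] at h2
      refine ⟨τ, h2.1, ?_⟩
      have h3 := (hPn U h hreg τ n).1 h2.2
      have h4 := h1 m (by rw [hL]; exact lt_irrefl n)
      rw [Function.update_self] at h4
      rwa [h4] at h3
    · rintro ⟨τ, h1, h2⟩
      let τ' : Dim ⊤ → U := fun i =>
        if i.val < n then τ i else Function.update σ m (σ (.ofNat 0)) i
      have hτ' : ∀ i : Dim ⊤, i.val < n → τ' i = τ i := fun i hi => if_pos hi
      refine ⟨τ', fun l hl => if_neg (by rwa [hL] at hl), ?_⟩
      rw [map_inf]
      refine ⟨hreg x τ τ' (fun k hk => (hτ' k (hx k hk)).symm) h1,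
        (hPn U h hreg τ' n).2 fun i hi => ?_⟩
      have h3 : τ' m = σ (.ofNat 0) := by
        rw [show τ' m = Function.update σ m (σ (.ofNat 0)) m from if_neg (lt_irrefl n),
          Function.update_self]
      rw [h3, hτ' _ (show i < n from hi)]
      exact h2 i hi
  let zr : RaOmega B := ⟨z, fun l hl => hB.eq_of_rep fun U h hreg σ => by
    rw [h.map_c', mem_c]
    have h1 : ∀ u, Function.update σ l u ∈ h z ↔ σ ∈ h z := fun u => by
      rw [hz U h hreg, hz U h hreg, Function.update_of_ne (show Dim.ofNat 0 ≠ l from hl.1.symm)]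
    simp only [h1]
    exact ⟨fun ⟨_, h⟩ => h, fun h => ⟨σ m, h⟩⟩⟩
  -- `x` holds of a sequence exactly when some point codes its first `n` entries and is a code of a
  -- member of `x`. Single-valued projections and regularity give the direction back to `x`.
  have key : x = c m (s (.ofNat 0) m zr.val ⊓ infBelow P n) := hB.eq_of_rep fun U h hreg σ => by
    have hh := hreg.isRelRepOmega
    have h1 : ∀ u, Function.update σ m u ∈ h (s (.ofNat 0) m zr.val ⊓ infBelow P n) ↔
        (∃ τ ∈ h x, ∀ i < n, h.rel (tupleProj p q i) u (τ (.ofNat i))) ∧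
          ∀ i < n, h.rel (tupleProj p q i) u (σ (.ofNat i)) := fun u => by
      rw [map_inf, mem_inf, h.map_s, mem_s hm0.symm, hPn U h hreg]
      refine and_congr ?_ (forall₂_congr fun i hi => ?_)
      · rw [show zr.val = z from rfl, hz U h hreg]
        simp
      · rw [Function.update_self, Function.update_of_ne (hmi i hi)]
    rw [h.map_c', mem_c]
    simp only [h1]
    constructor
    · intro hσ
      obtain ⟨u, hu⟩ := hh.exists_code hpq n fun i => σ (.ofNat i)
      exact ⟨u, ⟨σ, hσ, hu⟩, hu⟩
    · rintro ⟨u, ⟨τ, hτ, h2⟩, h3⟩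
      refine hreg x τ σ (fun k hk => ?_) hτ
      exact hh.tupleProj_functional hpq k.val (h2 _ (hx k hk)) (h3 _ (hx k hk))
  change CylGen _ _ x
  rw [key]
  have hzr : CylGen (Dim ⊤) (Set.range fun r : RaOmega B => r.val) zr.val := .base ⟨zr, rfl⟩
  exact ((gen_s _ _ hzr).inf (hPg n)).cyl m

end LocallyFinite

/-! ## Homomorphisms of locally finite algebras -/

theorem IsLf.prod {A B : Type u} [BooleanAlgebra A] [CylAlg (Dim ⊤) A] [BooleanAlgebra B]
    [CylAlg (Dim ⊤) B] (hA : IsLf A) (hB : IsLf B) : IsLf (A × B) := fun z =>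
  ((hA z.1).union (hB z.2)).subset fun k hk => by
    by_contra h
    simp only [Set.mem_union, Set.mem_ofPred_eq, not_or, not_not] at h
    exact hk (Prod.ext h.1 h.2)

theorem IsLf.exists_cList {A : Type u} [BooleanAlgebra A] [CylAlg (Dim ⊤) A] (hA : IsLf A)
    (x : A) : ∃ L : List (Dim ⊤), ∀ l : Dim ⊤, c l (cList L x) = cList L x :=
  ⟨(hA x).toFinset.toList, fun l => by
    by_cases hl : c l x = x
    · rw [c_cList, hl]
    · exact c_cList_of_mem (by simpa using hl) x⟩

theorem finite_dim_of_cylGen {I : Type w} {A : Type u} [BooleanAlgebra A] [CylAlg I A] {X : Set A}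
    (hX : ∀ x ∈ X, {k : I | c k x ≠ x}.Finite) {x : A} (hx : CylGen I X x) :
    {k : I | c k x ≠ x}.Finite := by
  have key : ∀ (x : A) (S : Set I), S.Finite → (∀ k, k ∉ S → c k x = x) →
      {k : I | c k x ≠ x}.Finite := fun x S hS h =>
    hS.subset fun k hk => by_contra fun hkS => hk (h k hkS)
  have fix : ∀ {x : A} {k : I}, k ∉ {k : I | c k x ≠ x} → c k x = x := fun h =>
    not_not.1 h
  induction hx with
  | base hx => exact hX _ hx
  | bot => exact key _ ∅ Set.finite_empty fun k _ => c_bot k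
  | top => exact key _ ∅ Set.finite_empty fun k _ => c_top k
  | sup _ _ h1 h2 =>
    exact key _ _ (h1.union h2) fun k hk =>
      c_sup_of_fixed (fix fun h => hk (.inl h)) (fix fun h => hk (.inr h))
  | inf _ _ h1 h2 =>
    refine key _ _ (h1.union h2) fun k hk => ?_
    rw [c_inf_of_fixed (fix fun h => hk (.inr h)), fix fun h => hk (.inl h)]
  | compl _ h => exact key _ _ h fun k hk => c_compl_of_fixed (fix hk)
  | cyl i _ h =>
    refine key _ _ h fun k hk => ?_
    rw [c_comm, fix hk]
  | diag i j =>
    exact key _ {i, j} (Set.toFinite _) fun k hk =>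
      c_d i j k (fun h => hk (.inl h)) (fun h => hk (.inr h))

theorem Ra.finite_dim {I : Type w} {A : Type u} [BooleanAlgebra A] [CylAlg I A] {i j k : I}
    (r : Ra i j k A) : {l : I | c l r.val ≠ r.val}.Finite :=
  (Set.toFinite {i, j}).subset fun l hl => by
    by_contra h
    rw [Set.mem_insert_iff, Set.mem_singleton_iff, not_or] at h
    exact hl (r.2 l h)

section Extension

variable {A B : Type u} [BooleanAlgebra A] [CylAlg (Dim ⊤) A] [BooleanAlgebra B]
  [CylAlg (Dim ⊤) B]

/-- The pairs `(p, g p)` and `(q, g q)` are quasi-projections in the reduct of the product, so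
commutation applies to the graph of `g`. -/
theorem exists_extension_omega (hA : IsLf A) (hB : IsLf B) {p q : RaOmega A}
    (hpq : IsQuasiProj p q) (g : RAHom (RaOmega A) (RaOmega B)) :
    ∃ h : CylHom (Dim ⊤) A B, ∀ r : RaOmega A, h r.val = (g r).val :=
  exists_extension g (hA.generated_by_ra hpq)
    (fun z => (hA.prod hB).exists_cList z |>.imp fun _ h l _ _ => h l) fun _ hy =>
    g.graph.mem_range ((hA.prod hB).relGen_of_cylGen (X := Set.range g.graph)
      (p := g.graph p) (q := g.graph q) (.base (Set.mem_range_self p))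
      (.base (Set.mem_range_self q)) (g.graph.map_quasi hpq) hy)

theorem extension_omega_unique (hA : IsLf A) {p q : RaOmega A} (hpq : IsQuasiProj p q)
    {h h' : CylHom (Dim ⊤) A B} (hh : ∀ r : RaOmega A, h r.val = h' r.val) : h = h' :=
  CylHom.ext' fun x => CylHom.eq_on_gen (X := Set.range fun r : RaOmega A => r.val)
    (by rintro _ ⟨r, rfl⟩; exact hh r) (by
      have : x ∈ cylSg (Dim ⊤) (Set.range fun r : RaOmega A => r.val) := by
        rw [hA.generated_by_ra hpq]; trivial
      exact this)

theorem extension_omega_bijective (hA : IsLf A) (hB : IsLf B) {p q : RaOmega B}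
    (hpq : IsQuasiProj p q) {g : RAHom (RaOmega A) (RaOmega B)} (hg : Function.Bijective g)
    {h : CylHom (Dim ⊤) A B} (hh : ∀ r : RaOmega A, h r.val = (g r).val) :
    Function.Bijective h := by
  constructor
  · refine h.injective_of_ra (i := Dim.ofNat 0) (j := Dim.ofNat 1) (k := Dim.ofNat 2)
      (fun x => (hA.exists_cList x).imp fun _ h l _ _ => h l) fun r hr => ?_
    have h1 : g r = ⊥ := Ra.ext ((hh r).symm.trans hr)
    have h2 : r = ⊥ := hg.1 (h1.trans (map_bot g.toBoundedLatticeHom).symm)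
    rw [h2]; rfl
  · refine h.surjective_of_gen (hB.generated_by_ra hpq) ?_
    rintro _ ⟨r, rfl⟩
    obtain ⟨r, rfl⟩ := hg.2 r
    exact ⟨_, hh r⟩

end Extension

theorem exists_dilation_omega (Q : Type u) [BooleanAlgebra Q] [RelOps Q] (hQ : IsQRA Q) :
    ∃ (A : Type u) (_ : BooleanAlgebra A) (_ : CylAlg (Dim ⊤) A) (e : RAHom Q (RaOmega A)),
      IsDilationOmega e := by
  obtain ⟨C, _, _, e, he⟩ := exists_ra_embedding (Dim.ofNat_ne (by decide : 0 ≠ 1))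
    (Dim.ofNat_ne (by decide : 0 ≠ 2)) (Dim.ofNat_ne (by decide : 1 ≠ 2)) hQ
  have hlf : IsLf (cylSub (Dim ⊤) (Set.range fun x => (e x).val)) := fun x =>
    (finite_dim_of_cylGen (by rintro _ ⟨r, rfl⟩; exact (e r).finite_dim) x.2).subset
      fun k hk h => hk (Subtype.ext h)
  have hgen : ∀ X : Set Q, (∃ p ∈ X, ∃ q ∈ X, IsQuasiProj p q) →
      ∀ y : RaOmega (cylSub (Dim ⊤) (Set.range fun x => (e x).val)),
        CylGen (Dim ⊤) (Ra.val '' (e.toSub '' X)) y.val → RelGen (e.toSub '' X) y := by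
    rintro X ⟨p, hp, q, hq, hpq⟩ y hy
    exact hlf.relGen_of_cylGen (X := e.toSub '' X) (p := e.toSub p) (q := e.toSub q)
      (.base (Set.mem_image_of_mem _ hp)) (.base (Set.mem_image_of_mem _ hq)) (e.toSub.map_quasi hpq) hy
  refine ⟨_, inferInstance, inferInstance, e.toSub, hlf,
    e.toSub.bijective_of (e.toSub_injective he) e.toSub_generates fun y hy => ?_,
    e.toSub_generates, fun X hX => e.toSub.ra_sg_of X (hgen X hX)⟩
  -- Commutation at the whole of `Q`, which contains a quasi-projection pair, shows that the reduct
  -- has no new elements.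
  obtain ⟨p, q, hpq⟩ := hQ.2
  have h := hgen Set.univ ⟨p, trivial, q, trivial, hpq⟩ y
  rw [Set.image_univ] at h
  exact h hy

/-- Quasi-projections carried over by `f` make `B` generated by its reduct, which yields
surjectivity without a generation hypothesis on `B`. -/
theorem existsUnique_iso_omega {Q A B : Type u} [BooleanAlgebra Q] [RelOps Q] [BooleanAlgebra A]
    [CylAlg (Dim ⊤) A] [BooleanAlgebra B] [CylAlg (Dim ⊤) B] (hQ : IsQRA Q)
    {e : RAHom Q (RaOmega A)} (he : IsDilationOmega e) {f : RAHom Q (RaOmega B)} (hB : IsLf B)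
    (hf : Function.Bijective f) :
    ∃! h : CylHom (Dim ⊤) A B, Function.Bijective h ∧ ∀ x, h (e x).val = (f x).val := by
  obtain ⟨p, q, hpq⟩ := hQ.2
  let g := (e.inverse he.bijective).trans f
  have hg : Function.Bijective g := by
    refine hf.comp ⟨fun x y h => ?_, fun x => ⟨e x, e.inverse_apply he.bijective x⟩⟩
    exact (e.apply_inverse he.bijective x).symm.trans
      ((congrArg e h).trans (e.apply_inverse _ y))
  have hge : ∀ x, g (e x) = f x := fun x => congrArg f (e.inverse_apply he.bijective x)
  obtain ⟨h, hh⟩ := exists_extension_omega he.lf hB (e.map_quasi hpq) g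
  refine ⟨h, ⟨extension_omega_bijective he.lf hB (f.map_quasi hpq) hg hh, fun x => ?_⟩,
    fun h' hh' => extension_omega_unique he.lf (e.map_quasi hpq) fun r => ?_⟩
  · rw [hh, hge]
  · obtain ⟨x, rfl⟩ := he.bijective.2 r
    rw [hh'.2, hh, hge]

/-! ## The equivalences of categories -/

theorem IsRelAlg.of_surjective {R : Type u} {S : Type v} [BooleanAlgebra R] [RelOps R]
    [BooleanAlgebra S] [RelOps S] (hR : IsRelAlg R) (f : RAHom R S)
    (hf : Function.Surjective f) : IsRelAlg S where
  comp_assoc x y z := by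
    obtain ⟨x, rfl⟩ := hf x; obtain ⟨y, rfl⟩ := hf y; obtain ⟨z, rfl⟩ := hf z
    simp only [← f.map_comp', hR.comp_assoc]
  sup_comp x y z := by
    obtain ⟨x, rfl⟩ := hf x; obtain ⟨y, rfl⟩ := hf y; obtain ⟨z, rfl⟩ := hf z
    simp only [← f.map_comp', ← map_sup, hR.sup_comp]
  comp_ident x := by
    obtain ⟨x, rfl⟩ := hf x
    rw [← f.map_ident', ← f.map_comp', hR.comp_ident]
  conv_conv x := by
    obtain ⟨x, rfl⟩ := hf x
    rw [← f.map_conv', ← f.map_conv', hR.conv_conv]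
  conv_sup x y := by
    obtain ⟨x, rfl⟩ := hf x; obtain ⟨y, rfl⟩ := hf y
    simp only [← f.map_conv', ← map_sup, hR.conv_sup]
  conv_comp x y := by
    obtain ⟨x, rfl⟩ := hf x; obtain ⟨y, rfl⟩ := hf y
    simp only [← f.map_conv', ← f.map_comp', hR.conv_comp]
  tarski x y := by
    obtain ⟨x, rfl⟩ := hf x; obtain ⟨y, rfl⟩ := hf y
    rw [← f.map_conv', ← f.map_comp', ← map_compl', ← map_compl', ← f.map_comp']
    exact OrderHomClass.mono f.toBoundedLatticeHom (hR.tarski x y)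

/-- Bijective homomorphisms are isomorphisms. -/
noncomputable def RAHom.toIso {R S : RelTypeCat.{u}} (e : RAHom R.carrier S.carrier)
    (he : Function.Bijective e) : R ≅ S where
  hom := e
  inv := e.inverse he
  hom_inv_id := RAHom.ext' fun x => e.inverse_apply he x
  inv_hom_id := RAHom.ext' fun x => e.apply_inverse he x

theorem raQRA_isEquivalence : (raQRA.{u}).IsEquivalence where
  faithful := ⟨fun {A B f g} h => by
    obtain ⟨_, p, q, hpq⟩ := A.property
    refine ObjectProperty.hom_ext _ (extension_omega_unique A.obj.lf hpq fun r => ?_)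
    have h1 : raFunctor.map f.hom = raFunctor.map g.hom :=
      congrArg (fun k : raQRA.obj A ⟶ raQRA.obj B => k.hom) h
    exact congrArg (fun k : RAHom (RaOmega A.obj.carrier) (RaOmega B.obj.carrier) => (k r).val) h1⟩
  full := ⟨fun {A B} g => by
    obtain ⟨_, p, q, hpq⟩ := A.property
    obtain ⟨h, hh⟩ := exists_extension_omega A.obj.lf B.obj.lf hpq g.hom
    exact ⟨ObjectProperty.homMk h, ObjectProperty.hom_ext _ (RAHom.ext' fun r => Ra.ext (hh r))⟩⟩
  essSurj := ⟨fun Q => by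
    obtain ⟨A, _, _, e, he⟩ := exists_dilation_omega Q.obj.carrier Q.property
    have hA : IsQRA (RaOmega A) := by
      obtain ⟨hR, p, q, hpq⟩ := Q.property
      refine ⟨?_, _, _, e.map_quasi hpq⟩
      exact hR.of_surjective e he.bijective.2
    exact ⟨⟨⟨A, he.lf⟩, hA⟩, ⟨(ObjectProperty.isoMk _
      (RAHom.toIso (R := Q.obj) (S := ⟨RaOmega A⟩) e he.bijective)).symm⟩⟩⟩

theorem raPointed_isEquivalence : (raPointed.{u}).IsEquivalence where
  faithful := ⟨fun {A B f g} h => by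
    refine PointedLf.Hom.ext (extension_omega_unique A.alg.lf A.quasi fun r => ?_)
    have h1 : raFunctor.map f.hom = raFunctor.map g.hom := congrArg PointedQRA.Hom.hom h
    exact congrArg (fun k : RAHom (RaOmega A.alg.carrier) (RaOmega B.alg.carrier) => (k r).val) h1⟩
  full := ⟨fun {A B} g => by
    obtain ⟨h, hh⟩ := exists_extension_omega A.alg.lf B.alg.lf A.quasi g.hom
    have h1 : raFunctor.map (X := A.alg) (Y := B.alg) h = g.hom :=
      RAHom.ext' fun r => Ra.ext (hh r)
    exact ⟨⟨h, by rw [h1]; exact g.map_p, by rw [h1]; exact g.map_q⟩, PointedQRA.Hom.ext h1⟩⟩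
  essSurj := ⟨fun Q => by
    obtain ⟨A, _, _, e, he⟩ := exists_dilation_omega Q.alg.carrier ⟨Q.isRelAlg, _, _, Q.quasi⟩
    refine ⟨⟨⟨A, he.lf⟩, Q.isRelAlg.of_surjective e he.bijective.2, e Q.p, e Q.q,
      e.map_quasi Q.quasi⟩, ⟨?_⟩⟩
    exact
      { hom := ⟨e.inverse he.bijective, e.inverse_apply _ _, e.inverse_apply _ _⟩
        inv := ⟨e, rfl, rfl⟩
        hom_inv_id := PointedQRA.Hom.ext (RAHom.ext' fun x => e.apply_inverse he.bijective x)
        inv_hom_id := PointedQRA.Hom.ext (RAHom.ext' fun x => e.inverse_apply he.bijective x) }⟩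

theorem forget_faithful : (PointedLf.forget.{u}).Faithful :=
  ⟨fun h => PointedLf.Hom.ext h⟩

/-! ## Adjoining quasi-projections freely -/

theorem CylAlg.exists_small_copy {I : Type w} (S : Type v) [BooleanAlgebra S] [CylAlg I S]
    [Small.{u} S] :
    ∃ (F : Type u) (_ : BooleanAlgebra F) (_ : CylAlg I F) (e : CylHom I F S),
      Function.Bijective e := by
  let e : Shrink.{u} S ≃ S := (equivShrink S).symm
  let _ : BooleanAlgebra (Shrink.{u} S) := e.booleanAlgebra
  have hle : ∀ {x y}, e x ≤ e y → x ≤ y := fun h => h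
  have hsup : ∀ x y, e (x ⊔ y) = e x ⊔ e y := fun x y => e.apply_symm_apply _
  have hinf : ∀ x y, e (x ⊓ y) = e x ⊓ e y := fun x y => e.apply_symm_apply _
  have htop : e ⊤ = ⊤ := e.apply_symm_apply _
  have hbot : e ⊥ = ⊥ := e.apply_symm_apply _
  have hcompl : ∀ x, e xᶜ = (e x)ᶜ := fun x => e.apply_symm_apply _
  let _ : CylAlg I (Shrink.{u} S) :=
    { c := fun i x => e.symm (c i (e x))
      d := fun i j => e.symm (d i j)
      c_bot := fun i => e.injective (by rw [e.apply_symm_apply, hbot, c_bot])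
      le_c := fun i x => hle (by rw [e.apply_symm_apply]; exact le_c i _)
      c_inf_c := fun i x y => e.injective (by
        simp only [e.apply_symm_apply, hinf, c_inf_c])
      c_comm := fun i j x => e.injective (by simp only [e.apply_symm_apply, c_comm])
      d_self := fun i => e.injective (by rw [e.apply_symm_apply, htop, d_self])
      d_trans := fun i j k hi hj => e.injective (by
        simp only [e.apply_symm_apply, hinf]; exact d_trans i j k hi hj)
      d_subst := fun i j x h => e.injective (by
        simp only [e.apply_symm_apply, hinf, hcompl, hbot]; exact d_subst i j _ h) }
  exact ⟨Shrink.{u} S, inferInstance, inferInstance,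
    { toFun := e
      map_sup' := hsup
      map_inf' := hinf
      map_top' := htop
      map_bot' := hbot
      map_c' := fun i x => e.apply_symm_apply _
      map_d' := fun i j => e.apply_symm_apply _ }, e.bijective⟩

/-- All the axioms are equations, the last one after writing an inequality as a meet, and a
separating family of homomorphisms reflects equations. -/
theorem IsRelAlg.of_jointly_injective {R : Type u} [BooleanAlgebra R] [RelOps R] {J : Type w}
    {S : J → Type v} [∀ j, BooleanAlgebra (S j)] [∀ j, RelOps (S j)] (f : ∀ j, RAHom R (S j))
    (hf : ∀ x y, (∀ j, f j x = f j y) → x = y) (hS : ∀ j, IsRelAlg (S j)) : IsRelAlg R where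
  comp_assoc x y z := hf _ _ fun j => by simp only [(f j).map_comp', (hS j).comp_assoc]
  sup_comp x y z := hf _ _ fun j => by simp only [(f j).map_comp', map_sup, (hS j).sup_comp]
  comp_ident x := hf _ _ fun j => by
    simp only [(f j).map_comp', (f j).map_ident', (hS j).comp_ident]
  conv_conv x := hf _ _ fun j => by simp only [(f j).map_conv', (hS j).conv_conv]
  conv_sup x y := hf _ _ fun j => by simp only [(f j).map_conv', map_sup, (hS j).conv_sup]
  conv_comp x y := hf _ _ fun j => by
    simp only [(f j).map_conv', (f j).map_comp', (hS j).conv_comp]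
  tarski x y := inf_eq_left.1 (hf _ _ fun j => by
    simp only [map_inf, (f j).map_conv', (f j).map_comp', map_compl']
    exact inf_eq_left.2 ((hS j).tarski _ _))

theorem IsQuasiProj.of_jointly_injective {R : Type u} [BooleanAlgebra R] [RelOps R] {J : Type w}
    {S : J → Type v} [∀ j, BooleanAlgebra (S j)] [∀ j, RelOps (S j)] (f : ∀ j, RAHom R (S j))
    (hf : ∀ x y, (∀ j, f j x = f j y) → x = y) {p q : R}
    (h : ∀ j, IsQuasiProj (f j p) (f j q)) : IsQuasiProj p q where
  fst_functional := inf_eq_left.1 (hf _ _ fun j => by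
    simp only [map_inf, (f j).map_conv', (f j).map_comp', (f j).map_ident']
    exact inf_eq_left.2 (h j).fst_functional)
  snd_functional := inf_eq_left.1 (hf _ _ fun j => by
    simp only [map_inf, (f j).map_conv', (f j).map_comp', (f j).map_ident']
    exact inf_eq_left.2 (h j).snd_functional)
  pairing := hf _ _ fun j => by
    rw [(f j).map_comp', (f j).map_conv', (h j).pairing, map_top]

/-- Terms in the similarity type of `ω`-dimensional cylindric algebras, over the variables `V`. -/
inductive CylTerm (V : Type u) : Type u
  | var (a : V)
  | bot
  | top
  | sup (s t : CylTerm V)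
  | inf (s t : CylTerm V)
  | compl (s : CylTerm V)
  | cyl (i : Dim ⊤) (s : CylTerm V)
  | diag (i j : Dim ⊤)

/-- Evaluation of terms. -/
def CylTerm.eval {V : Type u} {A : Type v} [BooleanAlgebra A] [CylAlg (Dim ⊤) A] (f : V → A) :
    CylTerm V → A
  | var a => f a
  | bot => ⊥
  | top => ⊤
  | sup s t => s.eval f ⊔ t.eval f
  | inf s t => s.eval f ⊓ t.eval f
  | compl s => (s.eval f)ᶜ
  | cyl i s => c i (s.eval f)
  | diag i j => d i j

theorem small_cylSub {V : Type u} {A : Type v} [BooleanAlgebra A] [CylAlg (Dim ⊤) A] (f : V → A) :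
    Small.{u} (cylSub (Dim ⊤) (Set.range f)) := by
  have key : ∀ x, CylGen (Dim ⊤) (Set.range f) x → ∃ t : CylTerm V, t.eval f = x := fun x hx => by
    induction hx with
    | base hx => obtain ⟨a, rfl⟩ := hx; exact ⟨.var a, rfl⟩
    | bot => exact ⟨.bot, rfl⟩
    | top => exact ⟨.top, rfl⟩
    | sup _ _ h1 h2 => obtain ⟨s, rfl⟩ := h1; obtain ⟨t, rfl⟩ := h2; exact ⟨.sup s t, rfl⟩
    | inf _ _ h1 h2 => obtain ⟨s, rfl⟩ := h1; obtain ⟨t, rfl⟩ := h2; exact ⟨.inf s t, rfl⟩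
    | compl _ h => obtain ⟨s, rfl⟩ := h; exact ⟨.compl s, rfl⟩
    | cyl i _ h => obtain ⟨s, rfl⟩ := h; exact ⟨.cyl i s, rfl⟩
    | diag i j => exact ⟨.diag i j, rfl⟩
  choose t ht using fun x : cylSub (Dim ⊤) (Set.range f) => key x.1 x.2
  exact small_of_injective (f := t) fun x y h => Subtype.ext (by rw [← ht x, h, ht y])

/-- A projection of a product of cylindric algebras. -/
def CylHom.eval {I : Type w} {J : Type u} {A : J → Type v} [∀ j, BooleanAlgebra (A j)]
    [∀ j, CylAlg I (A j)] (j : J) : CylHom I (∀ j, A j) (A j) where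
  toFun x := x j
  map_sup' _ _ := rfl
  map_inf' _ _ := rfl
  map_top' := rfl
  map_bot' := rfl
  map_c' _ _ := rfl
  map_d' _ _ := rfl

/-- Composition of homomorphisms of cylindric algebras in different universes. -/
def CylHom.comp {I : Type w} {A : Type*} {B : Type*} {C : Type*} [BooleanAlgebra A] [CylAlg I A]
    [BooleanAlgebra B] [CylAlg I B] [BooleanAlgebra C] [CylAlg I C]
    (g : CylHom I B C) (f : CylHom I A B) : CylHom I A C where
  toBoundedLatticeHom := g.toBoundedLatticeHom.comp f.toBoundedLatticeHom
  map_c' i x := by simp [f.map_c', g.map_c']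
  map_d' i j := by simp [f.map_d', g.map_d']

/-- Inside the product of all targets of `A`, the images of `A` together with the distinguished
pairs generate an algebra through which every target map factors by a projection. The factorization
is unique because homomorphisms are determined on generators. -/
theorem exists_free_pointed (A : LfCat.{u}) :
    ∃ (F : PointedLf.{u}) (φ : A ⟶ F.alg), ∀ (B : PointedLf.{u}) (ψ : A ⟶ B.alg),
      ∃! h : F ⟶ B, φ ≫ h.hom = ψ := by
  let J := Σ B : PointedLf.{u}, (A ⟶ B.alg)
  let ψ : ∀ j : J, CylHom (Dim ⊤) A.carrier j.1.alg.carrier := fun j => j.2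
  let var : A.carrier ⊕ Bool → ∀ j : J, j.1.alg.carrier
    | .inl a => fun j => ψ j a
    | .inr true => fun j => j.1.p.val
    | .inr false => fun j => j.1.q.val
  -- The product need not be locally finite, but each generator has a dimension set bounded
  -- uniformly over the factors: that of `a` in `A`, or `{0, 1}`.
  have hfix : ∀ x ∈ Set.range var, {k : Dim ⊤ | c k x ≠ x}.Finite := by
    rintro _ ⟨a | b, rfl⟩
    · refine (A.lf a).subset fun k hk h => hk (funext fun j => ?_)
      exact ((ψ j).map_c' k a).symm.trans (congrArg (ψ j) h)
    · refine (Set.toFinite {Dim.ofNat 0, Dim.ofNat 1}).subset fun k hk => ?_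
      by_contra h
      rw [Set.mem_insert_iff, Set.mem_singleton_iff, not_or] at h
      cases b with
      | true => exact hk (funext fun j => j.1.p.2 k h)
      | false => exact hk (funext fun j => j.1.q.2 k h)
  -- The product lives in a larger universe. Its generated subalgebra is no larger than the set of
  -- terms over the generators, so it has a copy in the original one.
  have := small_cylSub var
  obtain ⟨F, _, _, e, he⟩ :=
    CylAlg.exists_small_copy.{u} (I := Dim ⊤) (cylSub (Dim ⊤) (Set.range var))
  let ev : ∀ j : J, CylHom (Dim ⊤) F j.1.alg.carrier := fun j =>
    (CylHom.eval j).comp ((cylSub.incl _).comp e)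
  have hev : ∀ x y : F, (∀ j, ev j x = ev j y) → x = y := fun x y h =>
    he.1 (Subtype.ext (funext h))
  have hlf : IsLf F := fun x => (finite_dim_of_cylGen hfix (e x).2).subset fun k hk h =>
    hk (he.1 (by rw [e.map_c']; exact Subtype.ext h))
  choose g hg using fun a => he.2 ⟨var a, CylGen.base ⟨a, rfl⟩⟩
  have hgv : ∀ a j, ev j (g a) = var a j := fun a j =>
    congrArg (fun z : cylSub (Dim ⊤) (Set.range var) => z.1 j) (hg a)
  let φ : CylHom (Dim ⊤) A.carrier F :=
    { toFun := fun a => g (.inl a)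
      map_sup' := fun x y => hev _ _ fun j => by
        rw [map_sup, hgv, hgv, hgv]; exact map_sup (ψ j).toBoundedLatticeHom x y
      map_inf' := fun x y => hev _ _ fun j => by
        rw [map_inf, hgv, hgv, hgv]; exact map_inf (ψ j).toBoundedLatticeHom x y
      map_top' := hev _ _ fun j => by
        rw [map_top, hgv]; exact map_top (ψ j).toBoundedLatticeHom
      map_bot' := hev _ _ fun j => by
        rw [map_bot, hgv]; exact map_bot (ψ j).toBoundedLatticeHom
      map_c' := fun i x => hev _ _ fun j => by
        rw [(ev j).map_c']
        change ev j (g _) = c i (ev j (g _))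
        rw [hgv, hgv]; exact (ψ j).map_c' i x
      map_d' := fun i k => hev _ _ fun j => by
        rw [(ev j).map_d']
        change ev j (g _) = _
        rw [hgv]; exact (ψ j).map_d' i k }
  let p : RaOmega F := ⟨g (.inr true), fun l hl => hev _ _ fun j => by
    rw [(ev j).map_c', hgv]; exact j.1.p.2 l hl⟩
  let q : RaOmega F := ⟨g (.inr false), fun l hl => hev _ _ fun j => by
    rw [(ev j).map_c', hgv]; exact j.1.q.2 l hl⟩
  have hevr : ∀ x y : RaOmega F, (∀ j, (ev j).ra x = (ev j).ra y) → x = y := fun x y h =>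
    Ra.ext (hev _ _ fun j => congrArg Ra.val (h j))
  have hp : ∀ j, (ev j).ra p = j.1.p := fun j => Ra.ext (hgv (.inr true) j)
  have hq : ∀ j, (ev j).ra q = j.1.q := fun j => Ra.ext (hgv (.inr false) j)
  have hpq : IsQuasiProj p q := IsQuasiProj.of_jointly_injective (fun j => (ev j).ra) hevr
    fun j => by rw [hp, hq]; exact j.1.quasi
  let P : PointedLf.{u} := ⟨⟨F, hlf⟩, IsRelAlg.of_jointly_injective (fun j => (ev j).ra) hevr
    fun j => j.1.isRelAlg, p, q, hpq⟩
  have hgen : ∀ x : F, CylGen (Dim ⊤) (Set.range g) x := fun x => by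
    have h1 : CylGen (Dim ⊤) (e '' Set.range g) (e x) := by
      refine gen_mono_of (fun y hy => .base ?_) (cylSub.gen (e x).2)
      obtain ⟨a, ha⟩ := hy
      exact ⟨g a, ⟨a, rfl⟩, (hg a).trans (Subtype.ext ha)⟩
    obtain ⟨x', hx', h2⟩ := e.exists_of_gen h1
    rwa [← he.1 h2]
  refine ⟨P, φ, fun B χ => ⟨⟨ev ⟨B, χ⟩, hp ⟨B, χ⟩, hq ⟨B, χ⟩⟩, ?_, fun h hh => ?_⟩⟩
  · exact CylHom.ext' fun a => hgv (.inl a) ⟨B, χ⟩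
  · refine PointedLf.Hom.ext (CylHom.ext' fun x => CylHom.eq_on_gen ?_ (hgen x))
    rintro _ ⟨a | b, rfl⟩
    · refine Eq.trans ?_ (hgv (.inl a) ⟨B, χ⟩).symm
      exact congrArg (fun k : CylHom (Dim ⊤) A.carrier B.alg.carrier => k a) hh
    · cases b with
      | true => exact (congrArg Ra.val h.map_p).trans (congrArg Ra.val (hp ⟨B, χ⟩)).symm
      | false => exact (congrArg Ra.val h.map_q).trans (congrArg Ra.val (hq ⟨B, χ⟩)).symm

/-- The free pointed algebra over `A` is an initial object of the comma category under `A`; having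
one for every `A` is the general criterion for a left adjoint. -/
theorem forget_isRightAdjoint : (PointedLf.forget.{u}).IsRightAdjoint := by
  have : ∀ A : LfCat.{u}, Limits.HasInitial (StructuredArrow A PointedLf.forget.{u}) := fun A => by
    obtain ⟨F, φ, hF⟩ := exists_free_pointed A
    let X : StructuredArrow A PointedLf.forget.{u} := StructuredArrow.mk (Y := F) φ
    refine Limits.IsInitial.hasInitial (X := X) (Limits.IsInitial.ofUniqueHom
      (fun Y => StructuredArrow.homMk (hF Y.right Y.hom).choose
        (hF Y.right Y.hom).choose_spec.1) fun Y m => ?_)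
    exact StructuredArrow.hom_ext _ _
      ((hF Y.right Y.hom).choose_spec.2 m.right (StructuredArrow.w m))
  exact isRightAdjointOfStructuredArrowInitials _

theorem mainTheorem7 :
    -- every quasi-projective relation algebra is, for each `4 ≤ n ≤ ω`, the `Ra`-reduct of an
    -- `A ∈ S Nr_3 CA_n` with the `Ra S` property, unique up to a unique isomorphism over `Q`, and
    -- embedding over `Q` into every `B ∈ S Nr_3 CA_n` with `Q = Ra B`
    (∀ (Q : Type u) [BooleanAlgebra Q] [RelOps Q], IsQRA Q → ∀ n : ℕ∞, 4 ≤ n →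
      ∃ (A : Type u) (_ : BooleanAlgebra A) (_ : CylAlg (Dim 3) A) (e : RAHom Q (Ra3 A)),
        IsDilation3 n e ∧
        (∀ (B : Type u) [BooleanAlgebra B] [CylAlg (Dim 3) B] (f : RAHom Q (Ra3 B)),
          IsDilation3 n f →
            ∃! h : CylHom (Dim 3) A B, Function.Bijective h ∧ ∀ x, h (e x).val = (f x).val) ∧
        ∀ (B : Type u) [BooleanAlgebra B] [CylAlg (Dim 3) B] (f : RAHom Q (Ra3 B)),
          IsSNr 3 n B → Function.Bijective f →
            ∃! h : CylHom (Dim 3) A B, Function.Injective h ∧ ∀ x, h (e x).val = (f x).val) ∧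
    -- isomorphisms of `Ra`-reducts lift to isomorphisms of the dilations
    (∀ n : ℕ∞, 4 ≤ n → ∀ (A B : Type u) [BooleanAlgebra A] [CylAlg (Dim 3) A]
      [BooleanAlgebra B] [CylAlg (Dim 3) B],
      IsSNr 3 n A → IsSNr 3 n B → IsQRA (Ra3 A) →
      cylSg (Dim 3) (Set.range fun x : Ra3 A => x.val) = Set.univ →
      cylSg (Dim 3) (Set.range fun x : Ra3 B => x.val) = Set.univ →
      ∀ g : RAHom (Ra3 A) (Ra3 B), Function.Bijective g →
        ∃! h : CylHom (Dim 3) A B, Function.Bijective h ∧ ∀ x : Ra3 A, h x.val = (g x).val) ∧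
    -- every quasi-projective relation algebra has an `ω`-dilation, unique in `Lf_ω`
    (∀ (Q : Type u) [BooleanAlgebra Q] [RelOps Q], IsQRA Q →
      ∃ (A : Type u) (_ : BooleanAlgebra A) (_ : CylAlg (Dim ⊤) A) (e : RAHom Q (RaOmega A)),
        IsDilationOmega e ∧
        ∀ (B : Type u) [BooleanAlgebra B] [CylAlg (Dim ⊤) B] (f : RAHom Q (RaOmega B)),
          IsLf B → Function.Bijective f →
            ∃! h : CylHom (Dim ⊤) A B, Function.Bijective h ∧ ∀ x, h (e x).val = (f x).val) ∧
    -- `Ra` is an equivalence of categories, both for all homomorphisms and with distinguished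
    -- quasi-projections; in the latter form the subcategory of `Lf_ω` is reflective
    (raQRA.{u}).IsEquivalence ∧
    (raPointed.{u}).IsEquivalence ∧
    (PointedLf.forget.{u}).Faithful ∧
    (PointedLf.forget.{u}).IsRightAdjoint := by
  refine ⟨fun Q _ _ hQ n hn => ?_, fun n hn A B _ _ _ _ hA hB _ hgA hgB g hg =>
    existsUnique_extension_three hn hA hB hgA hgB g hg, fun Q _ _ hQ => ?_,
    raQRA_isEquivalence, raPointed_isEquivalence, forget_faithful, forget_isRightAdjoint⟩
  · obtain ⟨A, i1, i2, e, he⟩ := exists_dilation_three Q hQ n hn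
    exact ⟨A, i1, i2, e, he, fun B _ _ f hf => existsUnique_iso_three hn he hf,
      fun B _ _ f hB hf => existsUnique_embedding_three hn he hB hf⟩
  · obtain ⟨A, i1, i2, e, he⟩ := exists_dilation_omega Q hQ
    exact ⟨A, i1, i2, e, he, fun B _ _ f hB hf => existsUnique_iso_omega hQ he hB hf⟩
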